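/- A metric graph $\Gamma$ is the compact connected space obtained from a finite connected multigraph $G$ with edge lengths $l(e)\in(0,\infty]$ by identifying each edge $e$ with $[0,l(e)]$; length $\infty$ is allowed only for leaf edges, whose leaf end is then the point $\infty$ (a point at infinity). $\Gamma$ carries the path metric (with value $\infty$ allowed), and each $(G,l)$ giving $\Gamma$ with this metric is a model of $\Gamma$. A rational function on $\Gamma$ is the constant $-\infty$ or a piecewise linear function with integer slopes and finitely many pieces, infinite at most at points at infinity; in the latter case $\mathrm{div}(f)$ has as coefficient at $x$ the sum of the outgoing slopes of $f$ at $x$. For a divisor $D$, $R(D)$ consists of $-\infty$ and of the rational functions $f$ with $D+\mathrm{div}(f)\ge 0$. Let a finite group $K$ act on $\Gamma$ by isometric homeomorphisms, let $D$ be a $K$-invariant effective divisor on $\Gamma$, and let $F=(f_0,\dots,f_n)$ be a finite generating set of the tropical semimodule $R(D)^K$ of $K$-invariant elements of $R(D)$ (every element is $\max_i(c_i+f_i)$ with $c_i\in\mathbb R\cup\{-\infty\}$). Let $\phi_F:\Gamma\to\mathbb{TP}^n$, $x\mapsto(f_0(x):\cdots:f_n(x))$, be the associated rational map, extended by continuity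 to the points at infinity where some $f_i$ is $+\infty$. Here $\mathbb{TP}^n=((\mathbb R\cup\{-\infty\})^{n+1}\setminus\{(-\infty,\dots,-\infty)\})/\mathbb R(1,\dots,1)$, and the lattice length of a segment from $p$ to $p+\lambda w$, with $\lambda \geq 0$ and $w$ an integral vector which is primitive modulo $(1,\dots,1)$, is $\lambda$. Call $\phi_F$ $K$-injective if $\phi_F(x)\ne\phi_F(x')$ whenever $Kx\neq Kx'$. (1) If $\phi_F$ is $K$-injective, then $\phi_F$ is a local isometry onto its image for the lattice length: $\Gamma$ has a model such that on each edge $\phi_F$ maps distances along the edge to lattice distances. (2) $\phi_F$ is $K$-injective if and only if it induces a $K$-Galois covering $\Gamma\to\mathrm{Im}(\phi_F)$ with edge-multiplicities $\mathbf 1$ on $\Gamma$ and $m'(\phi_F(e))=|K_e|$ on the image, where $K_e$ is the stabilizer of the edge $e$. The latter means that there are loopless models $(G,l)$ of $\Gamma$ and $(G',l')$ of $\mathrm{Im}(\phi_F)$, the edges of $G'$ being segments with $l'$ the lattice length, such that: $\phi_F$ is continuous, maps vertices to vertices and each edge $e$ of $G$ onto an edge of $G'$ by a dilation with positive integral factor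 $\deg_e$, the inverse image of the interior of an edge of $G'$ being a union of interiors of edges of $G$; there is $m':E(G')\to\mathbb Z_{>0}$ with $m'(\phi_F(e))=|K_e|$ for all $e\in E(G)$; for each $x\in\Gamma$ the number $\deg_x=\sum_{h\ni x,\,h\mapsto h'}m'(\phi_F(e))\deg_e$ (summed over the half-edges $h$ at $x$ over $h'$, with $e$ the edge containing $h$) does not depend on the half-edge $h'$ at $\phi_F(x)$; $\sum_{x\mapsto x'}\deg_x=|K|$ for every $x'\in\mathrm{Im}(\phi_F)$ (no condition if $\Gamma$ is a singleton); and $K$ maps edges of $G$ to edges of $G$ and acts transitively on every fibre of $\phi_F$. -/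

import Mathlib

open Set Filter Topology
open scoped ENNReal NNReal Pointwise

noncomputable section

namespace TropicalGraph

/-! ### Metric graphs and their models -/

/-- The distance `|s - t|` of two parameters in the extended half-line `[0, ∞]`
(so it is `0` for `s = t = ∞` and `∞` when exactly one of them is `∞`). -/
def segLen (s t : ℝ≥0∞) : ℝ≥0∞ := max (s - t) (t - s)

/-- An edge-weighted finite multigraph `(G, l)` whose realization is the space `X`: a finite set of
vertices and finitely many edges, where the edge `e` is a copy of `[0, len e]`, glued into `X` by
`param e` (the values of `param e` beyond `len e` are irrelevant). Loops and multiple edges are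
allowed. An edge may have length `∞` only if its end at parameter `∞` is a leaf end. -/
structure GraphModel (X : Type*) [TopologicalSpace X] where
  V : Finset X
  E : Type
  [fintypeE : Fintype E]
  len : E → ℝ≥0∞
  param : E → ℝ≥0∞ → X
  len_pos : ∀ e, 0 < len e
  continuousOn_param : ∀ e, ContinuousOn (param e) (Icc 0 (len e))
  param_zero_mem : ∀ e, param e 0 ∈ V
  param_len_mem : ∀ e, param e (len e) ∈ V
  param_not_mem : ∀ e, ∀ t ∈ Ioo 0 (len e), param e t ∉ V
  param_inj : ∀ e e' t t', t ∈ Ioo 0 (len e) → t' ∈ Ioo 0 (len e') →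
    param e t = param e' t' → e = e' ∧ t = t'
  cover : ∀ x, x ∈ V ∨ ∃ e, ∃ t ∈ Ioo 0 (len e), param e t = x
  infinite_leaf : ∀ e, len e = ∞ → ∀ e',
    param e' 0 ≠ param e ∞ ∧ (param e' (len e') = param e ∞ → e' = e)

attribute [instance] GraphModel.fintypeE

namespace GraphModel

variable {X : Type*} [TopologicalSpace X]

/-- The closed edge `e` as a subset of the space. -/
def edge (M : GraphModel X) (e : M.E) : Set X := M.param e '' Icc 0 (M.len e)

/-- `M.Walk x y r`: there is a walk of total length `r` from `x` to `y`, composed of finitely many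
segments, each of which lies on an edge. -/
inductive Walk (M : GraphModel X) : X → X → ℝ≥0∞ → Prop
  | refl (x : X) : Walk M x x 0
  | step (e : M.E) (s t : ℝ≥0∞) (y : X) (r : ℝ≥0∞) (hs : s ≤ M.len e) (ht : t ≤ M.len e)
      (w : Walk M (M.param e t) y r) : Walk M (M.param e s) y (segLen s t + r)

/-- The path metric (an `∞`-metric) of the edge-weighted graph. -/
def dist (M : GraphModel X) (x y : X) : ℝ≥0∞ := sInf {r | M.Walk x y r}

/-- No edge is a loop. -/
def Loopless (M : GraphModel X) : Prop := ∀ e, M.param e 0 ≠ M.param e (M.len e)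

/-- The points at infinity: ends at parameter `∞` of edges of infinite length. -/
def IsPointAtInfinity (M : GraphModel X) (x : X) : Prop :=
  ∃ e, M.len e = ∞ ∧ M.param e ∞ = x

open Classical in
/-- The sum over the half-edges at `x` of the outgoing slopes, for a function with slope `m e`
along `e` (in the direction of the parametrization). It is `0` unless `x` is a vertex. -/
def slopeSum (M : GraphModel X) (m : M.E → ℤ) (x : X) : ℤ :=
  ∑ e, ((if M.param e 0 = x then m e else 0) - (if M.param e (M.len e) = x then m e else 0))

/-- `f` has on every edge `e` the constant slope `m e`, and takes the values `±∞` only at points at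
infinity. In `EReal` one has `0 * ⊤ = 0`, so that at a point at infinity the formula gives the
limit of `f` along the edge. -/
def HasSlopes (M : GraphModel X) (f : X → EReal) (m : M.E → ℤ) : Prop :=
  (∀ e, ∃ a : ℝ, ∀ t ≤ M.len e,
    f (M.param e t) = (a : EReal) + (((m e : ℤ) : ℝ) : EReal) * ((t : ℝ≥0∞) : EReal)) ∧
  ∀ x, f x = ⊤ ∨ f x = ⊥ → M.IsPointAtInfinity x

end GraphModel

/-- A metric graph: a (nonempty) connected Hausdorff space with an `∞`-metric `d` which is the path
metric of some edge-weighted finite graph. The topology is the compact one, in which an edge of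
infinite length is a copy of `[0, ∞]`. -/
class MetricGraph (Γ : Type*) [TopologicalSpace Γ] where
  d : Γ → Γ → ℝ≥0∞
  t2 : T2Space Γ
  connected : ConnectedSpace Γ
  exists_model : ∃ M : GraphModel Γ, M.dist = d

/-- `M` is a model of the metric graph `Γ`. -/
def IsModel {Γ : Type*} [TopologicalSpace Γ] [MetricGraph Γ] (M : GraphModel Γ) : Prop :=
  M.dist = MetricGraph.d

/-! ### Rational functions and the tropical semimodule `R(D)^K`

Divisors are elements of `Γ →₀ ℤ`; tropical functions have values in `EReal`. -/

section Rational

variable {Γ : Type*} [TopologicalSpace Γ] [MetricGraph Γ]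

/-- `f` is a rational function other than the constant `-∞` (piecewise linear with integer slopes
and finitely many pieces), and `P` is its principal divisor `div f`. -/
def IsPrincipalDivisor (f : Γ → EReal) (P : Γ →₀ ℤ) : Prop :=
  ∃ (M : GraphModel Γ) (m : M.E → ℤ), IsModel M ∧ M.HasSlopes f m ∧ ∀ x, P x = M.slopeSum m x

/-- `R(D)`: the rational functions `f` with `D + div f` effective, together with `-∞`. -/
def R (D : Γ →₀ ℤ) : Set (Γ → EReal) :=
  {f | (∀ x, f x = ⊥) ∨ ∃ P, IsPrincipalDivisor f P ∧ 0 ≤ D + P}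

/-- `R(D)^K`: the `K`-invariant elements of `R(D)`. -/
def RInv (K : Type*) [Group K] [MulAction K Γ] (D : Γ →₀ ℤ) : Set (Γ → EReal) :=
  {f | f ∈ R D ∧ ∀ (σ : K) (x : Γ), f (σ • x) = f x}

/-- The finite family `F` is a generating set of the tropical semimodule `R(D)^K`: its members lie
in `R(D)^K`, and every element is a tropical linear combination `max_i (c_i + F_i)` with
`c_i ∈ ℝ ∪ {-∞}` (in `EReal`, `⊥ + y = ⊥` for all `y`). -/
def Generates (K : Type*) [Group K] [MulAction K Γ] (D : Γ →₀ ℤ) {n : ℕ}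
    (F : Fin (n + 1) → Γ → EReal) : Prop :=
  (∀ i, F i ∈ RInv K D) ∧
  ∀ g ∈ RInv K D, ∃ c : Fin (n + 1) → EReal, (∀ i, c i ≠ ⊤) ∧ ∀ x, g x = ⨆ i, (c i + F i x)

end Rational

/-! ### Tropical projective space -/

/-- `T^(n+1)` without the point `(-∞, …, -∞)`, where `T = ℝ ∪ {-∞}`. -/
def TropVec (n : ℕ) : Type :=
  {v : Fin (n + 1) → EReal // (∀ i, v i ≠ ⊤) ∧ ∃ i, v i ≠ ⊥}

instance (n : ℕ) : TopologicalSpace (TropVec n) :=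
  inferInstanceAs (TopologicalSpace {v : Fin (n + 1) → EReal // (∀ i, v i ≠ ⊤) ∧ ∃ i, v i ≠ ⊥})

/-- Vectors are equivalent when they differ by a tropical (i.e. additive) real scalar. -/
instance tropSetoid (n : ℕ) : Setoid (TropVec n) where
  r v w := ∃ c : ℝ, ∀ i, v.1 i = (c : EReal) + w.1 i
  iseqv := by
    refine ⟨fun v => ⟨0, fun i => by simp⟩, ?_, ?_⟩
    · rintro v w ⟨c, h⟩
      refine ⟨-c, fun i => ?_⟩
      rw [h i, ← add_assoc, ← EReal.coe_add]
      simp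
    · rintro u v w ⟨c, h⟩ ⟨c', h'⟩
      refine ⟨c + c', fun i => ?_⟩
      rw [h i, h' i, ← add_assoc, ← EReal.coe_add]

/-- The tropical projective space `TP^n`, with the quotient topology. -/
def TP (n : ℕ) : Type := Quotient (tropSetoid n)

instance (n : ℕ) : TopologicalSpace (TP n) :=
  inferInstanceAs (TopologicalSpace (Quotient (tropSetoid n)))

/-- The point `(v 0 : … : v n)`. -/
def TP.mk {n : ℕ} (v : TropVec n) : TP n := Quotient.mk (tropSetoid n) v

instance (n : ℕ) : Nonempty (TP n) :=
  ⟨TP.mk ⟨fun _ => 0, fun _ => EReal.zero_ne_top, 0, EReal.zero_ne_bot⟩⟩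

/-- `q - p = l • w` in the affine structure of `TP^n`, where `w` is a primitive integral vector:
the greatest common divisor of the differences `w i - w j` is one, `i` and `j` running over the
coordinates that are not `-∞`. -/
def HasLatticeLength {n : ℕ} (p q : TP n) (l : ℝ≥0) : Prop :=
  ∃ (u v : TropVec n) (w : Fin (n + 1) → ℤ), TP.mk u = p ∧ TP.mk v = q ∧
    (∀ i, v.1 i = u.1 i + (((l : ℝ) * (w i : ℝ) : ℝ) : EReal)) ∧
    ∀ k : ℕ, (∀ i j, u.1 i ≠ ⊥ → u.1 j ≠ ⊥ → (k : ℤ) ∣ w i - w j) → k = 1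

open Classical in
/-- The lattice length distance on `TP^n`; it is `∞` if `q - p` is not a real multiple of an
integral vector, in particular between a point with finite coordinates and one with a coordinate
`-∞`. -/
def latticeDist {n : ℕ} (p q : TP n) : ℝ≥0∞ :=
  if p = q then 0 else ⨅ (l : ℝ≥0) (_ : HasLatticeLength p q l), (l : ℝ≥0∞)

/-- For a subset of `TP^n` and a graph structure on it: all edges are straight segments of rational
slope which are parametrized by lattice length. This makes the subset a metric graph. -/
def IsLatticeModel {n : ℕ} {S : Set (TP n)} (M : GraphModel S) : Prop :=
  ∀ e, ∀ s ≤ M.len e, ∀ t ≤ M.len e,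
    latticeDist (M.param e s : TP n) (M.param e t : TP n) = segLen s t

/-! ### The rational map of a family of functions -/

section RationalMap

variable {Γ : Type*} [TopologicalSpace Γ]

/-- The points at which `(F 0 x, …, F n x)` is a vector of homogeneous coordinates. -/
def regularPts {n : ℕ} (F : Fin (n + 1) → Γ → EReal) : Set Γ :=
  {x | (∀ i, F i x ≠ ⊤) ∧ ∃ i, F i x ≠ ⊥}

/-- `x ↦ (F 0 x : … : F n x)` on the points where this makes sense. -/
def homCoord {n : ℕ} (F : Fin (n + 1) → Γ → EReal) (x : regularPts F) : TP n :=
  TP.mk ⟨fun i => F i x.1, x.2⟩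

open Classical in
/-- The rational map `x ↦ (F 0 x : … : F n x)`; at a point (at infinity) where some `F i` is `+∞`,
it is defined as the limit of its values at the nearby points. -/
def rationalMap {n : ℕ} (F : Fin (n + 1) → Γ → EReal) (x : Γ) : TP n :=
  if h : x ∈ regularPts F then homCoord F ⟨x, h⟩
  else limUnder (comap ((↑) : regularPts F → Γ) (𝓝 x)) (homCoord F)

/-- `φ` separates distinct `K`-orbits. -/
def KInjective (K : Type*) [Group K] [MulAction K Γ] {Y : Type*} (φ : Γ → Y) : Prop :=
  ∀ x y : Γ, MulAction.orbit K x ≠ MulAction.orbit K y → φ x ≠ φ y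

/-- `φ` is a local isometry for the lattice length: `Γ` has a model on each edge of which `φ`
preserves distances. -/
def IsLocalIsometry [MetricGraph Γ] {n : ℕ} (φ : Γ → TP n) : Prop :=
  ∃ M : GraphModel Γ, IsModel M ∧ ∀ e, ∀ s ≤ M.len e, ∀ t ≤ M.len e,
    latticeDist (φ (M.param e s)) (φ (M.param e t)) = segLen s t

end RationalMap

/-! ### Finite harmonic morphisms with edge-multiplicities, Galois coverings -/

section Morphisms

variable {X Y : Type*} [TopologicalSpace X] [TopologicalSpace Y]

/-- `φ` is a finite morphism for the models `M` and `M'`: it is continuous, maps vertices to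
vertices, the inverse image of the relative interior of an edge `e'` is the union of the relative
interiors of the edges over `e'`, and `φ` maps each edge `e` to the edge `edgeMap e` by a dilation
with the positive integral factor `deg e` (preserving or reversing the parametrization). -/
structure FiniteMorphism (M : GraphModel X) (M' : GraphModel Y) (φ : X → Y) where
  edgeMap : M.E → M'.E
  deg : M.E → ℕ
  deg_pos : ∀ e, 0 < deg e
  continuous : Continuous φ
  map_vertex : ∀ x ∈ M.V, φ x ∈ M'.V
  preimage_interior : ∀ e', φ ⁻¹' (M'.param e' '' Ioo 0 (M'.len e')) =
    ⋃ e ∈ {e | edgeMap e = e'}, M.param e '' Ioo 0 (M.len e)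
  len_edgeMap : ∀ e, M'.len (edgeMap e) = deg e * M.len e
  dilation : ∀ e,
    (∀ t ≤ M.len e, φ (M.param e t) = M'.param (edgeMap e) (deg e * t)) ∨
    (M.len e ≠ ∞ ∧
      ∀ t ≤ M.len e, φ (M.param e t) = M'.param (edgeMap e) (M'.len (edgeMap e) - deg e * t))

variable {M : GraphModel X} {M' : GraphModel Y} {φ : X → Y}

open Classical in
/-- The sum of `m'(φ(e)) / m(e) * deg e` over the edges `e` at `x` which lie over `e'`. As the
models are loopless, for a vertex `x` the half-edges at `x` correspond to the edges containing `x`,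
and for `x` in the relative interior of `e` both half-edges at `x` contribute the same, one to each
half-edge at `φ x`. -/
def FiniteMorphism.degAt (ψ : FiniteMorphism M M' φ) (m : M.E → ℕ+) (m' : M'.E → ℕ+)
    (x : X) (e' : M'.E) : ℕ :=
  ∑ e ∈ Finset.univ.filter (fun e => x ∈ M.edge e ∧ ψ.edgeMap e = e'),
    ((m' e' : ℕ) / (m e : ℕ)) * ψ.deg e

/-- Harmonicity at every point, with respect to edge-multiplicities `m` and `m'`. -/
def FiniteMorphism.IsHarmonic (ψ : FiniteMorphism M M' φ) (m : M.E → ℕ+) (m' : M'.E → ℕ+) :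
    Prop :=
  ∀ x : X, (∀ e, x ∈ M.edge e → (m e : ℕ) ∣ (m' (ψ.edgeMap e) : ℕ)) ∧
    ∀ e₁ e₂, φ x ∈ M'.edge e₁ → φ x ∈ M'.edge e₂ → ψ.degAt m m' x e₁ = ψ.degAt m m' x e₂

/-- The degree of `ψ` is `k`: over every point `y` of the target, and for every choice of a
half-edge at `y`, the local degrees add up to `k`. There is no condition if the target is a
singleton; then the source is a singleton, too, by finiteness, and such a map is regarded as having
any degree. -/
def FiniteMorphism.HasDegree (ψ : FiniteMorphism M M' φ) (m : M.E → ℕ+) (m' : M'.E → ℕ+)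
    (k : ℕ) : Prop :=
  ∀ (y : Y) (e' : M'.E), y ∈ M'.edge e' → ∑ᶠ x ∈ φ ⁻¹' {y}, ψ.degAt m m' x e' = k

/-- `φ` is a `K`-Galois covering for the edge-multiplicities `m` and `m'`: a finite harmonic
morphism of degree `|K|` such that `K` acts transitively on each fibre and respects the edges, their
lengths and their multiplicities. -/
structure FiniteMorphism.IsGalois (K : Type*) [Group K] [MulAction K X]
    (ψ : FiniteMorphism M M' φ) (m : M.E → ℕ+) (m' : M'.E → ℕ+) : Prop where
  harmonic : ψ.IsHarmonic m m'
  degree : ψ.HasDegree m m' (Nat.card K)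
  invariant : ∀ (σ : K) (x : X), φ (σ • x) = φ x
  transitive : ∀ x y : X, φ x = φ y → ∃ σ : K, σ • x = y
  keeps : ∀ (σ : K) (e : M.E), ∃ e₁ : M.E, σ • M.edge e = M.edge e₁ ∧ M.len e₁ = M.len e ∧
    m e₁ = m e

end Morphisms

/-- `φ : Γ → TP^n` induces a `K`-Galois covering onto its image with the edge-multiplicity `1` on
`Γ` and the edge-multiplicity `φ(e) ↦ |K_e|` on the image, where `K_e` is the stabilizer of `e`: this
is so for some loopless model of `Γ` and some loopless model of the image, in which lengths are
lattice lengths. -/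
def InducesGaloisCovering {Γ : Type*} [TopologicalSpace Γ] [MetricGraph Γ] (K : Type*) [Group K]
    [MulAction K Γ] {n : ℕ} (φ : Γ → TP n) : Prop :=
  ∃ (M : GraphModel Γ) (M' : GraphModel (range φ)),
    IsModel M ∧ M.Loopless ∧ IsLatticeModel M' ∧ M'.Loopless ∧
    ∃ (m' : M'.E → ℕ+) (ψ : FiniteMorphism M M' (rangeFactorization φ)),
      ψ.IsGalois K (fun _ => 1) m' ∧
      ∀ e : M.E, (m' (ψ.edgeMap e) : ℕ) = Nat.card (MulAction.stabilizer K (M.edge e))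

end TropicalGraph

end

open Set Filter Topology
open scoped ENNReal NNReal Pointwise

noncomputable section

namespace TropicalGraph

/-! ### Distances along segments -/

/-! Choose a model of `Γ` with `K`-invariant vertex set on whose edges all generators are affine
(`exists_isAdapted`). Along an edge the rational map is then an affine path whose direction is the
vector of slopes `m i`, and it is parametrized by lattice length as soon as two of these slopes
differ by exactly one (`latticeDist_linVec`).

Slopes of elements of `R(D)^K` are slopes of generators: such an element is a finite maximum of
translates `c i + F i`, so on infinitely many points of an edge one index attains the maximum twice,
and two affine functions which agree at two points have the same slope (`exists_slope_eq`). As `D`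
is effective, constants lie in `R(D)^K`, hence slope `0` occurs on every edge. If some generator `f`
has slope `m ≠ 0` on an edge, it is truncated to `bendFun`: this is `max f c`, except that on a
short range of values of `f` the slope `m` is replaced by its sign. The result is invariant. It
dominates `f` and `c`, and at each vertex of a suitable subdivision it agrees with one of them, so
its sum of outgoing slopes is at least that of the function it agrees with there, and it stays in
`R(D)^K`. Hence slope `1` or `-1` occurs too. In the remaining case all slopes on the edge vanish
and the map is constant there; then `K`-injectivity would put the infinitely many points of the edge
into one finite orbit.

For the Galois covering, invariance and `K`-injectivity say that the fibres of the map are the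
`K`-orbits, so the image is the quotient `Γ/K`. After barycentric subdivision no edge is inverted,
the quotient graph is a loopless model of the image, and each edge maps isometrically to its orbit.
By orbit-stabilizer the local degree at `x` is `|K_x|` for every half-edge at the image point
(`degAt_quotientMorphism`); this is harmonicity, and summing over an orbit gives `|K|`. Conversely,
transitivity on fibres is part of the definition of a Galois covering and is `K`-injectivity.

Underneath lies a rigidity statement: a model is determined, up to orientation of edges, by its
vertices and its path metric (`exists_sameEdge`). It lets slopes be compared on common refinements,
and it makes isometries that preserve the vertices map edges to edges. -/

lemma segLen_self (s : ℝ≥0∞) : segLen s s = 0 := by simp [segLen]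

lemma segLen_comm (s t : ℝ≥0∞) : segLen s t = segLen t s := max_comm _ _

lemma segLen_of_le {s t : ℝ≥0∞} (h : s ≤ t) : segLen s t = t - s := by
  simp [segLen, tsub_eq_zero_of_le h]

lemma segLen_triangle (s t u : ℝ≥0∞) : segLen s u ≤ segLen s t + segLen t u := by
  refine max_le ?_ ?_
  · exact tsub_le_tsub_add_tsub.trans (add_le_add (le_max_left _ _) (le_max_left _ _))
  · rw [add_comm]
    exact tsub_le_tsub_add_tsub.trans (add_le_add (le_max_right _ _) (le_max_right _ _))

lemma segLen_zero_left (s : ℝ≥0∞) : segLen 0 s = s := by simp [segLen]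

lemma segLen_add_left {a : ℝ≥0∞} (ha : a ≠ ∞) (s t : ℝ≥0∞) :
    segLen (a + s) (a + t) = segLen s t := by
  simp [segLen, ENNReal.add_sub_add_eq_sub_left ha]

lemma segLen_ofReal {s t : ℝ} (hs : 0 ≤ s) (ht : 0 ≤ t) :
    segLen (ENNReal.ofReal s) (ENNReal.ofReal t) = ENNReal.ofReal |s - t| := by
  wlog h : s ≤ t generalizing s t
  · rw [segLen_comm, this ht hs (le_of_not_ge h), abs_sub_comm]
  rw [segLen_of_le (ENNReal.ofReal_le_ofReal h), ← ENNReal.ofReal_sub _ hs,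
    abs_sub_comm, abs_of_nonneg (sub_nonneg.2 h)]

lemma segLen_top_left {t : ℝ≥0∞} (ht : t ≠ ∞) : segLen ∞ t = ∞ := by
  rw [segLen_comm, segLen_of_le le_top, ENNReal.top_sub ht]

/-- Distance to a fixed parameter is 1-Lipschitz. Together with `segLen_min_le` this bounds the
truncated distance in `exists_ball`. -/
lemma segLen_segLen_le (s p q : ℝ≥0∞) : segLen (segLen s p) (segLen s q) ≤ segLen p q := by
  refine max_le ?_ ?_ <;> rw [tsub_le_iff_right]
  · rw [add_comm, segLen_comm p q]
    exact segLen_triangle s q p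
  · rw [add_comm]
    exact segLen_triangle s p q

lemma segLen_min_le (r p q : ℝ≥0∞) : segLen (min r p) (min r q) ≤ segLen p q := by
  wlog h : p ≤ q generalizing p q
  · rw [segLen_comm, segLen_comm p]
    exact this _ _ (le_of_not_ge h)
  rw [segLen_of_le h, segLen_of_le (min_le_min_left r h), tsub_le_iff_right]
  rcases le_total r p with hr | hr
  · rw [min_eq_left hr]
    exact (min_le_left _ _).trans le_add_self
  · rw [min_eq_right hr, tsub_add_cancel_of_le h]
    exact min_le_right _ _

lemma continuous_segLen {s : ℝ≥0∞} (hs : s ≠ ∞) : Continuous (segLen s) :=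
  (ENNReal.continuous_sub_left hs).max (ENNReal.continuous_sub_right s)

namespace GraphModel

variable {X : Type*} [TopologicalSpace X] (M N : GraphModel X)

/-! ### The path metric of a model -/

lemma Walk.trans {M : GraphModel X} {x y z : X} {r r' : ℝ≥0∞} (h : M.Walk x y r)
    (h' : M.Walk y z r') : M.Walk x z (r + r') := by
  induction h with
  | refl x => simpa using h'
  | step e s t y r hs ht w ih => rw [add_assoc]; exact Walk.step e s t z _ hs ht (ih h')

lemma dist_le_segLen (e : M.E) {s t : ℝ≥0∞} (hs : s ≤ M.len e) (ht : t ≤ M.len e) :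
    M.dist (M.param e s) (M.param e t) ≤ segLen s t :=
  sInf_le (by simpa using Walk.step e s t _ 0 hs ht (Walk.refl _))

lemma dist_triangle (x y z : X) : M.dist x z ≤ M.dist x y + M.dist y z := by
  unfold dist
  rw [ENNReal.sInf_add]
  refine le_iInf₂ fun r hr => ?_
  rw [ENNReal.add_sInf]
  exact le_iInf₂ fun r' hr' => sInf_le (Walk.trans hr hr')

/-- The bound adds up over the segments of a walk. So the path metric is the largest `ρ` with these
properties, which gives lower bounds for it without further inspection of walks. -/
lemma le_dist (ρ : X → X → ℝ≥0∞) (h0 : ∀ x, ρ x x = 0) (h1 : ∀ x y z, ρ x z ≤ ρ x y + ρ y z)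
    (h2 : ∀ e s t, s ≤ M.len e → t ≤ M.len e → ρ (M.param e s) (M.param e t) ≤ segLen s t)
    (x y : X) : ρ x y ≤ M.dist x y := by
  refine le_sInf fun r hr => ?_
  induction hr with
  | refl x => simp [h0]
  | step e s t y r hs ht w ih => exact (h1 _ _ _).trans (add_le_add (h2 e s t hs ht) ih)

lemma dist_self (x : X) : M.dist x x = 0 := le_antisymm (sInf_le (Walk.refl x)) bot_le

/-- The points in the relative interior of an edge. -/
def openEdge (e : M.E) : Set X := M.param e '' Ioo 0 (M.len e)

variable {M} in
lemma not_mem_V_of_mem_openEdge {e : M.E} {x : X} (h : x ∈ M.openEdge e) : x ∉ M.V := by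
  obtain ⟨t, ht, rfl⟩ := h
  exact M.param_not_mem e t ht

variable {M} in
lemma eq_of_mem_openEdge {e e' : M.E} {x : X} (h : x ∈ M.openEdge e) (h' : x ∈ M.openEdge e') :
    e = e' := by
  obtain ⟨t, ht, rfl⟩ := h
  obtain ⟨t', ht', h⟩ := h'
  exact (M.param_inj _ _ _ _ ht ht' h.symm).1

lemma exists_openEdge {x : X} (h : x ∉ M.V) : ∃ e, x ∈ M.openEdge e := by
  rcases M.cover x with h' | ⟨e, t, ht, rfl⟩
  · exact absurd h' h
  · exact ⟨e, t, ht, rfl⟩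

lemma mem_Ioo_or_ends {L t : ℝ≥0∞} (ht : t ≤ L) : t ∈ Ioo 0 L ∨ t = 0 ∨ t = L := by
  rcases eq_or_lt_of_le ht with h | h
  · exact Or.inr (Or.inr h)
  · rcases eq_or_ne t 0 with h0 | h0
    · exact Or.inr (Or.inl h0)
    · exact Or.inl ⟨pos_iff_ne_zero.2 h0, h⟩

lemma param_mem_V_or {e : M.E} {t : ℝ≥0∞} (ht : t ≤ M.len e) :
    M.param e t ∈ M.openEdge e ∨ M.param e t ∈ M.V := by
  rcases mem_Ioo_or_ends ht with h | rfl | rfl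
  · exact Or.inl ⟨t, h, rfl⟩
  · exact Or.inr (M.param_zero_mem e)
  · exact Or.inr (M.param_len_mem e)

/-- Near an interior point of an edge, distances are distances along the edge. -/
lemma exists_ball (e : M.E) {s : ℝ≥0∞} (hs : s ∈ Ioo 0 (M.len e)) :
    ∃ r, 0 < r ∧ ∀ y, M.dist (M.param e s) y < r →
      ∃ t ∈ Ioo 0 (M.len e), M.param e t = y ∧ segLen s t = M.dist (M.param e s) y := by
  set r := min s (M.len e - s) with hr
  -- `u` is the distance from `s` along `e`, cut off at `r`, and equals `r` off the open edge. By
  -- the choice of `r` it has reached `r` at both ends of `e`, so it is 1-Lipschitz for the path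
  -- metric and bounds it from below.
  let u : X → ℝ≥0∞ := fun y => min r (⨅ (t) (_ : t ∈ Ioo 0 (M.len e) ∧ M.param e t = y), segLen s t)
  have hin : ∀ t ∈ Ioo 0 (M.len e), u (M.param e t) = min r (segLen s t) := by
    intro t ht
    have : (⨅ (t') (_ : t' ∈ Ioo 0 (M.len e) ∧ M.param e t' = M.param e t), segLen s t')
        = segLen s t := by
      refine le_antisymm (iInf₂_le t ⟨ht, rfl⟩) (le_iInf₂ fun t' h => ?_)
      rw [(M.param_inj _ _ _ _ h.1 ht h.2).2]
    simp only [u, this]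
  have hout : ∀ y, y ∉ M.openEdge e → u y = r := by
    intro y hy
    have : (⨅ (t') (_ : t' ∈ Ioo 0 (M.len e) ∧ M.param e t' = y), segLen s t') = ⊤ := by
      simp only [iInf_eq_top]
      intro t ht
      exact absurd ⟨t, ht.1, ht.2⟩ hy
    simp only [u, this, min_top_right]
  have hall : ∀ t ≤ M.len e, u (M.param e t) = min r (segLen s t) := by
    intro t ht
    rcases mem_Ioo_or_ends ht with h | rfl | rfl
    · exact hin t h
    · rw [hout _ fun h => not_mem_V_of_mem_openEdge h (M.param_zero_mem e), segLen_comm,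
        segLen_zero_left, min_eq_left (min_le_left _ _)]
    · rw [hout _ fun h => not_mem_V_of_mem_openEdge h (M.param_len_mem e),
        segLen_of_le hs.2.le, min_eq_left (min_le_right _ _)]
  have hlip : ∀ x y, segLen (u x) (u y) ≤ M.dist x y := by
    refine M.le_dist _ (fun _ => segLen_self _) (fun _ _ _ => segLen_triangle _ _ _) ?_
    intro e' p q hp hq
    by_cases he : e' = e
    · subst he
      rw [hall p hp, hall q hq]
      exact (segLen_min_le _ _ _).trans (segLen_segLen_le _ _ _)
    · have key : ∀ p ≤ M.len e', M.param e' p ∉ M.openEdge e := by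
        intro p hp h
        rcases M.param_mem_V_or hp with h' | h'
        · exact he (eq_of_mem_openEdge h' h)
        · exact not_mem_V_of_mem_openEdge h h'
      rw [hout _ (key p hp), hout _ (key q hq), segLen_self]
      exact bot_le
  refine ⟨r, lt_min hs.1 (tsub_pos_of_lt hs.2), fun y hy => ?_⟩
  have h1 : u y ≤ M.dist (M.param e s) y := by
    have := hlip (M.param e s) y
    rwa [hin s hs, segLen_self, min_eq_right (zero_le), segLen_zero_left] at this
  have hye : y ∈ M.openEdge e := by
    by_contra hne
    rw [hout y hne] at h1
    exact absurd hy (not_lt.2 h1)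
  obtain ⟨t, ht, rfl⟩ := hye
  refine ⟨t, ht, rfl, le_antisymm ?_ (M.dist_le_segLen e hs.2.le ht.2.le)⟩
  rw [hin t ht] at h1
  rcases min_le_iff.1 h1 with h | h
  · exact absurd hy (not_lt.2 h)
  · exact h

end GraphModel

/-! ### Maps of intervals preserving distances locally -/

lemma eq_of_Ioo_zero_eq {a b : ℝ≥0∞} (ha : 0 < a) (h : Ioo 0 a ⊆ Ioo 0 b) : a ≤ b := by
  refine le_of_forall_lt fun c hc => ?_
  rcases eq_or_ne c 0 with rfl | h0
  · obtain ⟨d, hd⟩ := exists_between ha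
    exact (h hd).1.trans (h hd).2
  · exact (h ⟨pos_iff_ne_zero.2 h0, hc⟩).2

lemma continuousAt_of_segLen_eq {γ : ℝ≥0∞ → ℝ≥0∞} {s : ℝ≥0∞} (hs : s ≠ ∞) (hγ : γ s ≠ ∞)
    (h : ∀ᶠ t in 𝓝 s, segLen (γ s) (γ t) = segLen s t) : ContinuousAt γ s := by
  refine (ENNReal.tendsto_nhds hγ).2 fun ε hε => ?_
  have h2 : ∀ᶠ t in 𝓝 s, segLen s t < ε :=
    (continuous_segLen hs).continuousAt.eventually_lt_const (by rwa [segLen_self])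
  filter_upwards [h, h2] with t ht ht2
  rw [← ht] at ht2
  have h3 := (le_max_left _ _).trans ht2.le
  have h4 := (le_max_right _ _).trans ht2.le
  refine ⟨?_, ?_⟩
  · rw [tsub_le_iff_right] at h3 ⊢
    rwa [add_comm]
  · rwa [tsub_le_iff_right, add_comm] at h4

/-- A bijection of intervals which locally preserves distances is the identity or a reflection. -/
lemma eq_or_reflect_of_segLen_eq {γ : ℝ≥0∞ → ℝ≥0∞} {L L' : ℝ≥0∞} (hL : 0 < L) (hL' : 0 < L')
    (hmaps : ∀ s ∈ Ioo 0 L, γ s ∈ Ioo 0 L') (hinj : InjOn γ (Ioo 0 L))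
    (hsurj : ∀ t ∈ Ioo 0 L', ∃ s ∈ Ioo 0 L, γ s = t)
    (hloc : ∀ s ∈ Ioo 0 L, ∀ᶠ t in 𝓝 s, segLen (γ s) (γ t) = segLen s t) :
    L = L' ∧ ((∀ s ∈ Ioo 0 L, γ s = s) ∨ (L ≠ ∞ ∧ ∀ s ∈ Ioo 0 L, γ s = L - s)) := by
  have hcont : ContinuousOn γ (Ioo 0 L) := fun s hs =>
    (continuousAt_of_segLen_eq (hs.2.trans_le le_top).ne ((hmaps s hs).2.trans_le le_top).ne
      (hloc s hs)).continuousWithinAt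
  have hfin : ∀ s ∈ Ioo 0 L, s ≠ ∞ := fun s hs => (hs.2.trans_le le_top).ne
  have hfin' : ∀ s ∈ Ioo 0 L, γ s ≠ ∞ := fun s hs => ((hmaps s hs).2.trans_le le_top).ne
  obtain ⟨s₀, hs₀⟩ := exists_between hL
  rcases hcont.strictMonoOn_of_injOn_Ioo hL hinj with hmono | hanti
  -- In the increasing case `γ t - t` is locally constant, hence constant on the connected interval.
  -- Sums are used because subtraction truncates.
  · have key : ∀ s ∈ Ioo 0 L, ∀ t ∈ Ioo 0 L, γ t + s = γ s + t := by
      intro s hs t ht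
      refine isPreconnected_Ioo.induction₂' (fun s t => γ t + s = γ s + t) ?_ ?_ hs ht
      · intro x hx
        filter_upwards [nhdsWithin_le_nhds (hloc x hx), self_mem_nhdsWithin] with y hy hyI
        suffices γ y + x = γ x + y from ⟨this, this.symm⟩
        rcases le_total x y with h | h
        · have hm := hmono.monotoneOn hx hyI h
          rw [segLen_of_le h, segLen_of_le hm] at hy
          rw [← tsub_add_cancel_of_le hm, hy, add_comm, add_comm _ (γ x), ← add_assoc,
            add_comm x, add_assoc, add_tsub_cancel_of_le h]
        · have hm := hmono.monotoneOn hyI hx h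
          rw [segLen_comm, segLen_comm x, segLen_of_le h, segLen_of_le hm] at hy
          rw [← tsub_add_cancel_of_le hm, hy, add_assoc, add_comm (x - y), add_assoc,
            add_tsub_cancel_of_le h]
      · intro x y z hx hy hz h1 h2
        have : (γ z + x) + (y + γ y) = (γ x + z) + (y + γ y) := by
          calc (γ z + x) + (y + γ y) = (γ z + y) + (γ y + x) := by ring
            _ = (γ y + z) + (γ x + y) := by rw [h1, h2]
            _ = _ := by ring
        exact (ENNReal.add_left_inj (ENNReal.add_ne_top.2 ⟨hfin y hy, hfin' y hy⟩)).1 this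
    -- A shift up by `d > 0` would miss the value `d`; a shift down by `d` would send the parameter
    -- `d` to `0`.
    have hid : ∀ s ∈ Ioo 0 L, γ s = s := by
      intro s hs
      refine le_antisymm ?_ ?_ <;> by_contra! hlt
      · obtain ⟨t, ht, hd⟩ := hsurj (γ s - s)
          ⟨tsub_pos_of_lt hlt, (tsub_le_self).trans_lt (hmaps s hs).2⟩
        have := key s hs t ht
        rw [hd, tsub_add_cancel_of_le hlt.le] at this
        have h2 : γ s + 0 = γ s + t := by simpa using this
        exact ht.1.ne ((ENNReal.add_right_inj (hfin' s hs)).1 h2)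
      · have hd : s - γ s ∈ Ioo 0 L := ⟨tsub_pos_of_lt hlt, (tsub_le_self).trans_lt hs.2⟩
        have := key s hs _ hd
        rw [add_tsub_cancel_of_le hlt.le] at this
        have h2 : γ (s - γ s) + s = 0 + s := by simpa using this
        exact (hmaps _ hd).1.ne' ((ENNReal.add_left_inj (hfin s hs)).1 h2)
    refine ⟨le_antisymm (eq_of_Ioo_zero_eq hL fun s hs => hid s hs ▸ hmaps s hs)
      (eq_of_Ioo_zero_eq hL' fun t ht => ?_), Or.inl hid⟩
    obtain ⟨s, hs, rfl⟩ := hsurj t ht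
    rwa [hid s hs]
  -- In the decreasing case `γ s + s` is constant; since `γ` maps onto the second interval, the
  -- constant must be the length of both.
  · have key : ∀ s ∈ Ioo 0 L, ∀ t ∈ Ioo 0 L, γ s + s = γ t + t := by
      intro s hs t ht
      refine isPreconnected_Ioo.induction₂' (fun s t => γ s + s = γ t + t) ?_ ?_ hs ht
      · intro x hx
        filter_upwards [nhdsWithin_le_nhds (hloc x hx), self_mem_nhdsWithin] with y hy hyI
        suffices γ x + x = γ y + y from ⟨this, this.symm⟩
        rcases le_total x y with h | h
        · have hm := hanti.antitoneOn hx hyI h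
          rw [segLen_comm, segLen_of_le h, segLen_of_le hm] at hy
          rw [← tsub_add_cancel_of_le hm, hy, add_comm _ (γ y), add_assoc,
            tsub_add_cancel_of_le h]
        · have hm := hanti.antitoneOn hyI hx h
          rw [segLen_comm x, segLen_of_le h, segLen_of_le hm] at hy
          rw [← tsub_add_cancel_of_le hm, hy, add_comm _ (γ x), add_assoc,
            tsub_add_cancel_of_le h]
      · intro x y z _ _ _ h1 h2
        exact h1.trans h2
    set C := γ s₀ + s₀ with hC
    have hCt : C ≠ ∞ := ENNReal.add_ne_top.2 ⟨hfin' _ hs₀, hfin _ hs₀⟩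
    have hk : ∀ s ∈ Ioo 0 L, γ s + s = C := fun s hs => key s hs _ hs₀
    have hk' : ∀ s ∈ Ioo 0 L, γ s = C - s := fun s hs =>
      ENNReal.eq_sub_of_add_eq (hfin s hs) (hk s hs)
    have hLC : L = C := by
      refine le_antisymm (le_of_forall_lt_imp_le_of_dense fun t ht => ?_) ?_
      · rcases eq_or_ne t 0 with rfl | h0
        · exact bot_le
        · exact (hk t ⟨pos_iff_ne_zero.2 h0, ht⟩) ▸ le_add_self
      · by_contra! hlt
        have hd : C - L < L' := by
          refine lt_of_le_of_lt ?_ (hmaps _ hs₀).2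
          rw [hk' _ hs₀]
          exact tsub_le_tsub_left hs₀.2.le C
        obtain ⟨t, ht, h⟩ := hsurj (C - L) ⟨tsub_pos_of_lt hlt, hd⟩
        have h2 := hk t ht
        rw [h] at h2
        have h3 : C - L + L = C := tsub_add_cancel_of_le hlt.le
        have h4 := (ENNReal.add_right_inj (ENNReal.sub_ne_top hCt)).1 (h2.trans h3.symm)
        exact ht.2.ne h4
    have hL'C : L' = C := by
      refine le_antisymm (le_of_forall_lt_imp_le_of_dense fun t ht => ?_) ?_
      · rcases eq_or_ne t 0 with rfl | h0
        · exact bot_le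
        · obtain ⟨s, hs, rfl⟩ := hsurj t ⟨pos_iff_ne_zero.2 h0, ht⟩
          exact hk s hs ▸ le_self_add
      · by_contra! hlt
        have hm : C - L' ∈ Ioo 0 L :=
          ⟨tsub_pos_of_lt hlt, by
            rw [hLC]; exact ENNReal.sub_lt_self hCt (hL'.trans hlt).ne' hL'.ne'⟩
        have h1 := (hmaps _ hm).2
        rw [hk' _ hm, ENNReal.sub_sub_cancel hCt hlt.le] at h1
        exact h1.false
    exact ⟨hLC.trans hL'C.symm, Or.inr ⟨hLC ▸ hCt, fun s hs => by rw [hk' s hs, hLC]⟩⟩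

namespace GraphModel

variable {X : Type*} [TopologicalSpace X]

/-! ### Models with the same vertices -/

/-- The edge `e` of `M` and the edge `e'` of `N` agree up to orientation. -/
def SameEdge (M N : GraphModel X) (e : M.E) (e' : N.E) : Prop :=
  M.len e = N.len e' ∧ ((∀ t ≤ M.len e, M.param e t = N.param e' t) ∨
    (M.len e ≠ ∞ ∧ ∀ t ≤ M.len e, M.param e t = N.param e' (M.len e - t)))

variable {M N : GraphModel X}

/-- The open edge avoids the vertices of `N`, and small balls of the common metric around interior
points of `N` stay in one edge (`exists_ball`). So the edge of `N` containing `M.param e s` is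
locally constant in `s`, and the interval is connected. -/
lemma exists_openEdge_subset (hV : M.V = N.V) (hd : M.dist = N.dist) (e : M.E) :
    ∃ e', M.openEdge e ⊆ N.openEdge e' := by
  have h1 : ∀ s ∈ Ioo 0 (M.len e), ∃ e', M.param e s ∈ N.openEdge e' := fun s hs =>
    N.exists_openEdge (hV ▸ M.param_not_mem e s hs)
  obtain ⟨s₀, hs₀⟩ := exists_between (M.len_pos e)
  obtain ⟨e', he'⟩ := h1 s₀ hs₀
  refine ⟨e', ?_⟩
  rintro _ ⟨t, ht, rfl⟩
  have : ∃ e', M.param e s₀ ∈ N.openEdge e' ∧ M.param e t ∈ N.openEdge e' := by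
    refine isPreconnected_Ioo.induction₂'
      (fun s t => ∃ e', M.param e s ∈ N.openEdge e' ∧ M.param e t ∈ N.openEdge e') ?_ ?_ hs₀ ht
    · intro s hs
      obtain ⟨e', τ, hτ, h⟩ := h1 s hs
      obtain ⟨r, hr, hball⟩ := N.exists_ball e' hτ
      have h2 : ∀ᶠ t in 𝓝 s, segLen s t < r :=
        (continuous_segLen (hs.2.trans_le le_top).ne).continuousAt.eventually_lt_const
          (by rwa [segLen_self])
      filter_upwards [nhdsWithin_le_nhds h2, self_mem_nhdsWithin] with t ht htI
      obtain ⟨u, hu, hu', -⟩ := hball (M.param e t) (by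
        rw [h, ← hd]
        exact (M.dist_le_segLen e hs.2.le htI.2.le).trans_lt ht)
      exact ⟨⟨e', ⟨τ, hτ, h⟩, u, hu, hu'⟩, ⟨e', ⟨u, hu, hu'⟩, τ, hτ, h⟩⟩
    · rintro x y z _ _ _ ⟨e₁, h1, h2⟩ ⟨e₂, h3, h4⟩
      obtain rfl := eq_of_mem_openEdge h2 h3
      exact ⟨e₁, h1, h4⟩
  obtain ⟨e₁, h1, h2⟩ := this
  rwa [eq_of_mem_openEdge he' h1]

/-- Inclusions in both directions make the open edges coincide. Near interior points the common
metric is the parameter distance in either model, so the change of parameter `γ` locally preserves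
distances and is the identity or a reflection; continuity extends this to the ends. -/
theorem exists_sameEdge [T2Space X] (hV : M.V = N.V) (hd : M.dist = N.dist) (e : M.E) :
    ∃ e', M.SameEdge N e e' := by
  obtain ⟨e', he'⟩ := exists_openEdge_subset hV hd e
  obtain ⟨e'', he''⟩ := exists_openEdge_subset hV.symm hd.symm e'
  obtain ⟨s₀, hs₀⟩ := exists_between (M.len_pos e)
  obtain rfl : e'' = e := eq_of_mem_openEdge (he'' (he' ⟨s₀, hs₀, rfl⟩)) ⟨s₀, hs₀, rfl⟩
  have h1 : ∀ s ∈ Ioo 0 (M.len e''), ∃ t ∈ Ioo 0 (N.len e'), N.param e' t = M.param e'' s :=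
    fun s hs => he' ⟨s, hs, rfl⟩
  choose! γ hγ hγe using h1
  have hmem : ∀ s ∈ Ioo 0 (M.len e''), s ∈ Ioo 0 (M.len e'') := fun _ h => h
  obtain ⟨hlen, h⟩ := eq_or_reflect_of_segLen_eq (γ := γ) (M.len_pos e'') (N.len_pos e') hγ
    (fun s hs t ht hst => (M.param_inj _ _ _ _ hs ht (by rw [← hγe s hs, ← hγe t ht, hst])).2)
    (fun t ht => by
      obtain ⟨s, hs, hst⟩ := he'' ⟨t, ht, rfl⟩
      exact ⟨s, hs, (N.param_inj _ _ _ _ (hγ s hs) ht ((hγe s hs).trans hst)).2⟩)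
    (fun s hs => by
      obtain ⟨r, hr, hball⟩ := N.exists_ball e' (hγ s hs)
      obtain ⟨r', hr', hball'⟩ := M.exists_ball e'' hs
      have hst : s ≠ ∞ := (hs.2.trans_le le_top).ne
      have hI : ∀ᶠ t in 𝓝 s, t ∈ Ioo 0 (M.len e'') := isOpen_Ioo.mem_nhds hs
      have h2 : ∀ᶠ t in 𝓝 s, segLen s t < r :=
        (continuous_segLen hst).continuousAt.eventually_lt_const (by rwa [segLen_self])
      have h3 : ∀ᶠ t in 𝓝 s, segLen s t < r' :=
        (continuous_segLen hst).continuousAt.eventually_lt_const (by rwa [segLen_self])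
      filter_upwards [hI, h2, h3] with t htI ht ht'
      have hle := M.dist_le_segLen e'' hs.2.le htI.2.le
      obtain ⟨u, hu, hu', hu''⟩ := hball (M.param e'' t) (by
        rw [hγe s hs, ← hd]
        exact hle.trans_lt ht)
      obtain ⟨v, hv, hv', hv''⟩ := hball' (M.param e'' t) (hle.trans_lt ht')
      rw [(M.param_inj _ _ _ _ hv htI hv').2] at hv''
      rw [(N.param_inj _ _ _ _ hu (hγ t htI) (hu'.trans (hγe t htI).symm)).2] at hu''
      rw [hu'', hv'', hγe s hs, hd])
  have hcl : Icc 0 (M.len e'') ⊆ closure (Ioo 0 (M.len e'')) := by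
    rw [closure_Ioo (M.len_pos e'').ne]
  refine ⟨e', hlen, h.imp (fun h t ht => ?_) (fun h => ⟨h.1, fun t ht => ?_⟩)⟩
  · refine EqOn.of_subset_closure (s := Ioo 0 (M.len e'')) (fun s hs => ?_)
      (M.continuousOn_param e'') (hlen ▸ N.continuousOn_param e') Ioo_subset_Icc_self hcl
      ⟨bot_le, ht⟩
    rw [← hγe s hs, h s hs]
  · have hc : ContinuousOn (fun t => N.param e' (M.len e'' - t)) (Icc 0 (M.len e'')) :=
      (hlen ▸ N.continuousOn_param e').comp (ENNReal.continuous_sub_left h.1).continuousOn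
        fun s hs => ⟨bot_le, tsub_le_self⟩
    refine EqOn.of_subset_closure (s := Ioo 0 (M.len e'')) (fun s hs => ?_)
      (M.continuousOn_param e'') hc Ioo_subset_Icc_self hcl ⟨bot_le, ht⟩
    rw [← hγe s hs, h.2 s hs]

end GraphModel

namespace GraphModel

variable {X : Type*} [TopologicalSpace X]

/-! ### Subdivision -/

/-- `N` is a subdivision of `M`: every edge of `N` is a segment of an edge of `M`. -/
structure Refinement (N M : GraphModel X) where
  under : N.E → M.E
  off : N.E → ℝ≥0∞
  off_ne_top : ∀ e, off e ≠ ∞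
  off_add_le : ∀ e, off e + N.len e ≤ M.len (under e)
  param_eq : ∀ e, ∀ t ≤ N.len e, N.param e t = M.param (under e) (off e + t)
  V_subset : M.V ⊆ N.V
  dist_eq : N.dist = M.dist
  slopeSum_eq : ∀ (m : M.E → ℤ) (x : X), N.slopeSum (fun e => m (under e)) x = M.slopeSum m x
  infinity : ∀ x, M.IsPointAtInfinity x → N.IsPointAtInfinity x

/-- Every model is a subdivision of itself. -/
def Refinement.refl (M : GraphModel X) : Refinement M M where
  under := id
  off _ := 0
  off_ne_top _ := ENNReal.zero_ne_top
  off_add_le e := by simp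
  param_eq e t _ := by simp
  V_subset := subset_rfl
  dist_eq := rfl
  slopeSum_eq _ _ := rfl
  infinity _ h := h

/-- Subdivisions can be composed. -/
def Refinement.trans {P N M : GraphModel X} (q : Refinement P N) (r : Refinement N M) :
    Refinement P M where
  under e := r.under (q.under e)
  off e := r.off (q.under e) + q.off e
  off_ne_top e := ENNReal.add_ne_top.2 ⟨r.off_ne_top _, q.off_ne_top _⟩
  off_add_le e := by
    rw [add_assoc]
    exact (add_le_add_right (q.off_add_le e) _).trans (r.off_add_le _)
  param_eq e t ht := by
    rw [q.param_eq e t ht, r.param_eq _ _ ((add_le_add_right ht _).trans (q.off_add_le e)),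
      add_assoc]
  V_subset := r.V_subset.trans q.V_subset
  dist_eq := q.dist_eq.trans r.dist_eq
  slopeSum_eq m x := by
    rw [← r.slopeSum_eq, ← q.slopeSum_eq]
  infinity x h := q.infinity x (r.infinity x h)

section Subdivide

open Classical in
/-- The model obtained by making the interior point of the edge `e₀` at parameter `a` a vertex. -/
def subdivide (M : GraphModel X) (e₀ : M.E) (a : ℝ≥0∞) (ha : a ∈ Ioo 0 (M.len e₀)) :
    GraphModel X where
  V := insert (M.param e₀ a) M.V
  -- `some e₀` keeps the part `[0, a]` of `e₀`, and `none` is the part beyond `a`.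
  E := Option M.E
  len o := o.elim (M.len e₀ - a) fun e => if e = e₀ then a else M.len e
  param o t := o.elim (M.param e₀ (a + t)) fun e => M.param e t
  len_pos := by
    rintro (_ | e)
    · exact tsub_pos_of_lt ha.2
    · dsimp only [Option.elim]
      split_ifs with h
      · exact ha.1
      · exact M.len_pos e
  continuousOn_param := by
    rintro (_ | e)
    · refine (M.continuousOn_param e₀).comp (by fun_prop) fun t ht => ⟨bot_le, ?_⟩
      exact (add_le_add_right ht.2 a).trans (add_tsub_cancel_of_le ha.2.le).le
    · refine (M.continuousOn_param e).mono (Icc_subset_Icc_right ?_)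
      dsimp only [Option.elim]
      split_ifs with h
      · exact h ▸ ha.2.le
      · exact le_rfl
  param_zero_mem := by
    rintro (_ | e)
    · simp
    · exact Finset.mem_insert_of_mem (M.param_zero_mem e)
  param_len_mem := by
    rintro (_ | e)
    · simp only [Option.elim, add_tsub_cancel_of_le ha.2.le]
      exact Finset.mem_insert_of_mem (M.param_len_mem e₀)
    · dsimp only [Option.elim]
      split_ifs with h
      · subst h
        exact Finset.mem_insert_self _ _
      · exact Finset.mem_insert_of_mem (M.param_len_mem e)
  param_not_mem := by
    have hat : a ≠ ∞ := (ha.2.trans_le le_top).ne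
    rintro (_ | e) t ht h
    · dsimp only [Option.elim] at ht h
      have htI : a + t ∈ Ioo 0 (M.len e₀) :=
        ⟨ha.1.trans_le le_self_add, by rw [add_comm]; exact lt_tsub_iff_right.1 ht.2⟩
      rcases Finset.mem_insert.1 h with h | h
      · have := (M.param_inj _ _ _ _ htI ha h).2
        have h2 : a + t = a + 0 := by simpa using this
        exact ht.1.ne' ((ENNReal.add_right_inj hat).1 h2)
      · exact M.param_not_mem _ _ htI h
    · dsimp only [Option.elim] at ht h
      split_ifs at ht with he
      · subst he
        have htI : t ∈ Ioo 0 (M.len e) := ⟨ht.1, ht.2.trans ha.2⟩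
        rcases Finset.mem_insert.1 h with h | h
        · exact ht.2.ne (M.param_inj _ _ _ _ htI ha h).2
        · exact M.param_not_mem _ _ htI h
      · rcases Finset.mem_insert.1 h with h | h
        · exact he (M.param_inj _ _ _ _ ht ha h).1
        · exact M.param_not_mem _ _ ht h
  param_inj := by
    have hat : a ≠ ∞ := (ha.2.trans_le le_top).ne
    have h0 : ∀ t, t ∈ Ioo 0 (M.len e₀ - a) → a + t ∈ Ioo 0 (M.len e₀) := fun t ht =>
        ⟨ha.1.trans_le le_self_add, by rw [add_comm]; exact lt_tsub_iff_right.1 ht.2⟩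
    have h1 : ∀ e t, t ∈ Ioo 0 (if e = e₀ then a else M.len e) → t ∈ Ioo 0 (M.len e) := by
      intro e t ht
      split_ifs at ht with he
      · exact ⟨ht.1, ht.2.trans (he ▸ ha.2)⟩
      · exact ht
    have h2 : ∀ e t t', t ∈ Ioo 0 (M.len e₀ - a) → t' ∈ Ioo 0 (if e = e₀ then a else M.len e) →
        M.param e₀ (a + t) ≠ M.param e t' := by
      intro e t t' ht ht' h
      obtain ⟨rfl, h3⟩ := M.param_inj _ _ _ _ (h0 t ht) (h1 e t' ht') h
      rw [if_pos rfl] at ht'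
      exact absurd ht'.2 (not_lt.2 (h3 ▸ le_self_add))
    rintro (_ | e) (_ | e') t t' ht ht' h
    · exact ⟨rfl, (ENNReal.add_right_inj hat).1 (M.param_inj _ _ _ _ (h0 t ht) (h0 t' ht') h).2⟩
    · exact absurd h (h2 e' t t' ht ht')
    · exact absurd h.symm (h2 e t' t ht' ht)
    · have := M.param_inj _ _ _ _ (h1 e t ht) (h1 e' t' ht') h
      exact ⟨by rw [this.1], this.2⟩
  cover := by
    have hat : a ≠ ∞ := (ha.2.trans_le le_top).ne
    intro x
    rcases M.cover x with h | ⟨e, t, ht, rfl⟩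
    · exact Or.inl (Finset.mem_insert_of_mem h)
    · by_cases he : e = e₀
      · subst he
        rcases lt_trichotomy t a with hta | rfl | hta
        · exact Or.inr ⟨some e, t, by simpa using ⟨ht.1, hta⟩, rfl⟩
        · exact Or.inl (Finset.mem_insert_self _ _)
        · refine Or.inr ⟨none, t - a, ⟨tsub_pos_of_lt hta,
            by
            refine (ENNReal.sub_lt_iff_lt_right hat hta.le).2 ?_
            simpa only [Option.elim, tsub_add_cancel_of_le ha.2.le] using ht.2⟩, ?_⟩
          simp only [Option.elim, add_tsub_cancel_of_le hta.le]
      · exact Or.inr ⟨some e, t, by simpa [he] using ht, rfl⟩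
  infinite_leaf := by
    have hat : a ≠ ∞ := (ha.2.trans_le le_top).ne
    have key : ∀ e, M.len e = ∞ → ∀ o : Option M.E,
        o.elim (M.param e₀ (a + 0)) (fun e => M.param e 0) ≠ M.param e ∞ ∧
        (o.elim (M.param e₀ (a + (M.len e₀ - a)))
          (fun e => M.param e (if e = e₀ then a else M.len e)) = M.param e ∞ →
          (o = none ∧ e = e₀) ∨ (o = some e ∧ e ≠ e₀)) := by
      intro e he
      have hv : M.param e₀ a ≠ M.param e ∞ := fun h =>
        M.param_not_mem e₀ a ha (h ▸ he ▸ M.param_len_mem e)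
      rintro (_ | e')
      · refine ⟨by simpa using hv, fun h => Or.inl ⟨rfl, ?_⟩⟩
        simp only [Option.elim, add_tsub_cancel_of_le ha.2.le] at h
        exact ((M.infinite_leaf e he e₀).2 h).symm
      · refine ⟨(M.infinite_leaf e he e').1, fun h => Or.inr ?_⟩
        dsimp only [Option.elim] at h
        split_ifs at h with he'
        · subst he'
          exact absurd h hv
        · obtain rfl := (M.infinite_leaf e he e').2 h
          exact ⟨rfl, he'⟩
    rintro (_ | e) hl o
    · have h0 : M.len e₀ = ∞ := by
        by_contra h
        exact ENNReal.sub_ne_top h hl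
      obtain ⟨h1, h2⟩ := key e₀ h0 o
      have h3 : a + ∞ = ∞ := by simp
      refine ⟨fun h => h1 (by cases o <;> simpa [h3] using h), fun h => ?_⟩
      have := h2 (by cases o <;> simpa [h3] using h)
      simpa using this
    · dsimp only [Option.elim] at hl
      split_ifs at hl with he
      · exact absurd hl hat
      · obtain ⟨h1, h2⟩ := key e hl o
        refine ⟨fun h => h1 (by cases o <;> simpa using h), fun h => ?_⟩
        have := h2 (by cases o <;> simpa using h)
        simpa [he] using this

/-- Each edge of the subdivision is a segment of an old edge, and a segment of `e₀` across the new
vertex splits there; `le_dist` turns both facts into inequalities of metrics. -/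
lemma dist_subdivide (M : GraphModel X) (e₀ : M.E) (a : ℝ≥0∞) (ha : a ∈ Ioo 0 (M.len e₀)) :
    (M.subdivide e₀ a ha).dist = M.dist := by
  classical
  have hat : a ≠ ∞ := (ha.2.trans_le le_top).ne
  funext x y
  refine le_antisymm ?_ ?_
  · refine M.le_dist _ (dist_self _) (dist_triangle _) ?_ x y
    have h1 : ∀ s t, s ≤ a → t ≤ a →
        (M.subdivide e₀ a ha).dist (M.param e₀ s) (M.param e₀ t) ≤ segLen s t := fun s t hs ht =>
      (M.subdivide e₀ a ha).dist_le_segLen (some e₀) (by simpa [subdivide] using hs)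
        (by simpa [subdivide] using ht)
    have h2 : ∀ s t, s ≤ M.len e₀ → t ≤ M.len e₀ → a ≤ s → a ≤ t →
        (M.subdivide e₀ a ha).dist (M.param e₀ s) (M.param e₀ t) ≤ segLen s t := by
      intro s t hs ht has hat'
      have := (M.subdivide e₀ a ha).dist_le_segLen none (s := s - a) (t := t - a)
        (tsub_le_tsub_right hs a) (tsub_le_tsub_right ht a)
      simp only [subdivide, Option.elim, add_tsub_cancel_of_le has, add_tsub_cancel_of_le hat']
        at this
      rwa [← segLen_add_left hat, add_tsub_cancel_of_le has, add_tsub_cancel_of_le hat'] at this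
    have h3 : ∀ s t u : ℝ≥0∞, s ≤ u → u ≤ t → segLen s t = segLen s u + segLen u t := by
      intro s t u hs ht
      rw [segLen_of_le (hs.trans ht), segLen_of_le hs, segLen_of_le ht, add_comm]
      exact (tsub_add_tsub_cancel ht hs).symm
    intro e s t hs ht
    by_cases he : e = e₀
    · subst he
      rcases le_total s a with hsa | hsa <;> rcases le_total t a with hta | hta
      · exact h1 s t hsa hta
      · rw [h3 s t a hsa hta]
        exact (dist_triangle _ _ _ _).trans
          (add_le_add (h1 s a hsa le_rfl) (h2 a t ha.2.le ht le_rfl hta))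
      · rw [segLen_comm, h3 t s a hta hsa, segLen_comm a s, add_comm]
        exact (dist_triangle _ _ _ _).trans
          (add_le_add (h2 s a hs ha.2.le hsa le_rfl)
            ((h1 a t le_rfl hta).trans_eq (segLen_comm _ _)))
      · exact h2 s t hs ht hsa hta
    · exact (M.subdivide e₀ a ha).dist_le_segLen (some e) (by simpa [subdivide, he] using hs)
        (by simpa [subdivide, he] using ht)
  · refine le_dist _ _ (dist_self _) (dist_triangle _) ?_ x y
    rintro (_ | e) s t hs ht
    · have h : ∀ s, s ≤ M.len e₀ - a → a + s ≤ M.len e₀ := fun s hs =>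
        (add_le_add_right hs a).trans (add_tsub_cancel_of_le ha.2.le).le
      rw [← segLen_add_left hat]
      exact M.dist_le_segLen e₀ (h s hs) (h t ht)
    · have h : ∀ s, s ≤ (if e = e₀ then a else M.len e) → s ≤ M.len e := by
        intro s hs
        split_ifs at hs with he
        · exact hs.trans (he ▸ ha.2.le)
        · exact hs
      exact M.dist_le_segLen e (h s hs) (h t ht)

/-- The subdivision at one point is a subdivision. -/
def subdivideRefinement (M : GraphModel X) (e₀ : M.E) (a : ℝ≥0∞) (ha : a ∈ Ioo 0 (M.len e₀)) :
    Refinement (M.subdivide e₀ a ha) M where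
  under o := Option.elim (α := M.E) o e₀ id
  off o := Option.elim (α := M.E) o a fun _ => 0
  off_ne_top := by
    rintro (_ | e)
    · exact (ha.2.trans_le le_top).ne
    · exact ENNReal.zero_ne_top
  off_add_le := by
    rintro (_ | e)
    · exact (add_tsub_cancel_of_le ha.2.le).le
    · simp only [Option.elim, id, zero_add, subdivide]
      split_ifs with he
      · exact he ▸ ha.2.le
      · exact le_rfl
  param_eq := by
    rintro (_ | e) t ht
    · rfl
    · simp [subdivide]
  V_subset x hx := by simp [subdivide, hx]
  dist_eq := M.dist_subdivide e₀ a ha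
  slopeSum_eq m x := by
    classical
    let T : Option M.E → ℤ := fun o => o.elim
      ((if M.param e₀ a = x then m e₀ else 0) - (if M.param e₀ (M.len e₀) = x then m e₀ else 0))
      fun e => ((if M.param e 0 = x then m e else 0) -
        (if M.param e (if e = e₀ then a else M.len e) = x then m e else 0))
    have hE : (M.subdivide e₀ a ha).slopeSum (fun o => m (Option.elim (α := M.E) o e₀ id)) x =
        ∑ o, T o := by
      unfold slopeSum
      refine Finset.sum_congr rfl ?_
      rintro (_ | e) _
      · simp only [T, subdivide, Option.elim, add_tsub_cancel_of_le ha.2.le, add_zero]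
      · simp only [T, subdivide, Option.elim, id]
        congr!
    have hM : M.slopeSum m x = ∑ e, ((if M.param e 0 = x then m e else 0) -
        (if M.param e (M.len e) = x then m e else 0)) := by
      unfold slopeSum
      refine Finset.sum_congr rfl fun o _ => ?_
      congr!
    rw [hE, hM, Fintype.sum_option]
    simp only [T, Option.elim]
    -- The end term of `e₀` moves to the new vertex, where it cancels against the start of `none`;
    -- the end term of `none` takes its former place.
    have : ∀ e, ((if M.param e 0 = x then m e else 0) -
        (if M.param e (if e = e₀ then a else M.len e) = x then m e else 0)) =
        ((if M.param e 0 = x then m e else 0) - (if M.param e (M.len e) = x then m e else 0)) +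
        (if e = e₀ then ((if M.param e₀ (M.len e₀) = x then m e₀ else 0) -
          (if M.param e₀ a = x then m e₀ else 0)) else 0) := by
      intro e
      by_cases he : e = e₀
      · subst he
        simp
      · simp [he]
    rw [Finset.sum_congr rfl fun e _ => this e, Finset.sum_add_distrib]
    simp only [Finset.sum_ite_eq', Finset.mem_univ, if_true]
    ring
  infinity := by
    rintro x ⟨e, he, rfl⟩
    by_cases h : e = e₀
    · subst h
      exact ⟨none, by simp [subdivide, he, (ha.2.trans_le le_top).ne], by simp [subdivide]⟩
    · exact ⟨some e, by simp [subdivide, he, h], by simp [subdivide]⟩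

/-- Any finite set of points can be made vertices of a subdivision. -/
theorem exists_refinement (M : GraphModel X) (S : Finset X) [DecidableEq X] :
    ∃ N : GraphModel X, N.V = M.V ∪ S ∧ Nonempty (Refinement N M) := by
  induction S using Finset.induction_on with
  | empty => exact ⟨M, by simp, ⟨Refinement.refl M⟩⟩
  | insert x S _ ih =>
    obtain ⟨N, hN, ⟨r⟩⟩ := ih
    by_cases hx : x ∈ N.V
    · refine ⟨N, ?_, ⟨r⟩⟩
      rw [Finset.union_insert, ← hN, Finset.insert_eq_of_mem hx]
    · obtain ⟨e, t, ht, rfl⟩ := N.exists_openEdge hx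
      refine ⟨N.subdivide e t ht, ?_, ⟨(N.subdivideRefinement e t ht).trans r⟩⟩
      rw [Finset.union_insert, ← hN]
      simp only [subdivide]
      congr!

end Subdivide

end GraphModel

/-! ### Affine functions on the extended half-line -/

/-- The function `t ↦ a + m t` on `[0, ∞]`, with `0 * ∞ = 0`. -/
def lin (a m : ℝ) (t : ℝ≥0∞) : EReal := (a : EReal) + (m : EReal) * (t : EReal)

lemma lin_of_ne_top (a m : ℝ) {t : ℝ≥0∞} (ht : t ≠ ∞) :
    lin a m t = ((a + m * t.toReal : ℝ) : EReal) := by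
  lift t to ℝ≥0 using ht
  simp only [lin, ENNReal.coe_toReal, EReal.coe_add, EReal.coe_mul]
  rfl

lemma lin_zero (a m : ℝ) : lin a m 0 = a := by simp [lin]

lemma lin_slope_zero (a : ℝ) (t : ℝ≥0∞) : lin a 0 t = a := by simp [lin]

lemma lin_top_of_pos (a : ℝ) {m : ℝ} (hm : 0 < m) : lin a m ∞ = ⊤ := by
  simp [lin, EReal.coe_mul_top_of_pos hm]

lemma lin_top_of_neg (a : ℝ) {m : ℝ} (hm : m < 0) : lin a m ∞ = ⊥ := by
  simp [lin, EReal.coe_mul_top_of_neg hm]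

lemma lin_add (a m : ℝ) {c : ℝ≥0∞} (hc : c ≠ ∞) (t : ℝ≥0∞) :
    lin a m (c + t) = lin (a + m * c.toReal) m t := by
  rcases eq_or_ne t ∞ with rfl | ht
  · rw [add_top]
    rcases lt_trichotomy m 0 with hm | rfl | hm
    · rw [lin_top_of_neg _ hm, lin_top_of_neg _ hm]
    · simp [lin_slope_zero]
    · rw [lin_top_of_pos _ hm, lin_top_of_pos _ hm]
  · rw [lin_of_ne_top _ _ ht, lin_of_ne_top _ _ (ENNReal.add_ne_top.2 ⟨hc, ht⟩),
      ENNReal.toReal_add hc ht]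
    congr 1
    ring

lemma lin_sub (a m : ℝ) {L t : ℝ≥0∞} (hL : L ≠ ∞) (ht : t ≤ L) :
    lin a m (L - t) = lin (a + m * L.toReal) (-m) t := by
  rw [lin_of_ne_top _ _ (ENNReal.sub_ne_top hL), lin_of_ne_top _ _ (ne_top_of_le_ne_top hL ht),
    ENNReal.toReal_sub_of_le ht hL]
  congr 1
  ring

/-! ### Slopes on different models of one space -/

namespace GraphModel

variable {X : Type*} [TopologicalSpace X] {M N : GraphModel X}

lemma HasSlopes.exists_lin {f : X → EReal} {m : M.E → ℤ} (h : M.HasSlopes f m) :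
    ∃ a : M.E → ℝ, ∀ e, ∀ t ≤ M.len e, f (M.param e t) = lin (a e) (m e) t :=
  Classical.skolem.1 h.1

lemma Refinement.hasSlopes (r : Refinement N M) {f : X → EReal} {m : M.E → ℤ}
    (h : M.HasSlopes f m) : N.HasSlopes f fun e => m (r.under e) := by
  refine ⟨fun e => ?_, fun x hx => r.infinity x (h.2 x hx)⟩
  obtain ⟨a, ha⟩ := h.exists_lin
  refine ⟨a (r.under e) + m (r.under e) * (r.off e).toReal, fun t ht => ?_⟩
  rw [r.param_eq e t ht, ha _ _ ((add_le_add_right ht _).trans (r.off_add_le e)),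
    lin_add _ _ (r.off_ne_top e)]
  rfl

/-- `slopeSum` is defined with classical decidability; this frees it from that instance. -/
lemma slopeSum_eq_sum (M : GraphModel X) [DecidableEq X] (m : M.E → ℤ) (x : X) :
    M.slopeSum m x = ∑ e, ((if M.param e 0 = x then m e else 0) -
        (if M.param e (M.len e) = x then m e else 0)) := by
  unfold slopeSum
  refine Finset.sum_congr rfl fun o _ => ?_
  congr!

lemma SameEdge.openEdge_eq {e : M.E} {e' : N.E} (h : M.SameEdge N e e') :
    M.openEdge e = N.openEdge e' := by
  obtain ⟨hl, h | ⟨hf, h⟩⟩ := h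
  · unfold openEdge
    rw [← hl]
    exact image_congr fun t ht => h t ht.2.le
  · unfold openEdge
    rw [← hl]
    ext x
    constructor
    · rintro ⟨t, ht, rfl⟩
      exact ⟨M.len e - t, ⟨tsub_pos_of_lt ht.2, ENNReal.sub_lt_self hf (M.len_pos e).ne' ht.1.ne'⟩,
        (h t ht.2.le).symm⟩
    · rintro ⟨t, ht, rfl⟩
      refine ⟨M.len e - t, ⟨tsub_pos_of_lt ht.2,
        ENNReal.sub_lt_self hf (M.len_pos e).ne' ht.1.ne'⟩, ?_⟩
      rw [h _ tsub_le_self, ENNReal.sub_sub_cancel hf ht.2.le]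

lemma openEdge_nonempty (M : GraphModel X) (e : M.E) : (M.openEdge e).Nonempty :=
  (nonempty_Ioo.2 (M.len_pos e)).image _

lemma openEdge_injective (M : GraphModel X) : Function.Injective M.openEdge := by
  intro e e' h
  obtain ⟨x, hx⟩ := M.openEdge_nonempty e
  exact eq_of_mem_openEdge hx (h ▸ hx)

/-- Slopes can be transferred between models with the same vertices. -/
lemma HasSlopes.of_V_eq [T2Space X] (hV : M.V = N.V) (hd : M.dist = N.dist) {f : X → EReal}
    {m : M.E → ℤ} (h : M.HasSlopes f m) :
    ∃ m', N.HasSlopes f m' ∧ ∀ x, N.slopeSum m' x = M.slopeSum m x := by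
  classical
  choose g hg using exists_sameEdge hV.symm hd.symm
  obtain ⟨a, ha⟩ := h.exists_lin
  have hbij : Function.Bijective g := by
    constructor
    · intro e e' hee
      exact N.openEdge_injective ((hg e).openEdge_eq.trans (hee ▸ (hg e').openEdge_eq.symm))
    · intro e
      obtain ⟨e', he'⟩ := exists_sameEdge hV hd e
      exact ⟨e', M.openEdge_injective ((hg e').openEdge_eq.symm.trans he'.openEdge_eq.symm)⟩
  have key : ∀ e, ∃ k : ℤ, (∃ b : ℝ, ∀ t ≤ N.len e, f (N.param e t) = lin b k t) ∧
      ∀ x, (if N.param e 0 = x then k else 0) - (if N.param e (N.len e) = x then k else 0) =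
        (if M.param (g e) 0 = x then m (g e) else 0) -
        (if M.param (g e) (M.len (g e)) = x then m (g e) else 0) := by
    intro e
    obtain ⟨hl, h' | ⟨hf, h'⟩⟩ := hg e
    · refine ⟨m (g e), ⟨a (g e), fun t ht => ?_⟩, fun x => ?_⟩
      · rw [h' t ht, ha _ _ (hl ▸ ht)]
      · rw [h' 0 bot_le, h' _ le_rfl, hl]
    -- Reversing an edge changes the sign of the slope and exchanges the ends, so the contribution
    -- to the sum of outgoing slopes is unchanged.
    · refine ⟨-m (g e), ⟨a (g e) + m (g e) * (N.len e).toReal, fun t ht => ?_⟩, fun x => ?_⟩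
      · rw [h' t ht, ha _ _ (hl ▸ tsub_le_self), lin_sub _ _ hf ht]
        simp
      · rw [h' 0 bot_le, h' _ le_rfl, tsub_zero, tsub_self, hl]
        split_ifs <;> ring
  choose m' hm' hm'' using key
  refine ⟨m', ⟨hm', fun x hx => ?_⟩, fun x => ?_⟩
  · obtain ⟨e, he, rfl⟩ := h.2 x hx
    obtain ⟨e', hl, h' | ⟨hf, -⟩⟩ := exists_sameEdge hV hd e
    · exact ⟨e', hl ▸ he, (h' ∞ he.ge).symm⟩
    · exact absurd he hf
  · rw [slopeSum_eq_sum, slopeSum_eq_sum, Finset.sum_congr rfl fun e _ => hm'' e x]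
    exact hbij.sum_comp fun e => ((if M.param e 0 = x then m e else 0) -
        (if M.param e (M.len e) = x then m e else 0))

/-- Slopes can be transferred to models with more vertices. -/
lemma HasSlopes.of_V_subset [T2Space X] (hV : M.V ⊆ N.V) (hd : M.dist = N.dist) {f : X → EReal}
    {m : M.E → ℤ} (h : M.HasSlopes f m) :
    ∃ m', N.HasSlopes f m' ∧ ∀ x, N.slopeSum m' x = M.slopeSum m x := by
  classical
  -- `P` subdivides `M` and has the vertices of `N`, so it is `N` up to orientation.
  obtain ⟨P, hP, ⟨r⟩⟩ := M.exists_refinement N.V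
  obtain ⟨m', h1, h2⟩ := (r.hasSlopes h).of_V_eq (N := N)
    (by rw [hP, Finset.union_eq_right.2 hV]) (r.dist_eq.trans hd)
  exact ⟨m', h1, fun x => (h2 x).trans (r.slopeSum_eq m x)⟩

/-! ### Group actions -/

section Action

variable {K : Type*} [Group K] [MulAction K X]

/-- Every finite set of points is contained in the invariant vertex set of some subdivision. -/
theorem exists_invariant_refinement [Finite K] (M : GraphModel X) (S : Finset X) :
    ∃ N : GraphModel X, N.dist = M.dist ∧ S ⊆ N.V ∧ ∀ (σ : K), ∀ x ∈ N.V, σ • x ∈ N.V := by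
  classical
  cases nonempty_fintype K
  let T : Finset X := (Finset.univ ×ˢ (M.V ∪ S)).image fun p : K × X => p.1 • p.2
  have hT : M.V ∪ S ⊆ T := fun x hx => Finset.mem_image.2 ⟨(1, x), by simpa using hx, by simp⟩
  obtain ⟨N, hN, ⟨r⟩⟩ := M.exists_refinement T
  have hNT : N.V = T := by rw [hN, Finset.union_eq_right.2 (Finset.union_subset_left hT)]
  refine ⟨N, r.dist_eq, hNT ▸ Finset.union_subset_right hT, fun σ x hx => ?_⟩
  rw [hNT] at hx ⊢
  obtain ⟨⟨τ, y⟩, hy, rfl⟩ := Finset.mem_image.1 hx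
  exact Finset.mem_image.2 ⟨(σ * τ, y), by simpa using hy, mul_smul _ _ _⟩

variable [ContinuousConstSMul K X]

open Classical in
/-- The image of a model under a group element. -/
def smul (M : GraphModel X) (σ : K) : GraphModel X where
  V := M.V.image (σ • ·)
  E := M.E
  len := M.len
  param e t := σ • M.param e t
  len_pos := M.len_pos
  continuousOn_param e := (M.continuousOn_param e).const_smul σ
  param_zero_mem e := Finset.mem_image_of_mem _ (M.param_zero_mem e)
  param_len_mem e := Finset.mem_image_of_mem _ (M.param_len_mem e)
  param_not_mem e t ht h := by
    obtain ⟨x, hx, hxe⟩ := Finset.mem_image.1 h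
    exact M.param_not_mem e t ht (MulAction.injective σ hxe ▸ hx)
  param_inj e e' t t' ht ht' h := M.param_inj e e' t t' ht ht' (MulAction.injective σ h)
  cover x := by
    rcases M.cover (σ⁻¹ • x) with h | ⟨e, t, ht, h⟩
    · exact Or.inl (Finset.mem_image.2 ⟨_, h, smul_inv_smul _ _⟩)
    · exact Or.inr ⟨e, t, ht, by rw [h, smul_inv_smul]⟩
  infinite_leaf e he e' := ⟨fun h => (M.infinite_leaf e he e').1 (MulAction.injective σ h),
    fun h => (M.infinite_leaf e he e').2 (MulAction.injective σ h)⟩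

lemma dist_smul_model (M : GraphModel X) (σ : K)
    (hK : ∀ x y, M.dist (σ • x) (σ • y) = M.dist x y) : (M.smul σ).dist = M.dist := by
  funext x y
  have hinv : M.dist (σ⁻¹ • x) (σ⁻¹ • y) = M.dist x y := by
    rw [← hK, smul_inv_smul, smul_inv_smul]
  refine le_antisymm ?_ ?_
  · have := M.le_dist (fun x y => (M.smul σ).dist (σ • x) (σ • y)) (fun _ => dist_self _ _)
      (fun _ _ _ => dist_triangle _ _ _ _)
      (fun e s t hs ht => (M.smul σ).dist_le_segLen e hs ht) (σ⁻¹ • x) (σ⁻¹ • y)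
    simpa only [smul_inv_smul, hinv] using this
  · have := (M.smul σ).le_dist (fun x y => M.dist (σ⁻¹ • x) (σ⁻¹ • y)) (fun _ => dist_self _ _)
      (fun _ _ _ => dist_triangle _ _ _ _)
      (fun e s t hs ht => by
        simp only [smul, inv_smul_smul]
        exact M.dist_le_segLen e hs ht) x y
    simpa only [hinv] using this

/-- `σ` maps the edge `e` to the edge `e'`, up to orientation. -/
def MapsEdge (M : GraphModel X) (σ : K) (e e' : M.E) : Prop :=
  M.len e = M.len e' ∧ ((∀ t ≤ M.len e, σ • M.param e t = M.param e' t) ∨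
    (M.len e ≠ ∞ ∧ ∀ t ≤ M.len e, σ • M.param e t = M.param e' (M.len e - t)))

/-- The translate of `M` by `σ` has the same vertices and the same metric as `M`, so
`exists_sameEdge` applies. -/
theorem exists_mapsEdge [T2Space X] (M : GraphModel X)
    (hK : ∀ (σ : K) x y, M.dist (σ • x) (σ • y) = M.dist x y)
    (hV : ∀ (σ : K), ∀ x ∈ M.V, σ • x ∈ M.V) (σ : K) (e : M.E) : ∃ e', M.MapsEdge σ e e' := by
  refine exists_sameEdge (M := M.smul σ) (N := M) ?_ (M.dist_smul_model σ (hK σ)) e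
  ext x
  simp only [smul, Finset.mem_image]
  constructor
  · rintro ⟨y, hy, rfl⟩
    exact hV σ y hy
  · intro hx
    exact ⟨σ⁻¹ • x, hV _ _ hx, smul_inv_smul _ _⟩

end Action

end GraphModel

/-- Multiplication in `EReal` is not continuous at `(0, ⊤)`, so slope zero is treated apart, as a
constant function. -/
lemma continuous_lin (a m : ℝ) : Continuous (lin a m) := by
  rcases eq_or_ne m 0 with rfl | hm
  · have : lin a 0 = fun _ => (a : EReal) := funext fun t => lin_slope_zero a t
    rw [this]
    exact continuous_const
  · refine continuous_iff_continuousAt.2 fun t => ?_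
    have hm' : (m : EReal) ≠ 0 := by simpa using hm
    have h1 : ContinuousAt (fun t : ℝ≥0∞ => (m : EReal) * (t : EReal)) t :=
      ContinuousAt.comp (f := fun t : ℝ≥0∞ => ((m : EReal), (t : EReal)))
        (g := fun p : EReal × EReal => p.1 * p.2)
        (EReal.continuousAt_mul (Or.inl hm') (Or.inl hm') (Or.inl (EReal.coe_ne_bot m))
          (Or.inl (EReal.coe_ne_top m)))
        (continuousAt_const.prodMk continuous_coe_ennreal_ereal.continuousAt)
    exact ContinuousAt.comp (f := fun t : ℝ≥0∞ => ((a : EReal), (m : EReal) * (t : EReal)))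
      (g := fun p : EReal × EReal => p.1 + p.2)
      (EReal.continuousAt_add (Or.inl (EReal.coe_ne_top a)) (Or.inl (EReal.coe_ne_bot a)))
      (continuousAt_const.prodMk h1)

/-- An affine function which avoids a value inside an interval stays on one side of it. -/
lemma lin_le_or_ge {a m : ℝ} {L : ℝ≥0∞} {v : EReal} (h : ∀ t ∈ Ioo 0 L, lin a m t ≠ v) :
    (∀ t ≤ L, lin a m t ≤ v) ∨ (∀ t ≤ L, v ≤ lin a m t) := by
  by_contra! hcon
  obtain ⟨⟨s, hs, hsv⟩, t, ht, htv⟩ := hcon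
  rcases le_total s t with hst | hst
  · obtain ⟨u, hu, huv⟩ := intermediate_value_Ioo' hst (continuous_lin a m).continuousOn ⟨htv, hsv⟩
    exact h u ⟨bot_le.trans_lt hu.1, hu.2.trans_le ht⟩ huv
  · obtain ⟨u, hu, huv⟩ := intermediate_value_Ioo hst (continuous_lin a m).continuousOn ⟨htv, hsv⟩
    exact h u ⟨bot_le.trans_lt hu.1, hu.2.trans_le hs⟩ huv

/-! ### Truncation of a piecewise linear function -/

/-- A convex piecewise linear function with values `c` below `c' - w (c' - c)`, with slope `1 / w`
up to `c'`, and with slope `1` from there on. -/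
def bend (w c c' y : ℝ) : ℝ := max y (max c (c' + (y - c') / w))

lemma bend_of_le {w c c' y : ℝ} (hw : 1 ≤ w) (hc : c < c') (hy : y ≤ c' - w * (c' - c)) :
    bend w c c' y = c := by
  have hw0 : 0 < w := one_pos.trans_le hw
  have h1 : (y - c') / w ≤ c - c' := by
    rw [div_le_iff₀ hw0]
    linarith
  have h2 : y ≤ c := by nlinarith
  unfold bend
  rw [max_eq_left (by linarith : c' + (y - c') / w ≤ c), max_eq_right h2]

lemma bend_of_mem {w c c' y : ℝ} (hw : 1 ≤ w) (hy : c' - w * (c' - c) ≤ y) (hy' : y ≤ c') :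
    bend w c c' y = c' + (y - c') / w := by
  have hw0 : 0 < w := one_pos.trans_le hw
  have h1 : c - c' ≤ (y - c') / w := by
    rw [le_div_iff₀ hw0]
    linarith
  have h2 : y - c' ≤ (y - c') / w := by
    rw [le_div_iff₀ hw0]
    nlinarith
  unfold bend
  rw [max_eq_right (by linarith : c ≤ c' + (y - c') / w),
    max_eq_right (by linarith : y ≤ c' + (y - c') / w)]

lemma bend_of_ge {w c c' y : ℝ} (hw : 1 ≤ w) (hc : c < c') (hy : c' ≤ y) :
    bend w c c' y = y := by
  have h2 : (y - c') / w ≤ y - c' := div_le_self (by linarith) hw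
  exact max_eq_left (max_le (by linarith) (by linarith))

lemma bend_one (c c' y : ℝ) : bend 1 c c' y = max y c := by
  simp [bend, max_comm]

lemma le_bend (w c c' y : ℝ) : y ≤ bend w c c' y := le_max_left _ _

lemma le_bend' (w c c' y : ℝ) : c ≤ bend w c c' y := (le_max_left _ _).trans (le_max_right _ _)

namespace GraphModel

variable {X : Type*} [TopologicalSpace X] {M N : GraphModel X}

open Classical in
/-- The absolute value of the slope at an interior point of an edge, but at least one. -/
def width (M : GraphModel X) (m : M.E → ℤ) (x : X) : ℝ :=
  if h : ∃ e, x ∈ M.openEdge e then max 1 |(m h.choose : ℝ)| else 1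

lemma width_of_mem (m : M.E → ℤ) {e : M.E} {x : X} (hx : x ∈ M.openEdge e) :
    M.width m x = max 1 |(m e : ℝ)| := by
  have h : ∃ e, x ∈ M.openEdge e := ⟨e, hx⟩
  rw [width, dif_pos h, eq_of_mem_openEdge h.choose_spec hx]

open Classical in
/-- The function which agrees with `max f c` except where `f` crosses the interval `(c, c')`; there
it has slope at most one in absolute value. -/
def bendFun (M : GraphModel X) (m : M.E → ℤ) (f : X → EReal) (c c' : ℝ) (x : X) : EReal :=
  if x ∈ M.V then max (f x) c else ((bend (M.width m x) c c' (f x).toReal : ℝ) : EReal)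

lemma bendFun_of_V {m : M.E → ℤ} {f : X → EReal} {c c' : ℝ} {x : X} (hx : x ∈ M.V) :
    M.bendFun m f c c' x = max (f x) c := if_pos hx

lemma bendFun_of_mem {m : M.E → ℤ} {f : X → EReal} {c c' : ℝ} {e : M.E} {x : X}
    (hx : x ∈ M.openEdge e) :
    M.bendFun m f c c' x = ((bend (max 1 |(m e : ℝ)|) c c' (f x).toReal : ℝ) : EReal) := by
  rw [bendFun, if_neg (not_mem_V_of_mem_openEdge hx), width_of_mem m hx]

/-- Only vertices are ends of edges. -/
lemma slopeSum_eq_zero (m : M.E → ℤ) {x : X} (hx : x ∉ M.V) : M.slopeSum m x = 0 := by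
  refine Finset.sum_eq_zero fun e _ => ?_
  rw [if_neg fun h : M.param e 0 = x => hx (h ▸ M.param_zero_mem e),
    if_neg fun h : M.param e (M.len e) = x => hx (h ▸ M.param_len_mem e), sub_zero]

/-- A function which dominates another one, and agrees with it at `x`, has the larger sum of
outgoing slopes at `x`. -/
lemma slopeSum_le_slopeSum {f h : X → EReal} {mf mh : M.E → ℤ} (hf : M.HasSlopes f mf)
    (hh : M.HasSlopes h mh) (hle : ∀ y, f y ≤ h y) {x : X} (hx : h x = f x)
    (hinf : ∀ e, M.len e = ∞ → M.param e ∞ = x → mh e ≤ mf e) :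
    M.slopeSum mf x ≤ M.slopeSum mh x := by
  classical
  obtain ⟨a, ha⟩ := hf.exists_lin
  obtain ⟨b, hb⟩ := hh.exists_lin
  rw [slopeSum_eq_sum, slopeSum_eq_sum]
  refine Finset.sum_le_sum fun e _ => sub_le_sub ?_ ?_
  · split_ifs with h0
    · obtain ⟨t, ht0, ht⟩ := exists_between (M.len_pos e)
      have htt : t ≠ ∞ := (ht.trans_le le_top).ne
      have h1 := hle (M.param e t)
      rw [ha e t ht.le, hb e t ht.le, lin_of_ne_top _ _ htt, lin_of_ne_top _ _ htt,
        EReal.coe_le_coe_iff] at h1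
      rw [← h0, ha e 0 bot_le, hb e 0 bot_le, lin_zero, lin_zero, EReal.coe_eq_coe_iff] at hx
      rw [hx] at h1
      have h2 : 0 < t.toReal := ENNReal.toReal_pos ht0.ne' htt
      have h3 : (mf e : ℝ) ≤ mh e := le_of_mul_le_mul_right (by linarith) h2
      exact_mod_cast h3
    · exact le_rfl
  · split_ifs with h0
    -- At an infinite end both functions may be infinite, and then equality there does not compare
    -- the slopes; hence the hypothesis `hinf`.
    · rcases eq_or_ne (M.len e) ∞ with hl | hl
      · exact hinf e hl (hl ▸ h0)
      · have h1 := hle (M.param e 0)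
        rw [ha e 0 bot_le, hb e 0 bot_le, lin_zero, lin_zero, EReal.coe_le_coe_iff] at h1
        rw [← h0, ha e _ le_rfl, hb e _ le_rfl, lin_of_ne_top _ _ hl, lin_of_ne_top _ _ hl,
          EReal.coe_eq_coe_iff] at hx
        have h2 : 0 < (M.len e).toReal := ENNReal.toReal_pos (M.len_pos e).ne' hl
        have h3 : (mh e : ℝ) ≤ mf e := le_of_mul_le_mul_right (by linarith) h2
        exact_mod_cast h3
    · exact le_rfl

lemma hasSlopes_const (M : GraphModel X) (c : ℝ) : M.HasSlopes (fun _ => (c : EReal)) fun _ => 0 :=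
  ⟨fun e => ⟨c, fun t _ => by simp⟩, fun x hx => by simp at hx⟩

lemma slopeSum_zero (M : GraphModel X) (x : X) : M.slopeSum (fun _ => 0) x = 0 :=
  Finset.sum_eq_zero fun e _ => by simp

end GraphModel

/-! ### The truncation is rational and has slope one somewhere -/

namespace GraphModel

variable {X : Type*} [TopologicalSpace X] {M N : GraphModel X}

/-- No vertex has its value in one of the intervals in which `bendFun` may differ from `max f c`. -/
def IsGenericLevel (M : GraphModel X) (m : M.E → ℤ) (f : X → EReal) (c c' : ℝ) : Prop :=
  c < c' ∧ ∀ v ∈ M.V, (c' : EReal) < f v ∨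
    ∀ e, f v < ((c' - max 1 |(m e : ℝ)| * (c' - c) : ℝ) : EReal)

/-- The interior points at which `bendFun` is not affine. -/
def breakPoints (M : GraphModel X) (m : M.E → ℤ) (f : X → EReal) (c c' : ℝ) : Set X :=
  {x | ∃ e, m e ≠ 0 ∧ x ∈ M.openEdge e ∧
    (f x = c' ∨ f x = ((c' - max 1 |(m e : ℝ)| * (c' - c) : ℝ) : EReal))}

/-- On an edge of non-zero slope each of the two critical values is taken at most once. `p` lists
the candidates by solving the affine equation, the Boolean selecting the value. -/
lemma finite_breakPoints {m : M.E → ℤ} {f : X → EReal} (hf : M.HasSlopes f m) (c c' : ℝ) :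
    (M.breakPoints m f c c').Finite := by
  obtain ⟨a, ha⟩ := hf.exists_lin
  let p : M.E × Bool → X := fun q => M.param q.1 (ENNReal.ofReal
    (((if q.2 then c' else c' - max 1 |(m q.1 : ℝ)| * (c' - c)) - a q.1) / m q.1))
  refine (Set.finite_range p).subset ?_
  rintro _ ⟨e, hm, ⟨t, ht, rfl⟩, h⟩
  have htt : t ≠ ∞ := (ht.2.trans_le le_top).ne
  have hm' : (m e : ℝ) ≠ 0 := by exact_mod_cast hm
  rw [ha e t ht.2.le, lin_of_ne_top _ _ htt, EReal.coe_eq_coe_iff, EReal.coe_eq_coe_iff] at h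
  have key : ∀ v : ℝ, a e + m e * t.toReal = v → ENNReal.ofReal ((v - a e) / m e) = t := by
    rintro v rfl
    rw [add_sub_cancel_left, mul_div_cancel_left₀ _ hm', ENNReal.ofReal_toReal htt]
  rcases h with h | h
  · exact ⟨(e, true), by simp only [p, if_true, key _ h]⟩
  · exact ⟨(e, false), by simp only [p, Bool.false_eq_true, if_false, key _ h]⟩

/-- On a subdivision at the break points, `bendFun` is affine on every edge: it is constant, or
equal to `f`, or it has slope `±1`; the last case does not occur on edges of infinite length. -/
lemma bendFun_cases {m : M.E → ℤ} {f : X → EReal} (hf : M.HasSlopes f m) {c c' : ℝ}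
    (hc : M.IsGenericLevel m f c c') (r : Refinement N M)
    (hN : M.breakPoints m f c c' ⊆ N.V) (e : N.E) :
    ((∀ t ≤ N.len e, M.bendFun m f c c' (N.param e t) = c) ∨
      (m (r.under e) = 0 ∧ ∃ b : ℝ, ∀ t ≤ N.len e, M.bendFun m f c c' (N.param e t) = b) ∨
      (∀ t ≤ N.len e, (c' : EReal) ≤ f (N.param e t) ∧
        M.bendFun m f c c' (N.param e t) = f (N.param e t))) ∨
    (N.len e ≠ ∞ ∧ ∃ (b : ℝ) (k : ℤ), ∀ t ≤ N.len e,
      M.bendFun m f c c' (N.param e t) = lin b k t) := by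
  obtain ⟨hcc, hV⟩ := hc
  set e₀ := r.under e with he₀
  have hmem : ∀ t ≤ N.len e, r.off e + t ≤ M.len e₀ := fun t ht =>
    (add_le_add_right ht _).trans (r.off_add_le e)
  have hor : ∀ t ≤ N.len e, N.param e t ∈ M.openEdge e₀ ∨ N.param e t ∈ M.V := fun t ht => by
    rw [r.param_eq e t ht]
    exact M.param_mem_V_or (hmem t ht)
  obtain ⟨a, ha⟩ : ∃ a : ℝ, ∀ t ≤ N.len e, f (N.param e t) = lin a (m e₀) t :=
    (r.hasSlopes hf).1 e
  set w : ℝ := max 1 |(m e₀ : ℝ)| with hw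
  have hw1 : 1 ≤ w := le_max_left _ _
  have hreal : ∀ t ≤ N.len e, N.param e t ∈ M.openEdge e₀ →
      ∃ y : ℝ, f (N.param e t) = y ∧ M.bendFun m f c c' (N.param e t) = (bend w c c' y : ℝ) := by
    intro t ht h
    refine ⟨(f (N.param e t)).toReal, ?_, bendFun_of_mem h⟩
    have h1 : ¬(f (N.param e t) = ⊤ ∨ f (N.param e t) = ⊥) := fun h' => by
      obtain ⟨e₁, he₁, hx⟩ := hf.2 _ h'
      exact not_mem_V_of_mem_openEdge h (hx ▸ he₁ ▸ M.param_len_mem e₁)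
    push Not at h1
    exact (EReal.coe_toReal h1.1 h1.2).symm
  by_cases hm : m e₀ = 0
  · refine Or.inl (Or.inr (Or.inl ⟨hm, max a c, fun t ht => ?_⟩))
    have hfa : f (N.param e t) = a := by rw [ha t ht, hm, Int.cast_zero, lin_slope_zero]
    rcases hor t ht with h | h
    · obtain ⟨y, hy, hb⟩ := hreal t ht h
      have hw' : w = 1 := by simp [hw, hm]
      rw [hfa, EReal.coe_eq_coe_iff] at hy
      rw [hb, hw', bend_one, hy]
    · rw [bendFun_of_V h, hfa, EReal.coe_strictMono.monotone.map_max]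
  have hm' : (m e₀ : ℝ) ≠ 0 := by exact_mod_cast hm
  have hw2 : w = |(m e₀ : ℝ)| := by
    refine max_eq_right ?_
    rw [← Int.cast_abs]
    exact_mod_cast Int.one_le_abs hm
  -- No break point is interior to an edge of `N`, so `f` takes neither critical value inside the
  -- edge. By `lin_le_or_ge` the whole edge lies in one of three zones: below, between or above
  -- these values.
  have havoid : ∀ v : EReal, (v = c' ∨ v = ((c' - w * (c' - c) : ℝ) : EReal)) →
      ∀ t ∈ Ioo 0 (N.len e), lin a (m e₀) t ≠ v := by
    intro v hv t ht h
    rw [← ha t ht.2.le] at h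
    refine N.param_not_mem e t ht (hN ⟨e₀, hm, ?_, h ▸ hv⟩)
    rw [r.param_eq e t ht.2.le]
    refine ⟨_, ⟨ht.1.trans_le le_add_self, lt_of_lt_of_le ?_ (r.off_add_le e)⟩, rfl⟩
    exact (ENNReal.add_lt_add_iff_left (r.off_ne_top e)).2 ht.2
  have hVt : ∀ t ≤ N.len e, N.param e t ∈ M.V → (c' : EReal) < f (N.param e t) ∨
      f (N.param e t) < ((c' - w * (c' - c) : ℝ) : EReal) := fun t ht h =>
    (hV _ h).imp_right fun h => h e₀
  have hbc : c' - w * (c' - c) ≤ c := by nlinarith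
  rcases lin_le_or_ge (havoid _ (Or.inl rfl)) with hle | hge
  · rcases lin_le_or_ge (havoid _ (Or.inr rfl)) with hle' | hge'
    · refine Or.inl (Or.inl fun t ht => ?_)
      have h1 := hle' t ht
      rw [← ha t ht] at h1
      rcases hor t ht with h | h
      · obtain ⟨y, hy, hb⟩ := hreal t ht h
        rw [hy, EReal.coe_le_coe_iff] at h1
        rw [hb, bend_of_le hw1 hcc h1]
      · rw [bendFun_of_V h, max_eq_right (h1.trans (EReal.coe_le_coe_iff.2 hbc))]
    -- In the middle zone genericity excludes the vertices of `M`. In particular the edge is not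
    -- infinite, since its end would be such a vertex.
    · have hop : ∀ t ≤ N.len e, N.param e t ∈ M.openEdge e₀ := by
        intro t ht
        refine (hor t ht).resolve_right fun h => ?_
        rcases hVt t ht h with h1 | h1 <;> rw [ha t ht] at h1
        · exact absurd (hle t ht) (not_le.2 h1)
        · exact absurd (hge' t ht) (not_le.2 h1)
      have hfin : N.len e ≠ ∞ := by
        intro h
        refine not_mem_V_of_mem_openEdge (hop _ le_rfl) ?_
        rw [r.param_eq e _ le_rfl, h, add_top]
        have h2 : M.len e₀ = ∞ := by
          have := r.off_add_le e
          rwa [h, add_top, top_le_iff] at this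
        rw [← h2]
        exact M.param_len_mem e₀
      -- Here `w` is the absolute value of the slope of `f`, so division by `w` leaves its sign.
      refine Or.inr ⟨hfin, c' + (a - c') / w, SignType.sign (m e₀), fun t ht => ?_⟩
      obtain ⟨y, hy, hb⟩ := hreal t ht (hop t ht)
      have htt : t ≠ ∞ := ne_top_of_le_ne_top hfin ht
      have h1 := hle t ht
      have h2 := hge' t ht
      rw [← ha t ht, hy, EReal.coe_le_coe_iff] at h1 h2
      rw [hb, bend_of_mem hw1 h2 h1, lin_of_ne_top _ _ htt]
      rw [ha t ht, lin_of_ne_top _ _ htt, EReal.coe_eq_coe_iff] at hy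
      congr 1
      have hs : (((SignType.sign (m e₀) : ℤ)) : ℝ) * w = m e₀ := by
        rw [hw2, ← Int.cast_abs, ← Int.cast_mul, sign_mul_abs]
      have hw0 : w ≠ 0 := by positivity
      rw [← hy]
      field_simp
      rw [← hs]
      ring
  · refine Or.inl (Or.inr (Or.inr fun t ht => ?_))
    have h1 := hge t ht
    rw [← ha t ht] at h1
    refine ⟨h1, ?_⟩
    rcases hor t ht with h | h
    · obtain ⟨y, hy, hb⟩ := hreal t ht h
      rw [hy, EReal.coe_le_coe_iff] at h1
      rw [hb, bend_of_ge hw1 hcc h1, hy]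
    · rw [bendFun_of_V h, max_eq_left (((EReal.coe_le_coe_iff.2 hcc.le)).trans h1)]

lemma le_bendFun {m : M.E → ℤ} {f : X → EReal} (hf : M.HasSlopes f m) (c c' : ℝ) (x : X) :
    f x ≤ M.bendFun m f c c' x ∧ (c : EReal) ≤ M.bendFun m f c c' x := by
  by_cases h : x ∈ M.V
  · rw [bendFun_of_V h]
    exact ⟨le_max_left _ _, le_max_right _ _⟩
  · obtain ⟨e, he⟩ := M.exists_openEdge h
    have h1 : ¬(f x = ⊤ ∨ f x = ⊥) := fun h' => by
      obtain ⟨e₁, he₁, hx⟩ := hf.2 _ h'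
      exact h (hx ▸ he₁ ▸ M.param_len_mem e₁)
    push Not at h1
    rw [bendFun_of_mem he]
    refine ⟨?_, EReal.coe_le_coe_iff.2 (le_bend' _ _ _ _)⟩
    conv_lhs => rw [← EReal.coe_toReal h1.1 h1.2]
    exact EReal.coe_le_coe_iff.2 (le_bend _ _ _ _)

/-- If `D + div f` and `D` are effective, then `bendFun` is a rational function `h` such that
`D + div h` is effective. -/
theorem exists_hasSlopes_bendFun {m : M.E → ℤ} {f : X → EReal} (hf : M.HasSlopes f m) {c c' : ℝ}
    (hc : M.IsGenericLevel m f c c') {D : X →₀ ℤ} (hD : 0 ≤ D)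
    (hDf : ∀ x, 0 ≤ D x + M.slopeSum m x) :
    ∃ (N : GraphModel X) (k : N.E → ℤ), N.dist = M.dist ∧ N.HasSlopes (M.bendFun m f c c') k ∧
      ∀ x, 0 ≤ D x + N.slopeSum k x := by
  classical
  obtain ⟨N, hNV, ⟨r⟩⟩ := M.exists_refinement (finite_breakPoints hf c c').toFinset
  have hN : M.breakPoints m f c c' ⊆ N.V := by
    rw [hNV]
    intro x hx
    simp [hx]
  set h := M.bendFun m f c c' with hh
  have hfN := r.hasSlopes hf
  -- Besides the slope `k` of `h`, this records the comparison required by `slopeSum_le_slopeSum` at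
  -- infinite ends: with the constant `c` if `h` equals `c` there, otherwise with `f`.
  have key : ∀ e, ∃ k : ℤ, (∃ b : ℝ, ∀ t ≤ N.len e, h (N.param e t) = lin b k t) ∧
      (N.len e = ∞ → (h (N.param e ∞) = c → k ≤ 0) ∧
        (h (N.param e ∞) ≠ c → k ≤ m (r.under e))) := by
    intro e
    have hcases := bendFun_cases hf hc r hN e
    rw [← hh] at hcases
    rcases hcases with (h1 | ⟨hm, b, h1⟩ | h1) | ⟨hl, b, k, h1⟩
    · refine ⟨0, ⟨c, fun t ht => ?_⟩, fun hl => ⟨fun _ => le_rfl, fun h2 => ?_⟩⟩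
      · rw [h1 t ht, Int.cast_zero, lin_slope_zero]
      · exact absurd (h1 _ hl.ge) h2
    · refine ⟨0, ⟨b, fun t ht => ?_⟩, fun hl => ⟨fun _ => le_rfl, fun h2 => hm.ge⟩⟩
      rw [h1 t ht, Int.cast_zero, lin_slope_zero]
    · refine ⟨m (r.under e), ?_, fun hl => ⟨fun h2 => ?_, fun _ => le_rfl⟩⟩
      · obtain ⟨b, hb⟩ := hfN.1 e
        exact ⟨b, fun t ht => by rw [h1 t ht |>.2, hb t ht]; rfl⟩
      · obtain ⟨h3, h4⟩ := h1 _ hl.ge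
        rw [← h4, h2, EReal.coe_le_coe_iff] at h3
        exact absurd hc.1 (not_lt.2 h3)
    · exact ⟨k, ⟨b, h1⟩, fun h2 => absurd h2 hl⟩
  choose k hk hk' using key
  have hhN : N.HasSlopes h k := by
    refine ⟨hk, fun x hx => ?_⟩
    have hbot : h x ≠ ⊥ := fun h0 => by
      have := (le_bendFun hf c c' x).2
      rw [← hh, h0] at this
      exact absurd this (by simp)
    have htop := hx.resolve_right hbot
    by_cases hxV : x ∈ M.V
    · rw [hh, bendFun_of_V hxV] at htop
      refine r.infinity x (hf.2 x (Or.inl ?_))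
      rcases max_choice (f x) (c : EReal) with h1 | h1 <;> rw [h1] at htop
      · exact htop
      · exact absurd htop (EReal.coe_ne_top c)
    · obtain ⟨e, he⟩ := M.exists_openEdge hxV
      rw [hh, bendFun_of_mem he] at htop
      exact absurd htop (EReal.coe_ne_top _)
  refine ⟨N, k, r.dist_eq, hhN, fun x => ?_⟩
  by_cases hx : x ∈ N.V
  swap
  · rw [slopeSum_eq_zero _ hx, add_zero]
    exact hD x
  -- At each vertex of `N` the function `h` touches one of its lower bounds `c` and `f`. Its sum of
  -- outgoing slopes is at least that of the bound it touches, and both bounds give an effective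
  -- divisor.
  have hval : h x = c ∨ h x = f x := by
    by_cases hxV : x ∈ M.V
    · rw [hh, bendFun_of_V hxV]
      exact (max_choice (f x) (c : EReal)).symm
    · rw [hNV, Finset.mem_union, Set.Finite.mem_toFinset] at hx
      obtain ⟨e, -, he, h1⟩ := hx.resolve_left hxV
      rw [hh, bendFun_of_mem he]
      have hw1 : (1 : ℝ) ≤ max 1 |(m e : ℝ)| := le_max_left _ _
      rcases h1 with h1 | h1
      · right
        rw [h1, EReal.toReal_coe, bend_of_ge hw1 hc.1 le_rfl]
      · left
        rw [h1, EReal.toReal_coe, bend_of_le hw1 hc.1 le_rfl]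
  by_cases hxc : h x = c
  · have := slopeSum_le_slopeSum (N.hasSlopes_const c) hhN (fun y => (le_bendFun hf c c' y).2) hxc
      (fun e hl he => (hk' e hl).1 (he.symm ▸ hxc))
    rw [slopeSum_zero] at this
    exact add_nonneg (hD x) this
  · have := slopeSum_le_slopeSum hfN hhN (fun y => (le_bendFun hf c c' y).1)
      (hval.resolve_left hxc) (fun e hl he => (hk' e hl).2 (he.symm ▸ hxc))
    rw [r.slopeSum_eq] at this
    exact (hDf x).trans (add_le_add_right this _)

/-- Around a level inside the range of `f` on the edge `e₀`, the function `bendFun` has slope `±1` on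
a part of `e₀`. -/
theorem exists_bendFun_slope_one {m : M.E → ℤ} {f : X → EReal} (hf : M.HasSlopes f m) {e₀ : M.E}
    (hm : m e₀ ≠ 0) : ∃ c c' : ℝ, M.IsGenericLevel m f c c' ∧ ∃ (b : ℝ) (k : ℤ), k ^ 2 = 1 ∧
      {t ∈ Ioo 0 (M.len e₀) | M.bendFun m f c c' (M.param e₀ t) = lin b k t}.Infinite := by
  classical
  obtain ⟨a, ha⟩ : ∃ a : ℝ, ∀ t ≤ M.len e₀, f (M.param e₀ t) = lin a (m e₀) t := hf.1 e₀
  have hm' : (m e₀ : ℝ) ≠ 0 := by exact_mod_cast hm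
  have hfin : ∀ t ∈ Ioo 0 (M.len e₀), t ≠ ∞ := fun t ht => (ht.2.trans_le le_top).ne
  -- `f` is injective on the open edge and has finitely many values at vertices, so some level on
  -- the edge is not taken at any vertex.
  obtain ⟨t₀, ht₀, ht₀V⟩ : ∃ t₀ ∈ Ioo 0 (M.len e₀), f (M.param e₀ t₀) ∉ f '' M.V := by
    have h1 : (Ioo 0 (M.len e₀) ∩ (fun t => f (M.param e₀ t)) ⁻¹' (f '' M.V)).Finite := by
      refine Set.Finite.of_injOn (f := fun t => f (M.param e₀ t)) (t := f '' M.V)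
        (fun t ht => ht.2) ?_ (M.V.finite_toSet.image f)
      intro s hs t ht hst
      dsimp only at hst
      rw [ha s hs.1.2.le, ha t ht.1.2.le, lin_of_ne_top _ _ (hfin s hs.1),
        lin_of_ne_top _ _ (hfin t ht.1), EReal.coe_eq_coe_iff] at hst
      exact (ENNReal.toReal_eq_toReal_iff' (hfin s hs.1) (hfin t ht.1)).1
        (mul_left_cancel₀ hm' (add_left_cancel hst))
    obtain ⟨t, ht, ht'⟩ := ((Ioo_infinite (M.len_pos e₀)).sdiff h1).nonempty
    exact ⟨t, ht, fun h => ht' ⟨ht, h⟩⟩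
  set c' : ℝ := a + m e₀ * t₀.toReal with hc'
  have hfc : f (M.param e₀ t₀) = c' := by rw [ha _ ht₀.2.le, lin_of_ne_top _ _ (hfin _ ht₀)]
  -- With `δ = c' - c` these are finitely many strict inequalities. They hold at `δ = 0` and persist
  -- for small `δ`.
  have hδ : ∀ᶠ δ : ℝ in 𝓝[>] 0, ∀ v ∈ M.V, (c' : EReal) < f v ∨
      ∀ e, f v < ((c' - max 1 |(m e : ℝ)| * δ : ℝ) : EReal) := by
    rw [Filter.eventually_all_finset]
    intro v hv
    have hne : f v ≠ c' := fun h => ht₀V ⟨v, hv, h.trans hfc.symm⟩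
    rcases lt_or_gt_of_ne hne with hlt | hgt
    · obtain ⟨z, hz, hz'⟩ := EReal.lt_iff_exists_real_btwn.1 hlt
      have : ∀ᶠ δ : ℝ in 𝓝[>] 0, ∀ e, z < c' - max 1 |(m e : ℝ)| * δ := by
        rw [Filter.eventually_all]
        intro e
        refine nhdsWithin_le_nhds ?_
        have hcont : ContinuousAt (fun δ : ℝ => c' - max 1 |(m e : ℝ)| * δ) 0 := by fun_prop
        refine hcont.eventually_const_lt ?_
        simpa using hz'
      filter_upwards [this] with δ hδ
      exact Or.inr fun e => hz.trans (EReal.coe_lt_coe_iff.2 (hδ e))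
    · exact Filter.Eventually.of_forall fun δ => Or.inl hgt
  obtain ⟨δ, hδV, hδ0⟩ := (hδ.and self_mem_nhdsWithin).exists
  refine ⟨c' - δ, c', ⟨by linarith, by simpa using hδV⟩, ?_⟩
  set w : ℝ := max 1 |(m e₀ : ℝ)| with hw
  have hw1 : 1 ≤ w := le_max_left _ _
  have hw2 : w = |(m e₀ : ℝ)| := by
    refine max_eq_right ?_
    rw [← Int.cast_abs]
    exact_mod_cast Int.one_le_abs hm
  have hs : (((SignType.sign (m e₀) : ℤ)) : ℝ) * w = m e₀ := by
    rw [hw2, ← Int.cast_abs, ← Int.cast_mul, sign_mul_abs]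
  refine ⟨c' + (a - c') / w, SignType.sign (m e₀), ?_, ?_⟩
  · rcases lt_or_gt_of_ne hm with h | h <;> simp [h]
  have hval : ∀ t ∈ Ioo 0 (M.len e₀), lin a (m e₀) t ≤ c' →
      ((c' - w * δ : ℝ) : EReal) < lin a (m e₀) t →
      M.bendFun m f (c' - δ) c' (M.param e₀ t) =
        lin (c' + (a - c') / w) (SignType.sign (m e₀) : ℤ) t := by
    intro t ht h1 h2
    rw [bendFun_of_mem ⟨t, ht, rfl⟩, ha t ht.2.le, lin_of_ne_top _ _ (hfin t ht),
      lin_of_ne_top _ _ (hfin t ht), EReal.toReal_coe]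
    rw [lin_of_ne_top _ _ (hfin t ht), EReal.coe_le_coe_iff] at h1
    rw [lin_of_ne_top _ _ (hfin t ht), EReal.coe_lt_coe_iff] at h2
    rw [bend_of_mem hw1 (by simpa using h2.le) h1]
    congr 1
    have hw0 : w ≠ 0 := by positivity
    field_simp
    rw [← hs]
    ring
  have hnear : ∀ᶠ t in 𝓝 t₀, ((c' - w * δ : ℝ) : EReal) < lin a (m e₀) t := by
    refine (continuous_lin a (m e₀)).continuousAt.eventually_const_lt ?_
    rw [lin_of_ne_top _ _ (hfin _ ht₀), ← hc', EReal.coe_lt_coe_iff]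
    nlinarith
  have hI : ∀ᶠ t in 𝓝 t₀, t ∈ Ioo 0 (M.len e₀) := isOpen_Ioo.mem_nhds ht₀
  have hall := hnear.and hI
  -- The slope-one range lies just below `c'`, so on the right of `t₀` if `f` decreases and on the
  -- left if it increases.
  rcases lt_or_gt_of_ne hm' with hneg | hpos
  · obtain ⟨u, hu, hsub⟩ := (mem_nhdsGT_iff_exists_Ioo_subset' ht₀.2).1
      (nhdsWithin_le_nhds (s := Ioi t₀) hall)
    refine (Ioo_infinite hu).mono fun t ht => ?_
    obtain ⟨h1, h2⟩ := hsub ht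
    refine ⟨h2, hval t h2 ?_ h1⟩
    rw [lin_of_ne_top _ _ (hfin _ h2), EReal.coe_le_coe_iff]
    have := ENNReal.toReal_mono (hfin _ h2) ht.1.le
    nlinarith
  · obtain ⟨u, hu, hsub⟩ := (mem_nhdsLT_iff_exists_Ioo_subset' ht₀.1).1
      (nhdsWithin_le_nhds (s := Iio t₀) hall)
    refine (Ioo_infinite hu).mono fun t ht => ?_
    obtain ⟨h1, h2⟩ := hsub ht
    refine ⟨h2, hval t h2 ?_ h1⟩
    rw [lin_of_ne_top _ _ (hfin _ h2), EReal.coe_le_coe_iff]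
    have := ENNReal.toReal_mono (hfin _ ht₀) ht.2.le
    nlinarith

/-! ### Invariance -/

section Action

variable {K : Type*} [Group K] [MulAction K X]

lemma MapsEdge.smul_mem_openEdge {σ : K} {e e' : M.E} (h : M.MapsEdge σ e e') {x : X}
    (hx : x ∈ M.openEdge e) : σ • x ∈ M.openEdge e' := by
  obtain ⟨t, ht, rfl⟩ := hx
  obtain ⟨hl, h | ⟨hf, h⟩⟩ := h
  · rw [h t ht.2.le]
    exact ⟨t, ⟨ht.1, hl ▸ ht.2⟩, rfl⟩
  · rw [h t ht.2.le]
    exact ⟨_, ⟨tsub_pos_of_lt ht.2, hl ▸ ENNReal.sub_lt_self hf (M.len_pos e).ne' ht.1.ne'⟩, rfl⟩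

/-- Two values on the edge determine the slope, and only a reversal changes its sign. The truncation
is invariant because `width` uses the absolute value. -/
lemma MapsEdge.abs_slope_eq {σ : K} {e e' : M.E} (h : M.MapsEdge σ e e') {f : X → EReal}
    {m : M.E → ℤ} (hf : M.HasSlopes f m) (hinv : ∀ x, f (σ • x) = f x) :
    |(m e' : ℝ)| = |(m e : ℝ)| := by
  obtain ⟨a, ha⟩ := hf.exists_lin
  obtain ⟨t, ht0, ht⟩ := exists_between (M.len_pos e)
  obtain ⟨s, hs0, hs⟩ := exists_between ht0
  have htt : t ≠ ∞ := (ht.trans_le le_top).ne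
  have hst : s ≠ ∞ := (hs.trans_le le_top).ne
  have hts : s.toReal < t.toReal := (ENNReal.toReal_lt_toReal hst htt).2 hs
  have h1 := hinv (M.param e s)
  have h2 := hinv (M.param e t)
  rw [ha e _ ht.le, lin_of_ne_top _ _ htt] at h2
  rw [ha e _ (hs.trans ht).le, lin_of_ne_top _ _ hst] at h1
  obtain ⟨hl, h | ⟨hf, h⟩⟩ := h
  · rw [h t ht.le, ha e' _ (hl ▸ ht.le), lin_of_ne_top _ _ htt, EReal.coe_eq_coe_iff] at h2
    rw [h s (hs.trans ht).le, ha e' _ (hl ▸ (hs.trans ht).le), lin_of_ne_top _ _ hst,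
      EReal.coe_eq_coe_iff] at h1
    rw [show (m e' : ℝ) = m e from mul_right_cancel₀ (sub_pos.2 hts).ne' (by linarith)]
  · rw [h t ht.le, ha e' _ (hl ▸ tsub_le_self), lin_sub _ _ hf ht.le, lin_of_ne_top _ _ htt,
      EReal.coe_eq_coe_iff] at h2
    rw [h s (hs.trans ht).le, ha e' _ (hl ▸ tsub_le_self), lin_sub _ _ hf (hs.trans ht).le,
      lin_of_ne_top _ _ hst, EReal.coe_eq_coe_iff] at h1
    rw [← abs_neg, show -(m e' : ℝ) = m e from
      mul_right_cancel₀ (sub_pos.2 hts).ne' (by linarith)]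

lemma bendFun_smul {f : X → EReal} {m : M.E → ℤ} (hf : M.HasSlopes f m)
    (hV : ∀ (σ : K), ∀ x ∈ M.V, σ • x ∈ M.V)
    (hE : ∀ (σ : K) e, ∃ e', M.MapsEdge σ e e')
    (hinv : ∀ (σ : K) x, f (σ • x) = f x) (c c' : ℝ) (σ : K) (x : X) :
    M.bendFun m f c c' (σ • x) = M.bendFun m f c c' x := by
  by_cases hx : x ∈ M.V
  · rw [bendFun_of_V hx, bendFun_of_V (hV σ x hx), hinv]
  · obtain ⟨e, he⟩ := M.exists_openEdge hx
    obtain ⟨e', he'⟩ := hE σ e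
    rw [bendFun_of_mem he, bendFun_of_mem (he'.smul_mem_openEdge he), hinv,
      he'.abs_slope_eq hf (hinv σ)]

end Action

end GraphModel

section Generators

variable {Γ : Type*} [TopologicalSpace Γ] [MetricGraph Γ] {K : Type*} [Group K] [MulAction K Γ]

/-! ### Generating sets of invariant rational functions -/

lemma mem_RInv {D : Γ →₀ ℤ} {h : Γ → EReal} {N : GraphModel Γ} {k : N.E → ℤ} (hN : IsModel N)
    (hk : N.HasSlopes h k) (hD : ∀ x, 0 ≤ D x + N.slopeSum k x)
    (hinv : ∀ (σ : K) (x : Γ), h (σ • x) = h x) : h ∈ RInv K D := by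
  refine ⟨Or.inr ⟨Finsupp.onFinset N.V (N.slopeSum k) fun x hx => ?_, ⟨N, k, hN, hk, fun _ => rfl⟩,
    hD⟩, hinv⟩
  by_contra h'
  exact hx (GraphModel.slopeSum_eq_zero k h')

/-- A constant has divisor zero, so effectivity of `D` suffices. -/
lemma const_mem_RInv {D : Γ →₀ ℤ} (hD : 0 ≤ D) (c : ℝ) :
    (fun _ => (c : EReal)) ∈ RInv (Γ := Γ) K D := by
  obtain ⟨M, hM⟩ := MetricGraph.exists_model (Γ := Γ)
  refine mem_RInv hM (M.hasSlopes_const c) (fun x => ?_) fun _ _ => rfl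
  rw [M.slopeSum_zero, add_zero]
  exact hD x

variable {D : Γ →₀ ℤ} {n : ℕ} {F : Fin (n + 1) → Γ → EReal}

lemma Generates.exists_eq (hF : Generates K D F) {g : Γ → EReal} (hg : g ∈ RInv K D) :
    ∃ c : Fin (n + 1) → EReal, (∀ i, c i ≠ ⊤) ∧ ∀ x, ∃ i, g x = c i + F i x := by
  obtain ⟨c, hc, h⟩ := hF.2 g hg
  refine ⟨c, hc, fun x => ?_⟩
  obtain ⟨i, hi⟩ := exists_eq_ciSup_of_finite (f := fun i => c i + F i x)
  exact ⟨i, (h x).trans hi.symm⟩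

lemma exists_coe_of_add_eq_coe {c y : EReal} (hc : c ≠ ⊤) {b : ℝ} (h : (b : EReal) = c + y) :
    ∃ c' y' : ℝ, c = c' ∧ y = y' ∧ b = c' + y' := by
  induction c with
  | bot => simp at h
  | top => exact absurd rfl hc
  | coe c =>
    induction y with
    | bot => simp at h
    | top => simp at h
    | coe y => exact ⟨c, y, rfl, rfl, by exact_mod_cast h⟩

/-- At every point one of the generators is finite. -/
lemma Generates.exists_finite (hF : Generates K D F) (hD : 0 ≤ D) (x : Γ) :
    ∃ i, ∃ y : ℝ, F i x = y := by
  obtain ⟨c, hc, h⟩ := hF.exists_eq (const_mem_RInv hD 0)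
  obtain ⟨i, hi⟩ := h x
  obtain ⟨-, y, -, hy, -⟩ := exists_coe_of_add_eq_coe (hc i) hi
  exact ⟨i, y, hy⟩

/-- An invariant model on the edges of which the generators are affine, with intercepts `a` and
slopes `m`. -/
structure IsAdapted (K : Type*) [Group K] [MulAction K Γ] (D : Γ →₀ ℤ)
    (F : Fin (n + 1) → Γ → EReal) (M : GraphModel Γ) (a : Fin (n + 1) → M.E → ℝ)
    (m : Fin (n + 1) → M.E → ℤ) : Prop where
  isModel : IsModel M
  smul_mem : ∀ (σ : K), ∀ x ∈ M.V, σ • x ∈ M.V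
  eq_bot_or : ∀ i, (∀ x, F i x = ⊥) ∨ M.HasSlopes (F i) (m i) ∧
    (∀ e, ∀ t ≤ M.len e, F i (M.param e t) = lin (a i e) (m i e) t) ∧
    ∀ x, 0 ≤ D x + M.slopeSum (m i) x

/-- Each generator other than `-∞` brings its own model. An invariant model whose vertices include
all of theirs inherits their slopes and sums of outgoing slopes. -/
theorem exists_isAdapted [Finite K] (hF : Generates K D F) :
    ∃ (M : GraphModel Γ) (a : Fin (n + 1) → M.E → ℝ) (m : Fin (n + 1) → M.E → ℤ),
      IsAdapted K D F M a m := by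
  classical
  have := MetricGraph.t2 (Γ := Γ)
  obtain ⟨M₀, hM₀⟩ := MetricGraph.exists_model (Γ := Γ)
  have h1 : ∀ i, ∃ N : GraphModel Γ, IsModel N ∧ ((∀ x, F i x = ⊥) ∨
      ∃ k : N.E → ℤ, N.HasSlopes (F i) k ∧ ∀ x, 0 ≤ D x + N.slopeSum k x) := by
    intro i
    rcases (hF.1 i).1 with h | ⟨P, ⟨N, k, hN, hk, hP⟩, hDP⟩
    · exact ⟨M₀, hM₀, Or.inl h⟩
    · exact ⟨N, hN, Or.inr ⟨k, hk, fun x => hP x ▸ hDP x⟩⟩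
  choose N hN hN' using h1
  obtain ⟨M, hM, hVM, hinv⟩ := M₀.exists_invariant_refinement (K := K)
    (Finset.univ.biUnion fun i => (N i).V)
  have hMd : IsModel M := hM.trans hM₀
  have h2 : ∀ i, ∃ (a : M.E → ℝ) (m : M.E → ℤ), (∀ x, F i x = ⊥) ∨ M.HasSlopes (F i) m ∧
      (∀ e, ∀ t ≤ M.len e, F i (M.param e t) = lin (a e) (m e) t) ∧
      ∀ x, 0 ≤ D x + M.slopeSum m x := by
    intro i
    rcases hN' i with h | ⟨k, hk, hD⟩
    · exact ⟨0, 0, Or.inl h⟩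
    · obtain ⟨m, hm, hm'⟩ := hk.of_V_subset (N := M)
        (fun x hx => hVM (Finset.mem_biUnion.2 ⟨i, Finset.mem_univ _, hx⟩))
        ((hN i).trans hMd.symm)
      obtain ⟨a, ha⟩ := hm.exists_lin
      exact ⟨a, m, Or.inr ⟨hm, ha, fun x => hm' x ▸ hD x⟩⟩
  choose a m h using h2
  exact ⟨M, a, m, hMd, hinv, h⟩

namespace IsAdapted

variable {M : GraphModel Γ} {a : Fin (n + 1) → M.E → ℝ} {m : Fin (n + 1) → M.E → ℤ}

lemma exists_mapsEdge [ContinuousConstSMul K Γ] (h : IsAdapted K D F M a m)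
    (hK : ∀ (σ : K) (x y : Γ), MetricGraph.d (σ • x) (σ • y) = MetricGraph.d x y)
    (σ : K) (e : M.E) : ∃ e', M.MapsEdge σ e e' := by
  have := MetricGraph.t2 (Γ := Γ)
  refine M.exists_mapsEdge (fun σ x y => ?_) h.smul_mem σ e
  rw [show M.dist = MetricGraph.d from h.isModel, hK]

/-- The slopes of an invariant function are slopes of generators. -/
lemma exists_slope_eq (h : IsAdapted K D F M a m) (hF : Generates K D F) {g : Γ → EReal}
    (hg : g ∈ RInv K D) {e : M.E} {b : ℝ} {k : ℤ}
    (hinf : {t ∈ Ioo 0 (M.len e) | g (M.param e t) = lin b k t}.Infinite) :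
    ∃ i, (∃ x, F i x ≠ ⊥) ∧ m i e = k := by
  obtain ⟨c, hc, hgc⟩ := hF.exists_eq hg
  choose i hi using fun t => hgc (M.param e t)
  -- Pigeonhole: infinitely many parameters and finitely many indices, so one generator realizes `g`
  -- at two of them. The finite constant `c i` drops out of the difference, which leaves equality of
  -- slopes.
  obtain ⟨s, hs, t, ht, hst, hist⟩ := hinf.exists_ne_map_eq_of_mapsTo (f := i) (t := Set.univ)
    (fun _ _ => Set.mem_univ _) Set.finite_univ
  have key : ∀ t ∈ {t ∈ Ioo 0 (M.len e) | g (M.param e t) = lin b k t},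
      (∃ x, F (i t) x ≠ ⊥) ∧ ∃ c' : ℝ, c (i t) = c' ∧
        b + k * t.toReal = c' + (a (i t) e + m (i t) e * t.toReal) := by
    rintro t ⟨htI, ht⟩
    have htt : t ≠ ∞ := (htI.2.trans_le le_top).ne
    rw [hi t, lin_of_ne_top _ _ htt] at ht
    obtain ⟨c', y, hc', hy, hb⟩ := exists_coe_of_add_eq_coe (hc _) ht.symm
    have hbot : F (i t) (M.param e t) ≠ ⊥ := by simp [hy]
    refine ⟨⟨_, hbot⟩, c', hc', ?_⟩
    rcases h.eq_bot_or (i t) with h1 | ⟨-, h1, -⟩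
    · exact absurd (h1 _) hbot
    · rw [h1 e t htI.2.le, lin_of_ne_top _ _ htt, EReal.coe_eq_coe_iff] at hy
      rw [hb, hy]
  obtain ⟨hne, c₁, hc₁, h1⟩ := key s hs
  obtain ⟨-, c₂, hc₂, h2⟩ := key t ht
  rw [← hist] at hc₂ h2
  obtain rfl : c₁ = c₂ := EReal.coe_injective (hc₁.symm.trans hc₂)
  refine ⟨i s, hne, ?_⟩
  have hst' : s.toReal ≠ t.toReal := fun h' => hst
    ((ENNReal.toReal_eq_toReal_iff' (hs.1.2.trans_le le_top).ne (ht.1.2.trans_le le_top).ne).1 h')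
  have h3 : (m (i s) e : ℝ) = k := by
    refine mul_right_cancel₀ (sub_ne_zero.2 hst') ?_
    linarith
  exact_mod_cast h3

/-- The constant `0` lies in `R(D)^K`, and its slope must be that of a generator. -/
lemma exists_slope_zero (h : IsAdapted K D F M a m) (hF : Generates K D F) (hD : 0 ≤ D) (e : M.E) :
    ∃ i, (∃ x, F i x ≠ ⊥) ∧ m i e = 0 := by
  refine h.exists_slope_eq hF (const_mem_RInv hD 0) (b := 0) ?_
  refine (Ioo_infinite (M.len_pos e)).mono fun t ht => ⟨ht, ?_⟩
  rw [Int.cast_zero, lin_slope_zero]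

/-- If some generator is not constant on an edge, then two of them have consecutive slopes. -/
theorem exists_consecutive_slopes [ContinuousConstSMul K Γ] (h : IsAdapted K D F M a m)
    (hF : Generates K D F) (hD : 0 ≤ D)
    (hK : ∀ (σ : K) (x y : Γ), MetricGraph.d (σ • x) (σ • y) = MetricGraph.d x y) {e : M.E}
    {i : Fin (n + 1)} (hi : ∃ x, F i x ≠ ⊥) (hie : m i e ≠ 0) :
    ∃ j k, (∃ x, F j x ≠ ⊥) ∧ (∃ x, F k x ≠ ⊥) ∧ (m j e - m k e) ^ 2 = 1 := by
  obtain ⟨j, hj, hj0⟩ := h.exists_slope_zero hF hD e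
  obtain ⟨hs, -, hDs⟩ := (h.eq_bot_or i).resolve_left fun h' => hi.elim fun x hx => hx (h' x)
  -- The truncation of `F i` is an invariant element of `R(D)` with slope `±1` on part of `e`; the
  -- generator `l` with that slope is paired with the generator `j` of slope zero.
  obtain ⟨c, c', hgen, b, k, hk, hinf⟩ := GraphModel.exists_bendFun_slope_one hs hie
  obtain ⟨N, q, hN, hq, hDq⟩ := GraphModel.exists_hasSlopes_bendFun hs hgen hD hDs
  have hmem : M.bendFun (m i) (F i) c c' ∈ RInv K D :=
    mem_RInv (hN.trans h.isModel) hq hDq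
      (GraphModel.bendFun_smul hs h.smul_mem (h.exists_mapsEdge hK) (hF.1 i).2 c c')
  obtain ⟨l, hl, hlk⟩ := h.exists_slope_eq hF hmem hinf
  exact ⟨l, j, hl, hj, by rw [hlk, hj0, sub_zero, hk]⟩

end IsAdapted

end Generators

/-! ### Tropical projective space -/

section TropicalProjectiveSpace

variable {n : ℕ}

lemma TP.mk_eq_mk {u v : TropVec n} :
    TP.mk u = TP.mk v ↔ ∃ c : ℝ, ∀ i, u.1 i = (c : EReal) + v.1 i :=
  Quotient.eq (r := tropSetoid n)

lemma continuous_mk : Continuous (TP.mk : TropVec n → TP n) := continuous_quotient_mk'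

/-- The maximum of the coordinates. -/
def TropVec.max (v : TropVec n) : EReal := Finset.univ.sup v.1

lemma TropVec.exists_max_eq_coe (v : TropVec n) : ∃ c : ℝ, v.max = c := by
  obtain ⟨j, hj⟩ := v.2.2
  have h1 : v.max ≠ ⊥ := fun h =>
    hj (le_bot_iff.1 ((Finset.le_sup (f := v.1) (Finset.mem_univ j)).trans_eq h))
  have h2 : v.max ≠ ⊤ := by
    obtain ⟨i, -, hi⟩ := Finset.exists_mem_eq_sup Finset.univ Finset.univ_nonempty v.1
    rw [TropVec.max, hi]
    exact v.2.1 i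
  exact ⟨v.max.toReal, (EReal.coe_toReal h2 h1).symm⟩

lemma TropVec.continuous_max : Continuous (TropVec.max : TropVec n → EReal) := by
  refine Continuous.finset_sup_apply fun i _ => ?_
  exact (continuous_apply i).comp continuous_subtype_val

lemma TropVec.max_add {u v : TropVec n} {c : ℝ} (h : ∀ i, u.1 i = (c : EReal) + v.1 i) :
    u.max = c + v.max := by
  have h1 : Monotone fun y : EReal => (c : EReal) + y := fun _ _ h => add_le_add_right h _
  have := Finset.apply_sup_eq_sup_comp_of_linearOrder (s := Finset.univ) (f := v.1) _ h1 (by simp)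
  simp only [TropVec.max, this]
  congr 1
  exact funext h

/-- The coordinates, normalized so that their maximum is zero. -/
def TropVec.normalize (v : TropVec n) (i : Fin (n + 1)) : EReal := v.1 i + -v.max

lemma TropVec.continuous_normalize :
    Continuous (TropVec.normalize : TropVec n → Fin (n + 1) → EReal) := by
  refine continuous_pi fun i => continuous_iff_continuousAt.2 fun v => ?_
  obtain ⟨c, hc⟩ := v.exists_max_eq_coe
  have h1 : ContinuousAt (fun v : TropVec n => v.1 i) v :=
    ((continuous_apply i).comp continuous_subtype_val).continuousAt
  have h2 : ContinuousAt (fun v : TropVec n => -v.max) v :=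
    (continuous_neg.comp TropVec.continuous_max).continuousAt
  refine ContinuousAt.comp (f := fun v : TropVec n => (v.1 i, -v.max))
    (g := fun p : EReal × EReal => p.1 + p.2) (EReal.continuousAt_add ?_ ?_) (h1.prodMk h2)
  · right
    rw [hc, ← EReal.coe_neg]
    exact EReal.coe_ne_bot _
  · right
    rw [hc, ← EReal.coe_neg]
    exact EReal.coe_ne_top _

/-- The normalized coordinates are a complete invariant of a projective point, because adding a
scalar shifts the maximum by the same amount. -/
lemma TropVec.normalize_eq_iff {u v : TropVec n} :
    u.normalize = v.normalize ↔ TP.mk u = TP.mk v := by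
  obtain ⟨a, ha⟩ := u.exists_max_eq_coe
  obtain ⟨b, hb⟩ := v.exists_max_eq_coe
  rw [TP.mk_eq_mk]
  constructor
  · intro h
    refine ⟨a - b, fun i => ?_⟩
    have hi := congr_fun h i
    simp only [TropVec.normalize, ha, hb, ← EReal.coe_neg] at hi
    have hu := u.2.1 i
    have hv := v.2.1 i
    generalize u.1 i = x at *
    generalize v.1 i = y at *
    induction x with
    | top => exact absurd rfl hu
    | bot =>
      induction y with
      | top => exact absurd rfl hv
      | bot => simp
      | coe y =>
        rw [EReal.bot_add, ← EReal.coe_add] at hi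
        exact absurd hi.symm (EReal.coe_ne_bot _)
    | coe x =>
      induction y with
      | top => exact absurd rfl hv
      | bot =>
        rw [EReal.bot_add, ← EReal.coe_add] at hi
        exact absurd hi (EReal.coe_ne_bot _)
      | coe y =>
        rw [← EReal.coe_add, ← EReal.coe_add, EReal.coe_eq_coe_iff] at hi
        rw [← EReal.coe_add, EReal.coe_eq_coe_iff]
        linarith
  · rintro ⟨c, h⟩
    funext i
    have hm := TropVec.max_add h
    rw [ha, hb, ← EReal.coe_add, EReal.coe_eq_coe_iff] at hm
    simp only [TropVec.normalize, h i, ha, hb, hm, ← EReal.coe_neg]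
    rw [add_right_comm, ← EReal.coe_add, add_comm (v.1 i)]
    congr 2
    ring

/-- The normalized coordinates map `TP n` continuously and injectively to a Hausdorff space.
Uniqueness of limits is what gives the limit in `rationalMap` a definite value. -/
instance : T2Space (TP n) := by
  let g : TP n → Fin (n + 1) → EReal :=
    Quotient.lift TropVec.normalize fun u v h => TropVec.normalize_eq_iff.2 (Quotient.sound h)
  have hg : Continuous g := TropVec.continuous_normalize.quotient_lift _
  refine T2Space.of_injective_continuous (f := g) ?_ hg
  rintro ⟨u⟩ ⟨v⟩ h
  exact TropVec.normalize_eq_iff.1 h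

/-! ### Lattice length -/

lemma HasLatticeLength.eq_bot_iff {p q : TP n} {l : ℝ≥0} (h : HasLatticeLength p q l)
    {u v : TropVec n} (hu : TP.mk u = p) (hv : TP.mk v = q) (i : Fin (n + 1)) :
    u.1 i = ⊥ ↔ v.1 i = ⊥ := by
  obtain ⟨u', v', w, rfl, rfl, hw, -⟩ := h
  obtain ⟨c, hc⟩ := TP.mk_eq_mk.1 hu
  obtain ⟨d, hd⟩ := TP.mk_eq_mk.1 hv
  rw [hc, hd, hw i]
  simp only [EReal.add_eq_bot_iff, EReal.coe_ne_bot, false_or, or_false]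

/-- The lattice length between distinct points is unique. -/
lemma HasLatticeLength.unique {p q : TP n} {l l' : ℝ≥0} (hpq : p ≠ q)
    (h : HasLatticeLength p q l) (h' : HasLatticeLength p q l') : l = l' := by
  obtain ⟨u, v, w, hu, hv, hw, hprim⟩ := h
  obtain ⟨u', v', w', hu', hv', hw', hprim'⟩ := h'
  obtain ⟨c, hc⟩ := TP.mk_eq_mk.1 (hu'.trans hu.symm)
  obtain ⟨d, hd⟩ := TP.mk_eq_mk.1 (hv'.trans hv.symm)
  have hsupp : ∀ i, u'.1 i ≠ ⊥ ↔ u.1 i ≠ ⊥ := fun i => by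
    rw [hc i]
    simp [EReal.add_eq_bot_iff]
  have hl : l ≠ 0 := by
    rintro rfl
    refine hpq ?_
    rw [← hu, ← hv]
    exact congr_arg _ (Subtype.ext (funext fun i => by simp [hw i]))
  have hl' : l' ≠ 0 := by
    rintro rfl
    refine hpq ?_
    rw [← hu', ← hv']
    exact congr_arg _ (Subtype.ext (funext fun i => by simp [hw' i]))
  -- On the finite coordinates the two displacements `l' • w'` and `l • w` differ by a multiple of
  -- `(1, …, 1)`; differences of coordinates remove it.
  have key : ∀ i, u.1 i ≠ ⊥ → (l' : ℝ) * w' i = l * w i + (d - c) := by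
    intro i hi
    have h1 := hw' i
    rw [hd i, hc i, hw i] at h1
    have hi' := u.2.1 i
    generalize u.1 i = y at *
    induction y with
    | bot => exact absurd rfl hi
    | top => exact absurd rfl hi'
    | coe y =>
      simp only [← EReal.coe_add, EReal.coe_eq_coe_iff] at h1
      linarith
  have key2 : ∀ i j, u.1 i ≠ ⊥ → u.1 j ≠ ⊥ →
      (l' : ℝ) * ((w' i - w' j : ℤ) : ℝ) = l * ((w i - w j : ℤ) : ℝ) := by
    intro i j hi hj
    have h1 := key i hi
    have h2 := key j hj
    push_cast
    linarith
  -- If all differences of `w` vanished, then `k = 0` would divide them, against primitivity.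
  obtain ⟨i, j, hi, hj, hij⟩ : ∃ i j, u.1 i ≠ ⊥ ∧ u.1 j ≠ ⊥ ∧ w i - w j ≠ 0 := by
    by_contra! hcon
    exact absurd (hprim 0 fun i j hi hj => by simp [hcon i j hi hj]) (by norm_num)
  have hlpos : (0 : ℝ) < l := by positivity
  have hlpos' : (0 : ℝ) < l' := by positivity
  -- The ratio of `l'` to `l` is `B / A` in lowest terms. Then `B` divides all differences of `w`
  -- and `A` all those of `w'`, so primitivity makes both `1`.
  obtain ⟨A, B, hAB, hA, hB⟩ := Nat.exists_coprime (w' i - w' j).natAbs (w i - w j).natAbs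
  set g := ((w' i - w' j).natAbs).gcd (w i - w j).natAbs with hg
  have hg0 : g ≠ 0 := by
    intro h0
    rw [h0, mul_zero, Int.natAbs_eq_zero] at hB
    exact hij hB
  have hrat : (l' : ℝ) * A = l * B := by
    have h1 := congr_arg abs (key2 i j hi hj)
    rw [abs_mul, abs_mul, abs_of_pos hlpos, abs_of_pos hlpos', ← Int.cast_abs, ← Int.cast_abs,
      Int.abs_eq_natAbs, Int.abs_eq_natAbs, hA, hB] at h1
    push_cast at h1
    refine mul_right_cancel₀ (Nat.cast_ne_zero.2 hg0 : (g : ℝ) ≠ 0) ?_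
    linarith
  have hcross : ∀ i j, u.1 i ≠ ⊥ → u.1 j ≠ ⊥ →
      (B : ℤ) * (w' i - w' j) = A * (w i - w j) := by
    intro i j hi hj
    have h1 := key2 i j hi hj
    have h2 : ((B : ℝ) * ((w' i - w' j : ℤ) : ℝ)) = A * ((w i - w j : ℤ) : ℝ) := by
      refine mul_left_cancel₀ (mul_pos hlpos hlpos').ne' ?_
      calc (l : ℝ) * l' * (B * ((w' i - w' j : ℤ) : ℝ))
          = (l * B) * (l' * ((w' i - w' j : ℤ) : ℝ)) := by ring
        _ = (l' * A) * (l * ((w i - w j : ℤ) : ℝ)) := by rw [h1, hrat]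
        _ = _ := by ring
    exact_mod_cast h2
  have hcopA : IsCoprime (A : ℤ) B := Nat.isCoprime_iff_coprime.2 hAB
  have hB1 : B = 1 := hprim B fun i j hi hj =>
    hcopA.symm.dvd_of_dvd_mul_left (Dvd.intro _ (hcross i j hi hj))
  have hA1 : A = 1 := hprim' A fun i j hi hj =>
    hcopA.dvd_of_dvd_mul_left
      (Dvd.intro _ (hcross i j ((hsupp i).1 hi) ((hsupp j).1 hj)).symm)
  rw [hA1, hB1, Nat.cast_one, mul_one, mul_one] at hrat
  exact_mod_cast hrat.symm

lemma HasLatticeLength.latticeDist_eq {p q : TP n} {l : ℝ≥0} (hpq : p ≠ q)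
    (h : HasLatticeLength p q l) : latticeDist p q = l := by
  rw [latticeDist, if_neg hpq]
  refine le_antisymm (iInf₂_le l h) (le_iInf₂ fun l' h' => ?_)
  rw [h.unique hpq h']

/-! ### Affine paths -/

open Classical in
/-- The path with coordinates `a i + k i * t` for `i` in `S`, and `-∞` for the other `i`. -/
def linVec (S : Set (Fin (n + 1))) (a : Fin (n + 1) → ℝ) (k : Fin (n + 1) → ℤ) (t : ℝ≥0∞)
    (i : Fin (n + 1)) : EReal := if i ∈ S then lin (a i) (k i) t else ⊥

variable {S : Set (Fin (n + 1))} {a : Fin (n + 1) → ℝ} {k : Fin (n + 1) → ℤ}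

lemma continuous_linVec : Continuous (linVec S a k) := by
  refine continuous_pi fun i => ?_
  unfold linVec
  split_ifs
  · exact continuous_lin _ _
  · exact continuous_const

/-- Non-positive slopes keep the coordinates away from `+∞` at the parameter `∞`, and a zero slope
keeps one of them finite. Subtracting the largest slope brings any family of slopes into this form.
-/
lemma linVec_spec {L : ℝ≥0∞} (hL : L = ∞ → ∀ i ∈ S, k i ≤ 0) (h0 : ∃ i ∈ S, k i = 0) {t : ℝ≥0∞}
    (ht : t ≤ L) : (∀ i, linVec S a k t i ≠ ⊤) ∧ ∃ i, linVec S a k t i ≠ ⊥ := by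
  constructor
  · intro i
    unfold linVec
    split_ifs with hi
    · rcases eq_or_ne t ∞ with rfl | htt
      · rcases (hL (top_le_iff.1 ht) i hi).lt_or_eq with h | h
        · rw [lin_top_of_neg _ (by exact_mod_cast h)]
          exact bot_ne_top
        · rw [h, Int.cast_zero, lin_slope_zero]
          exact EReal.coe_ne_top _
      · rw [lin_of_ne_top _ _ htt]
        exact EReal.coe_ne_top _
    · exact bot_ne_top
  · obtain ⟨i, hi, h⟩ := h0
    refine ⟨i, ?_⟩
    rw [linVec, if_pos hi, h, Int.cast_zero, lin_slope_zero]
    exact EReal.coe_ne_bot _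

/-- An affine path whose slopes are primitive is parametrized by lattice length. -/
theorem latticeDist_linVec {L : ℝ≥0∞} (hL : L = ∞ → ∀ i ∈ S, k i ≤ 0)
    (h0 : ∃ i ∈ S, k i = 0) (h1 : ∃ i ∈ S, ∃ j ∈ S, (k i - k j) ^ 2 = 1) {s t : ℝ≥0∞} (hs : s ≤ L)
    (ht : t ≤ L) : latticeDist (TP.mk ⟨linVec S a k s, linVec_spec hL h0 hs⟩)
      (TP.mk ⟨linVec S a k t, linVec_spec hL h0 ht⟩) = segLen s t := by
  obtain ⟨i, hi, j, hj, hij⟩ := h1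
  have hsq : k i - k j = 1 ∨ k i - k j = -1 := sq_eq_one_iff.1 hij
  rcases eq_or_ne s t with rfl | hst
  · rw [latticeDist, if_pos rfl, segLen_self]
  have hfin : ∀ s, s ≠ ∞ → ∀ i ∈ S, linVec S a k s i = ((a i + k i * s.toReal : ℝ) : EReal) :=
    fun s hs i hi => by rw [linVec, if_pos hi, lin_of_ne_top _ _ hs]
  -- Two distinct non-positive slopes cannot both be zero, so some coordinate tends to `-∞`. Hence
  -- the end at infinity has infinite lattice distance from the rest of the path.
  have hinf : L = ∞ → ∃ i ∈ S, linVec S a k ∞ i = ⊥ := by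
    intro h
    have h2 := hL h i hi
    have h3 := hL h j hj
    have : k i < 0 ∨ k j < 0 := by omega
    rcases this with h4 | h4
    · exact ⟨i, hi, by rw [linVec, if_pos hi, lin_top_of_neg _ (by exact_mod_cast h4)]⟩
    · exact ⟨j, hj, by rw [linVec, if_pos hj, lin_top_of_neg _ (by exact_mod_cast h4)]⟩
  set p := TP.mk ⟨linVec S a k s, linVec_spec hL h0 hs⟩ with hp
  set q := TP.mk ⟨linVec S a k t, linVec_spec hL h0 ht⟩ with hq
  have hne : s = ∞ ∨ t = ∞ → latticeDist p q = segLen s t := by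
    intro hor
    have hLt : L = ∞ := by
      rcases hor with rfl | rfl
      · exact top_le_iff.1 hs
      · exact top_le_iff.1 ht
    obtain ⟨l, hl, hbot⟩ := hinf hLt
    have hnot : ¬(linVec S a k s l = ⊥ ↔ linVec S a k t l = ⊥) := by
      rcases hor with rfl | rfl
      · rw [hfin t hst.symm l hl]
        exact fun h => EReal.coe_ne_bot _ (h.1 hbot)
      · rw [hfin s hst l hl]
        exact fun h => EReal.coe_ne_bot _ (h.2 hbot)
    have hseg : segLen s t = ∞ := by
      rcases hor with rfl | rfl
      · exact segLen_top_left hst.symm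
      · rw [segLen_comm]
        exact segLen_top_left hst
    have hpq : p ≠ q := by
      intro h
      obtain ⟨c, hc⟩ := TP.mk_eq_mk.1 h
      refine hnot ?_
      have := hc l
      dsimp only at this
      rw [this]
      simp [EReal.add_eq_bot_iff]
    rw [latticeDist, if_neg hpq, hseg]
    simp only [iInf_eq_top]
    intro l' h'
    exact absurd (h'.eq_bot_iff hp.symm hq.symm l) hnot
  rcases eq_or_ne s ∞ with hs' | hs'
  · exact hne (Or.inl hs')
  rcases eq_or_ne t ∞ with ht' | ht'
  · exact hne (Or.inr ht')
  have hstr : s.toReal ≠ t.toReal := fun h => hst ((ENNReal.toReal_eq_toReal_iff' hs' ht').1 h)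
  have hpq : p ≠ q := by
    intro h
    obtain ⟨c, hc⟩ := TP.mk_eq_mk.1 h
    have e1 := hc i
    have e2 := hc j
    dsimp only at e1 e2
    rw [hfin s hs' i hi, hfin t ht' i hi, ← EReal.coe_add, EReal.coe_eq_coe_iff] at e1
    rw [hfin s hs' j hj, hfin t ht' j hj, ← EReal.coe_add, EReal.coe_eq_coe_iff] at e2
    have e3 : ((k i - k j : ℤ) : ℝ) * (s.toReal - t.toReal) = 0 := by
      push_cast
      linarith
    rcases mul_eq_zero.1 e3 with h | h
    · have : k i - k j = 0 := by exact_mod_cast h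
      omega
    · exact hstr (by linarith)
  -- Lattice lengths are non-negative, so the direction of travel is put into the sign of the
  -- primitive vector.
  obtain ⟨ε, hε, hεl⟩ : ∃ ε : ℤ, (ε = 1 ∨ ε = -1) ∧
      |s.toReal - t.toReal| * ε = t.toReal - s.toReal := by
    rcases le_total s.toReal t.toReal with h | h
    · exact ⟨1, Or.inl rfl, by rw [abs_of_nonpos (by linarith)]; push_cast; ring⟩
    · exact ⟨-1, Or.inr rfl, by rw [abs_of_nonneg (by linarith)]; push_cast; ring⟩
  have hlat : HasLatticeLength p q (Real.nnabs (s.toReal - t.toReal)) := by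
    refine ⟨_, _, fun l => ε * k l, hp.symm, hq.symm, fun l => ?_, fun d hd => ?_⟩
    · by_cases hl : l ∈ S
      · dsimp only
        rw [hfin s hs' l hl, hfin t ht' l hl, ← EReal.coe_add, EReal.coe_eq_coe_iff]
        have : (|s.toReal - t.toReal|) * (((ε * k l : ℤ)) : ℝ) =
            (t.toReal - s.toReal) * k l := by
          rw [← hεl]
          push_cast
          ring
        rw [Real.coe_nnabs, this]
        ring
      · simp [linVec, hl]
    · have hreg : ∀ l ∈ S, linVec S a k s l ≠ ⊥ := fun l hl => by
        rw [hfin s hs' l hl]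
        exact EReal.coe_ne_bot _
      have h2 := hd i j (hreg i hi) (hreg j hj)
      rw [← mul_sub] at h2
      have h3 : (d : ℤ) ∣ 1 := by
        rcases hε with rfl | rfl <;> rcases hsq with h | h <;> rw [h] at h2 <;> simpa using h2
      exact_mod_cast Int.eq_one_of_dvd_one (by positivity) h3
  rw [hlat.latticeDist_eq hpq]
  have h5 := segLen_ofReal (s := s.toReal) (t := t.toReal) ENNReal.toReal_nonneg
    ENNReal.toReal_nonneg
  rw [ENNReal.ofReal_toReal hs', ENNReal.ofReal_toReal ht'] at h5
  rw [h5, ← Real.coe_nnabs, ENNReal.ofReal_coe_nnreal]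

end TropicalProjectiveSpace

/-- A map on a graph is continuous if it is so on every edge. -/
lemma GraphModel.continuous_of_edges {X Y : Type*} [TopologicalSpace X] [T2Space X]
    [TopologicalSpace Y] (M : GraphModel X) {g : X → Y}
    (hg : ∀ e, ContinuousOn (fun t => g (M.param e t)) (Icc 0 (M.len e))) : Continuous g := by
  -- The preimage of a closed set is the union of finitely many points and finitely many continuous
  -- images of compact sets of parameters.
  refine continuous_iff_isClosed.2 fun C hC => ?_
  have : g ⁻¹' C = ((M.V : Set X) ∩ g ⁻¹' C) ∪
      ⋃ e, M.param e '' (Icc 0 (M.len e) ∩ (fun t => g (M.param e t)) ⁻¹' C) := by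
    ext x
    constructor
    · intro hx
      rcases M.cover x with h | ⟨e, t, ht, rfl⟩
      · exact Or.inl ⟨h, hx⟩
      · exact Or.inr (mem_iUnion.2 ⟨e, t, ⟨Ioo_subset_Icc_self ht, hx⟩, rfl⟩)
    · rintro (h | h)
      · exact h.2
      · obtain ⟨e, t, ht, rfl⟩ := mem_iUnion.1 h
        exact ht.2
  rw [this]
  refine (M.V.finite_toSet.subset inter_subset_left).isClosed.union
    (isClosed_iUnion_of_finite fun e => ?_)
  have h1 : IsCompact (Icc 0 (M.len e) ∩ (fun t => g (M.param e t)) ⁻¹' C) :=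
    isCompact_Icc.of_isClosed_subset ((hg e).preimage_isClosed_of_isClosed isClosed_Icc hC)
      inter_subset_left
  exact (h1.image_of_continuousOn ((M.continuousOn_param e).mono inter_subset_left)).isClosed

/-- The indices of the members of the family other than `-∞`. -/
def properIndices {Γ : Type*} {n : ℕ} (F : Fin (n + 1) → Γ → EReal) : Set (Fin (n + 1)) :=
  {i | ∃ x, F i x ≠ ⊥}

lemma eq_bot_of_not_mem_properIndices {Γ : Type*} {n : ℕ} {F : Fin (n + 1) → Γ → EReal}
    {i : Fin (n + 1)} (hi : i ∉ properIndices F) (x : Γ) : F i x = ⊥ := by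
  by_contra hx
  exact hi ⟨x, hx⟩

lemma KInjective.exists_smul_eq {Γ K Y : Type*} [Group K] [MulAction K Γ]
    {φ : Γ → Y} (hφ : KInjective K φ) {x y : Γ} (hxy : φ x = φ y) : ∃ σ : K, σ • x = y := by
  by_contra hcon
  refine hφ y x (fun h => hcon ?_) hxy.symm
  exact MulAction.mem_orbit_iff.1 (h ▸ MulAction.mem_orbit_self y)

section RationalMaps

variable {Γ : Type*} [TopologicalSpace Γ] [MetricGraph Γ] {K : Type*} [Group K] [MulAction K Γ]
  {D : Γ →₀ ℤ} {n : ℕ} {F : Fin (n + 1) → Γ → EReal}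

/-! ### The rational map of a generating set -/

namespace IsAdapted

variable {M : GraphModel Γ} {a : Fin (n + 1) → M.E → ℝ} {m : Fin (n + 1) → M.E → ℤ}

lemma eq_lin (h : IsAdapted K D F M a m) {i : Fin (n + 1)} (hi : i ∈ properIndices F) {e : M.E}
    {t : ℝ≥0∞} (ht : t ≤ M.len e) : F i (M.param e t) = lin (a i e) (m i e) t :=
  ((h.eq_bot_or i).resolve_left fun h' => hi.elim fun x hx => hx (h' x)).2.1 e t ht

/-- Some generator has the largest slope on a given edge. -/
lemma exists_max_slope (hF : Generates K D F) (hD : 0 ≤ D) (m : Fin (n + 1) → M.E → ℤ) (e : M.E) :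
    ∃ j ∈ properIndices F, ∀ i ∈ properIndices F, m i e ≤ m j e := by
  obtain ⟨i, y, hy⟩ := hF.exists_finite hD (M.param e 0)
  exact Set.exists_max_image _ (fun i => m i e) (properIndices F).toFinite
    ⟨i, M.param e 0, by simp [hy]⟩

lemma mem_regularPts (h : IsAdapted K D F M a m) (hF : Generates K D F) (hD : 0 ≤ D) {e : M.E}
    {t : ℝ≥0∞} (ht : t ≤ M.len e) (htt : t ≠ ∞) : M.param e t ∈ regularPts F := by
  refine ⟨fun i => ?_, ?_⟩
  · by_cases hi : i ∈ properIndices F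
    · rw [h.eq_lin hi ht, lin_of_ne_top _ _ htt]
      exact EReal.coe_ne_top _
    · rw [eq_bot_of_not_mem_properIndices hi]
      exact bot_ne_top
  · obtain ⟨i, y, hy⟩ := hF.exists_finite hD (M.param e t)
    exact ⟨i, by simp [hy]⟩

lemma exists_of_not_mem_regularPts (h : IsAdapted K D F M a m) (hF : Generates K D F)
    (hD : 0 ≤ D) {x : Γ} (hx : x ∉ regularPts F) : ∃ e, M.len e = ∞ ∧ M.param e ∞ = x := by
  obtain ⟨i, y, hy⟩ := hF.exists_finite hD x
  have : ∃ i, F i x = ⊤ := by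
    by_contra! hcon
    exact hx ⟨hcon, i, by simp [hy]⟩
  obtain ⟨i, hi⟩ := this
  rcases h.eq_bot_or i with h1 | ⟨h1, -⟩
  · rw [h1] at hi
    exact absurd hi bot_ne_top
  · exact h1.2 x (Or.inl hi)

lemma mem_closure_regularPts (h : IsAdapted K D F M a m) (hF : Generates K D F)
    (hD : 0 ≤ D) (x : Γ) : x ∈ closure (regularPts F) := by
  by_cases hx : x ∈ regularPts F
  · exact subset_closure hx
  obtain ⟨e, he, rfl⟩ := h.exists_of_not_mem_regularPts hF hD hx
  have h1 : M.len e ∈ closure (Ioo 0 (M.len e)) := by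
    rw [closure_Ioo (M.len_pos e).ne]
    exact ⟨bot_le, le_rfl⟩
  have h2 : ContinuousWithinAt (M.param e) (Ioo 0 (M.len e)) (M.len e) :=
    (M.continuousOn_param e _ ⟨bot_le, le_rfl⟩).mono Ioo_subset_Icc_self
  have h3 := h2.mem_closure_image h1
  rw [he] at h3
  refine closure_mono ?_ h3
  rintro _ ⟨t, ht, rfl⟩
  exact h.mem_regularPts hF hD (ht.2.le.trans he.ge) ht.2.ne

/-- On the edges of an adapted model the rational map is affine, and it is continuous. -/
theorem exists_rationalMap_eq (h : IsAdapted K D F M a m) (hF : Generates K D F) (hD : 0 ≤ D) :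
    Continuous (rationalMap F) ∧ ∀ e, ∃ (k : Fin (n + 1) → ℤ)
      (hk : M.len e = ∞ → ∀ i ∈ properIndices F, k i ≤ 0) (hk0 : ∃ i ∈ properIndices F, k i = 0),
      (∀ i j, k i - k j = m i e - m j e) ∧ ∀ t, ∀ ht : t ≤ M.len e, rationalMap F (M.param e t) =
        TP.mk ⟨linVec (properIndices F) (fun i => a i e) k t, linVec_spec hk hk0 ht⟩ := by
  classical
  have := MetricGraph.t2 (Γ := Γ)
  choose j hjS hj using exists_max_slope (M := M) hF hD m
  -- Subtracting the largest slope times `t` from all coordinates does not change the projective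
  -- point at finite `t`, and the resulting path extends continuously to `t = ∞`.
  let k : M.E → Fin (n + 1) → ℤ := fun e i => m i e - m (j e) e
  have hk : ∀ e (L : ℝ≥0∞), L = ∞ → ∀ i ∈ properIndices F, k e i ≤ 0 := fun e _ _ i hi =>
    sub_nonpos.2 (hj e i hi)
  have hk0 : ∀ e, ∃ i ∈ properIndices F, k e i = 0 := fun e => ⟨j e, hjS e, sub_self _⟩
  let path : M.E → ℝ≥0∞ → TP n := fun e t =>
    TP.mk ⟨linVec (properIndices F) (fun i => a i e) (k e) t,
      linVec_spec (hk e ∞) (hk0 e) le_top⟩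
  have hpath : ∀ e, Continuous (path e) := fun e =>
    continuous_mk.comp (continuous_linVec.subtype_mk _)
  have hcoord : ∀ e t, ∀ ht : t ≤ M.len e, ∀ hx : M.param e t ∈ regularPts F,
      homCoord F ⟨M.param e t, hx⟩ = path e t := by
    intro e t ht hx
    refine TP.mk_eq_mk.2 ?_
    rcases eq_or_ne t ∞ with rfl | htt
    -- At a regular point at infinity no coordinate is `+∞` and not all are `-∞`. So the largest
    -- slope is already `0`, and the normalization changes nothing.
    · have hle : ∀ i ∈ properIndices F, m i e ≤ 0 := by
        intro i hi
        by_contra! hpos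
        exact hx.1 i (by rw [h.eq_lin hi ht, lin_top_of_pos _ (by exact_mod_cast hpos)])
      have hj0 : m (j e) e = 0 := by
        refine le_antisymm (hle _ (hjS e)) ?_
        by_contra! hneg
        obtain ⟨i, hi⟩ := hx.2
        have hiS : i ∈ properIndices F := ⟨_, hi⟩
        refine hi ?_
        rw [h.eq_lin hiS ht, lin_top_of_neg _ (by exact_mod_cast (hj e i hiS).trans_lt hneg)]
      refine ⟨0, fun i => ?_⟩
      by_cases hi : i ∈ properIndices F
      · simp only [linVec, if_pos hi, h.eq_lin hi ht, k, hj0, sub_zero, EReal.coe_zero, zero_add]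
      · simp only [linVec, if_neg hi, eq_bot_of_not_mem_properIndices hi, EReal.add_bot]
    · refine ⟨m (j e) e * t.toReal, fun i => ?_⟩
      by_cases hi : i ∈ properIndices F
      · simp only [linVec, if_pos hi, h.eq_lin hi ht, lin_of_ne_top _ _ htt, k]
        rw [← EReal.coe_add, EReal.coe_eq_coe_iff]
        push_cast
        ring
      · simp only [linVec, if_neg hi, eq_bot_of_not_mem_properIndices hi, EReal.add_bot]
  -- `Φ` is the continuous extension built from the paths. The leaf condition makes the edge at a
  -- point at infinity unique, and the limit in `rationalMap` must then be the value of `Φ`.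
  let Φ : Γ → TP n := fun x =>
    if hx : x ∈ regularPts F then homCoord F ⟨x, hx⟩
    else if hx : ∃ e, M.len e = ∞ ∧ M.param e ∞ = x then path hx.choose ∞
    else Classical.arbitrary _
  have hΦ : ∀ e, ∀ t ≤ M.len e, Φ (M.param e t) = path e t := by
    intro e t ht
    by_cases hx : M.param e t ∈ regularPts F
    · simp only [Φ, dif_pos hx]
      exact hcoord e t ht hx
    · have htt : t = ∞ := by
        by_contra htt
        exact hx (h.mem_regularPts hF hD ht htt)
      subst htt
      have he : M.len e = ∞ := top_le_iff.1 ht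
      have hex : ∃ e', M.len e' = ∞ ∧ M.param e' ∞ = M.param e ∞ := ⟨e, he, rfl⟩
      simp only [Φ, dif_neg hx, dif_pos hex]
      rw [(M.infinite_leaf e he hex.choose).2 (by rw [hex.choose_spec.1, hex.choose_spec.2])]
  have hΦc : Continuous Φ := M.continuous_of_edges fun e =>
    (hpath e).continuousOn.congr fun t ht => hΦ e t ht.2
  have hrat : rationalMap F = Φ := by
    funext x
    by_cases hx : x ∈ regularPts F
    · simp only [rationalMap, Φ, dif_pos hx]
    · rw [rationalMap, dif_neg hx]
      have hne : (comap ((↑) : regularPts F → Γ) (𝓝 x)).NeBot :=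
        mem_closure_iff_comap_neBot.1 (h.mem_closure_regularPts hF hD x)
      refine Tendsto.limUnder_eq ?_
      have h1 : homCoord F = fun y : regularPts F => Φ y := by
        funext y
        simp only [Φ, dif_pos y.2]
      rw [h1]
      exact hΦc.continuousAt.tendsto.comp tendsto_comap
  refine ⟨hrat ▸ hΦc, fun e => ⟨k e, hk e _, hk0 e, fun i i' => by simp only [k]; ring, ?_⟩⟩
  intro t ht
  rw [hrat, hΦ e t ht]

/-- The rational map is invariant. -/
lemma rationalMap_smul [ContinuousConstSMul K Γ] (h : IsAdapted K D F M a m)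
    (hF : Generates K D F) (hD : 0 ≤ D) (σ : K) (x : Γ) :
    rationalMap F (σ • x) = rationalMap F x := by
  -- Invariance is evident at the regular points; these are dense, and equality of two continuous
  -- maps to a Hausdorff space is a closed condition.
  have hc := (h.exists_rationalMap_eq hF hD).1
  have hcl : IsClosed {x | rationalMap F (σ • x) = rationalMap F x} :=
    isClosed_eq (hc.comp (continuous_const_smul σ)) hc
  refine closure_minimal (fun y hy => ?_) hcl (h.mem_closure_regularPts hF hD x)
  have hinv : ∀ i, F i (σ • y) = F i y := fun i => (hF.1 i).2 σ y
  have hy' : σ • y ∈ regularPts F := by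
    simpa only [regularPts, mem_ofPred_eq, hinv] using hy
  rw [mem_ofPred_eq, rationalMap, dif_pos hy', rationalMap, dif_pos hy]
  exact congr_arg TP.mk (Subtype.ext (funext hinv))

end IsAdapted

/-- If the rational map separates orbits, then it preserves distances on the edges of an adapted
model. -/
theorem IsAdapted.latticeDist_eq [Finite K] [ContinuousConstSMul K Γ] {M : GraphModel Γ}
    {a : Fin (n + 1) → M.E → ℝ} {m : Fin (n + 1) → M.E → ℤ} (h : IsAdapted K D F M a m)
    (hF : Generates K D F) (hD : 0 ≤ D)
    (hK : ∀ (σ : K) (x y : Γ), MetricGraph.d (σ • x) (σ • y) = MetricGraph.d x y)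
    (hinj : KInjective K (rationalMap F)) (e : M.E) {s t : ℝ≥0∞} (hs : s ≤ M.len e)
    (ht : t ≤ M.len e) :
    latticeDist (rationalMap F (M.param e s)) (rationalMap F (M.param e t)) = segLen s t := by
  obtain ⟨k, hk, hk0, hkm, hφ⟩ := (h.exists_rationalMap_eq hF hD).2 e
  rw [hφ s hs, hφ t ht]
  refine latticeDist_linVec hk hk0 ?_ hs ht
  suffices ∃ i ∈ properIndices F, m i e ≠ 0 by
    obtain ⟨i, hi, hie⟩ := this
    obtain ⟨j, l, hj, hl, hjl⟩ := h.exists_consecutive_slopes hF hD hK hi hie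
    exact ⟨j, hj, l, hl, by rw [hkm, hjl]⟩
  -- If all slopes vanish, the map is constant on the edge. By `K`-injectivity the infinite open
  -- edge then lies in a single orbit of the finite group.
  by_contra! hcon
  have hk' : ∀ i ∈ properIndices F, k i = 0 := by
    intro i hi
    obtain ⟨j, hj, hj0⟩ := hk0
    have := hkm i j
    rw [hcon i hi, hcon j hj] at this
    omega
  obtain ⟨t₀, ht₀⟩ := exists_between (M.len_pos e)
  have hconst : ∀ t ∈ Ioo 0 (M.len e),
      rationalMap F (M.param e t) = rationalMap F (M.param e t₀) := by
    intro t ht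
    rw [hφ t ht.2.le, hφ t₀ ht₀.2.le]
    congr 2
    funext i
    unfold linVec
    split_ifs with hi
    · rw [hk' i hi, Int.cast_zero, lin_slope_zero, lin_slope_zero]
    · rfl
  have hsub : M.openEdge e ⊆ MulAction.orbit K (M.param e t₀) := by
    rintro _ ⟨t, ht, rfl⟩
    exact MulAction.mem_orbit_iff.2 (hinj.exists_smul_eq (hconst t ht).symm)
  have hinf : (M.openEdge e).Infinite := (Ioo_infinite (M.len_pos e)).image
    fun s hs t ht hst => (M.param_inj _ _ _ _ hs ht hst).2
  exact hinf ((Set.finite_range _).subset hsub)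

end RationalMaps

namespace GraphModel

variable {X : Type*} [TopologicalSpace X] {M N : GraphModel X}

/-! ### Barycentric subdivision -/

/-- The parameter of a point in the middle of an edge. -/
def midParam (M : GraphModel X) (e : M.E) : ℝ≥0∞ := if M.len e = ∞ then 1 else M.len e / 2

lemma midParam_mem (M : GraphModel X) (e : M.E) : M.midParam e ∈ Ioo 0 (M.len e) := by
  unfold midParam
  split_ifs with h
  · rw [h]
    simp
  · exact ⟨ENNReal.half_pos (M.len_pos e).ne', ENNReal.half_lt_self (M.len_pos e).ne' h⟩

/-- The point in the middle of an edge. -/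
def midPoint (M : GraphModel X) (e : M.E) : X := M.param e (M.midParam e)

/-- An edge of the barycentric subdivision joins an old vertex and the middle of an edge. -/
lemma Refinement.not_mem_iff_mem [DecidableEq X] (r : Refinement N M)
    (hN : N.V = M.V ∪ Finset.univ.image M.midPoint) (e : N.E) :
    ¬(N.param e 0 ∈ M.V ↔ N.param e (N.len e) ∈ M.V) := by
  set e₀ := r.under e
  set c := M.midParam e₀
  have hc : c ∈ Ioo 0 (M.len e₀) := M.midParam_mem e₀
  have hcV : M.param e₀ c ∈ N.V := by
    rw [hN]
    exact Finset.mem_union_right _ (Finset.mem_image_of_mem M.midPoint (Finset.mem_univ e₀))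
  have hmid : ∀ t ∈ Ioo 0 (M.len e₀), M.param e₀ t ∈ N.V → t = c := by
    intro t ht h
    rw [hN, Finset.mem_union] at h
    obtain ⟨e', -, he'⟩ := Finset.mem_image.1 (h.resolve_left (M.param_not_mem e₀ t ht))
    obtain ⟨rfl, h2⟩ := M.param_inj _ _ _ _ (M.midParam_mem e') ht he'
    exact h2.symm
  have h0 : N.param e 0 = M.param e₀ (r.off e) := by simpa using r.param_eq e 0 bot_le
  have h1 : N.param e (N.len e) = M.param e₀ (r.off e + N.len e) := r.param_eq e _ le_rfl
  have hV0 : M.param e₀ (r.off e) ∈ N.V := h0 ▸ N.param_zero_mem e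
  have hV1 : M.param e₀ (r.off e + N.len e) ∈ N.V := h1 ▸ N.param_len_mem e
  have hlt : r.off e < r.off e + N.len e :=
    ENNReal.lt_add_right (r.off_ne_top e) (N.len_pos e).ne'
  have hle := r.off_add_le e
  -- The midpoint is a vertex of `N`, so the segment lies on one side of it. As `c` is the only
  -- interior parameter giving a vertex of `N`, one end of the segment is the midpoint and the other
  -- is an end of `e₀`.
  have hout : c ≤ r.off e ∨ r.off e + N.len e ≤ c := by
    by_contra! hcon
    have hIoo : c - r.off e ∈ Ioo 0 (N.len e) := by
      refine ⟨tsub_pos_of_lt hcon.1, ?_⟩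
      refine (ENNReal.sub_lt_iff_lt_right (r.off_ne_top e) hcon.1.le).2 ?_
      rw [add_comm]
      exact hcon.2
    refine N.param_not_mem e _ hIoo ?_
    rw [r.param_eq e _ hIoo.2.le, add_tsub_cancel_of_le hcon.1.le]
    exact hcV
  rw [h0, h1]
  rcases hout with h | h
  · have hoc : r.off e = c := hmid _ ⟨hc.1.trans_le h, hlt.trans_le hle⟩ hV0
    have hend : r.off e + N.len e = M.len e₀ := by
      by_contra hne
      have := hmid _ ⟨(hc.1.trans_le h).trans hlt, lt_of_le_of_ne hle hne⟩ hV1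
      rw [this, hoc] at hlt
      exact hlt.false
    rw [hend, hoc]
    exact fun hiff => M.param_not_mem e₀ c hc (hiff.2 (M.param_len_mem e₀))
  · have hoc : r.off e + N.len e = c :=
      hmid _ ⟨bot_le.trans_lt hlt, h.trans_lt hc.2⟩ hV1
    have hstart : r.off e = 0 := by
      by_contra hne
      have := hmid _ ⟨pos_iff_ne_zero.2 hne, hlt.trans_le hle⟩ hV0
      rw [hoc, this] at hlt
      exact hlt.false
    rw [hoc, hstart]
    exact fun hiff => M.param_not_mem e₀ c hc (hiff.1 (M.param_zero_mem e₀))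

/-! ### Models on which a group acts without inversions -/

section Action

variable {K : Type*} [Group K] [MulAction K X]

/-- Reversal fixes the midpoint of a finite edge. Infinite edges cannot be reversed, so there the
arbitrary parameter `1` serves. -/
lemma MapsEdge.smul_midPoint {σ : K} {e e' : M.E} (h : M.MapsEdge σ e e') :
    σ • M.midPoint e = M.midPoint e' := by
  have hlt := (M.midParam_mem e).2.le
  have hmid : M.midParam e' = M.midParam e := by simp only [midParam, h.1]
  obtain ⟨hl, h | ⟨hf, h⟩⟩ := h
  · rw [midPoint, h _ hlt, midPoint, hmid]
  · rw [midPoint, h _ hlt, midPoint, hmid, midParam, if_neg hf, ENNReal.sub_half hf]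

lemma MapsEdge.smul_edge {σ : K} {e e' : M.E} (h : M.MapsEdge σ e e') :
    σ • M.edge e = M.edge e' := by
  obtain ⟨hl, h | ⟨hf, h⟩⟩ := h
  · rw [edge, edge, ← hl, ← image_smul, image_image]
    exact image_congr fun t ht => h t ht.2
  · rw [edge, edge, ← hl, ← image_smul, image_image]
    ext x
    constructor
    · rintro ⟨t, ht, rfl⟩
      exact ⟨M.len e - t, ⟨bot_le, tsub_le_self⟩, (h t ht.2).symm⟩
    · rintro ⟨t, ht, rfl⟩
      refine ⟨M.len e - t, ⟨bot_le, tsub_le_self⟩, ?_⟩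
      dsimp only
      rw [h _ tsub_le_self, ENNReal.sub_sub_cancel hf ht.2]

lemma openEdge_subset_edge (e : M.E) : M.openEdge e ⊆ M.edge e := image_mono Ioo_subset_Icc_self

lemma mem_openEdge_of_mem_edge {e : M.E} {x : X} (h : x ∈ M.edge e) (hx : x ∉ M.V) :
    x ∈ M.openEdge e := by
  obtain ⟨t, ht, rfl⟩ := h
  exact (M.param_mem_V_or ht.2).resolve_right hx

lemma edge_injective (M : GraphModel X) : Function.Injective M.edge := by
  intro e e' h
  obtain ⟨x, hx⟩ := M.openEdge_nonempty e
  exact eq_of_mem_openEdge hx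
    (mem_openEdge_of_mem_edge (h ▸ openEdge_subset_edge e hx) (not_mem_V_of_mem_openEdge hx))

/-- The group `K` acts on the graph `M`, and no edge is inverted: the invariant set `A` contains
exactly one end of every edge. -/
structure ActsWithoutInversion (K : Type*) [Group K] [MulAction K X] (M : GraphModel X)
    (A : Set X) : Prop where
  smul_mem_V : ∀ (σ : K), ∀ x ∈ M.V, σ • x ∈ M.V
  exists_mapsEdge : ∀ (σ : K) e, ∃ e', M.MapsEdge σ e e'
  smul_mem : ∀ (σ : K), ∀ x ∈ A, σ • x ∈ A
  not_iff : ∀ e, ¬(M.param e 0 ∈ A ↔ M.param e (M.len e) ∈ A)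

namespace ActsWithoutInversion

variable {A : Set X}

lemma mem_iff (h : ActsWithoutInversion K M A) (σ : K) (x : X) : σ • x ∈ A ↔ x ∈ A :=
  ⟨fun hx => by simpa using h.smul_mem σ⁻¹ _ hx, h.smul_mem σ x⟩

lemma mem_V_iff (h : ActsWithoutInversion K M A) (σ : K) (x : X) : σ • x ∈ M.V ↔ x ∈ M.V :=
  ⟨fun hx => by simpa using h.smul_mem_V σ⁻¹ _ hx, h.smul_mem_V σ x⟩

/-- A reversal would exchange the two ends, but only one of them lies in the invariant set `A`. So
an element that preserves an edge fixes it pointwise. -/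
lemma smul_param (h : ActsWithoutInversion K M A) {σ : K} {e : M.E} (he : M.MapsEdge σ e e)
    {t : ℝ≥0∞} (ht : t ≤ M.len e) : σ • M.param e t = M.param e t := by
  rcases he.2 with h1 | ⟨-, h1⟩
  · exact h1 t ht
  · have h2 := h1 0 bot_le
    rw [tsub_zero] at h2
    exact absurd ((h.mem_iff σ _).symm.trans (by rw [h2])) (h.not_iff e)

/-- Points of an edge in the same orbit are equal. -/
lemma eq_of_smul_eq (h : ActsWithoutInversion K M A) {σ : K} {e : M.E} {x y : X}
    (hx : x ∈ M.edge e) (hy : y ∈ M.edge e) (hxy : σ • x = y) : x = y := by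
  by_cases hxV : x ∈ M.V
  · have hyV : y ∈ M.V := hxy ▸ h.smul_mem_V σ x hxV
    have key : ∀ x ∈ M.edge e, x ∈ M.V → x = M.param e 0 ∨ x = M.param e (M.len e) := by
      rintro _ ⟨t, ht, rfl⟩ hV
      rcases GraphModel.mem_Ioo_or_ends ht.2 with h' | rfl | rfl
      · exact absurd hV (M.param_not_mem e t h')
      · exact Or.inl rfl
      · exact Or.inr rfl
    have hA : x ∈ A ↔ y ∈ A := hxy ▸ (h.mem_iff σ x).symm
    rcases key x hx hxV with h1 | h1 <;> rcases key y hy hyV with h2 | h2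
    · rw [h1, h2]
    · rw [h1, h2] at hA
      exact absurd hA (h.not_iff e)
    · rw [h1, h2] at hA
      exact absurd hA.symm (h.not_iff e)
    · rw [h1, h2]
  · obtain ⟨e', he'⟩ := h.exists_mapsEdge σ e
    have hx' := mem_openEdge_of_mem_edge hx hxV
    have hyV : y ∉ M.V := fun hV => hxV ((h.mem_V_iff σ x).1 (hxy ▸ hV))
    obtain rfl := eq_of_mem_openEdge (mem_openEdge_of_mem_edge hy hyV)
      (hxy ▸ he'.smul_mem_openEdge hx')
    obtain ⟨t, ht, rfl⟩ := hx
    rw [← hxy, h.smul_param he' ht.2]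

lemma mapsEdge_of_smul_edge (h : ActsWithoutInversion K M A) {σ : K} {e e' : M.E}
    (he : σ • M.edge e = M.edge e') : M.MapsEdge σ e e' := by
  obtain ⟨e₁, he₁⟩ := h.exists_mapsEdge σ e
  rwa [← M.edge_injective (he₁.smul_edge.symm.trans he)]

/-- Edges are equivalent when they are in the same orbit. -/
def edgeSetoid (K : Type*) [Group K] [MulAction K X] (M : GraphModel X) : Setoid M.E where
  r e e' := ∃ σ : K, σ • M.edge e = M.edge e'
  iseqv := ⟨fun e => ⟨1, one_smul _ _⟩, fun ⟨σ, hσ⟩ => ⟨σ⁻¹, by rw [← hσ, inv_smul_smul]⟩,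
    fun ⟨σ, hσ⟩ ⟨τ, hτ⟩ => ⟨τ * σ, by rw [mul_smul, hσ, hτ]⟩⟩

/-- The orbits of edges. -/
abbrev EdgeOrbits (K : Type*) [Group K] [MulAction K X] (M : GraphModel X) : Type :=
  Quotient (edgeSetoid K M)

/-- The orbit of an edge. -/
def orbitOf (K : Type*) [Group K] [MulAction K X] (M : GraphModel X) (e : M.E) :
    EdgeOrbits K M := Quotient.mk (edgeSetoid K M) e

lemma orbitOf_eq_iff {e e' : M.E} :
    orbitOf K M e = orbitOf K M e' ↔ ∃ σ : K, σ • M.edge e = M.edge e' :=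
  Quotient.eq (r := edgeSetoid K M)

lemma orbitOf_out (q : EdgeOrbits K M) : orbitOf K M q.out = q := Quotient.out_eq q

lemma exists_mapsEdge_out (h : ActsWithoutInversion K M A) (e : M.E) :
    ∃ σ : K, M.MapsEdge σ e (orbitOf K M e).out := by
  obtain ⟨σ, hσ⟩ := orbitOf_eq_iff.1 (orbitOf_out (orbitOf K M e)).symm
  exact ⟨σ, h.mapsEdge_of_smul_edge hσ⟩

lemma orbitOf_eq_of_mapsEdge {σ : K} {e e' : M.E} (he : M.MapsEdge σ e e') :
    orbitOf K M e = orbitOf K M e' := orbitOf_eq_iff.2 ⟨σ, he.smul_edge⟩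

section Quotient

variable {Z : Type*} [TopologicalSpace Z] {π : X → Z}

/-- `π` is a continuous surjection, the fibres of which are the orbits. -/
structure IsOrbitMap (K : Type*) [Group K] [MulAction K X] (π : X → Z) : Prop where
  continuous : Continuous π
  surjective : Function.Surjective π
  eq_iff : ∀ x y, π x = π y ↔ ∃ σ : K, σ • x = y

lemma IsOrbitMap.smul_eq (hπ : IsOrbitMap K π) (σ : K) (x : X) : π (σ • x) = π x :=
  ((hπ.eq_iff _ _).2 ⟨σ, rfl⟩).symm

lemma orbitOf_eq_of_map_eq (h : ActsWithoutInversion K M A) (hπ : IsOrbitMap K π) {e e' : M.E}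
    {x y : X} (hx : x ∈ M.openEdge e) (hy : y ∈ M.openEdge e') (hxy : π x = π y) :
    orbitOf K M e = orbitOf K M e' := by
  obtain ⟨σ, rfl⟩ := (hπ.eq_iff x y).1 hxy
  obtain ⟨e₁, he₁⟩ := h.exists_mapsEdge σ e
  rw [orbitOf_eq_of_mapsEdge he₁, eq_of_mem_openEdge (he₁.smul_mem_openEdge hx) hy]

open Classical in
/-- The quotient graph, as a model of the orbit space. -/
def quotientModel (h : ActsWithoutInversion K M A) (hπ : IsOrbitMap K π) : GraphModel Z where
  V := M.V.image π
  E := EdgeOrbits K M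
  fintypeE := Fintype.ofFinite _
  len q := M.len q.out
  param q t := π (M.param q.out t)
  len_pos q := M.len_pos _
  continuousOn_param q := hπ.continuous.comp_continuousOn (M.continuousOn_param _)
  param_zero_mem q := Finset.mem_image_of_mem π (M.param_zero_mem _)
  param_len_mem q := Finset.mem_image_of_mem π (M.param_len_mem _)
  param_not_mem q t ht hV := by
    obtain ⟨v, hv, hvt⟩ := Finset.mem_image.1 hV
    obtain ⟨σ, hσ⟩ := (hπ.eq_iff _ _).1 hvt
    exact M.param_not_mem _ t ht (hσ ▸ h.smul_mem_V σ v hv)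
  param_inj q q' t t' ht ht' htt := by
    have hq : q = q' := by
      rw [← orbitOf_out q, ← orbitOf_out q']
      exact h.orbitOf_eq_of_map_eq hπ ⟨t, ht, rfl⟩ ⟨t', ht', rfl⟩ htt
    subst hq
    obtain ⟨σ, hσ⟩ := (hπ.eq_iff _ _).1 htt
    have := h.eq_of_smul_eq ⟨t, Ioo_subset_Icc_self ht, rfl⟩ ⟨t', Ioo_subset_Icc_self ht', rfl⟩ hσ
    exact ⟨rfl, (M.param_inj _ _ _ _ ht ht' this).2⟩
  cover z := by
    obtain ⟨x, rfl⟩ := hπ.surjective z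
    by_cases hx : x ∈ M.V
    · exact Or.inl (Finset.mem_image_of_mem π hx)
    · obtain ⟨e, he⟩ := M.exists_openEdge hx
      obtain ⟨σ, hσ⟩ := h.exists_mapsEdge_out e
      obtain ⟨t, ht, hte⟩ := hσ.smul_mem_openEdge he
      exact Or.inr ⟨_, t, ht, by rw [hte, hπ.smul_eq]⟩
  infinite_leaf q hq q' := by
    have key : ∀ t ≤ M.len q'.out, π (M.param q'.out t) = π (M.param q.out ∞) →
        ∃ (σ : K) (e : M.E), M.MapsEdge σ q'.out e ∧
          σ • M.param q'.out t = M.param q.out ∞ := by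
      intro t _ heq
      obtain ⟨σ, hσ⟩ := (hπ.eq_iff _ _).1 heq
      obtain ⟨e, he⟩ := h.exists_mapsEdge σ q'.out
      exact ⟨σ, e, he, hσ⟩
    have hrev : ∀ e, M.param e (M.len e) = M.param q.out ∞ → M.len e = ∞ := fun e he => by
      rw [(M.infinite_leaf _ hq e).2 he, hq]
    refine ⟨fun heq => ?_, fun heq => ?_⟩
    · obtain ⟨σ, e, he, hσ⟩ := key 0 bot_le heq
      obtain ⟨hl, h1 | ⟨hf, h1⟩⟩ := he <;> rw [h1 0 bot_le] at hσ
      · exact (M.infinite_leaf _ hq e).1 hσ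
      · rw [tsub_zero, hl] at hσ
        exact hf (hl.trans (hrev e hσ))
    · obtain ⟨σ, e, he, hσ⟩ := key _ le_rfl heq
      obtain ⟨hl, h1 | ⟨hf, h1⟩⟩ := id he <;> rw [h1 _ le_rfl] at hσ
      · rw [hl] at hσ
        rw [← orbitOf_out q, ← orbitOf_out q', orbitOf_eq_of_mapsEdge he,
          (M.infinite_leaf _ hq e).2 hσ]
      · rw [tsub_self] at hσ
        exact absurd hσ (M.infinite_leaf _ hq e).1

lemma mem_edge_quotientModel_iff (h : ActsWithoutInversion K M A) (hπ : IsOrbitMap K π) {x : X}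
    {q : EdgeOrbits K M} :
    π x ∈ (h.quotientModel hπ).edge q ↔ ∃ e, x ∈ M.edge e ∧ orbitOf K M e = q := by
  constructor
  · rintro ⟨t, ht, hte⟩
    obtain ⟨σ, hσ⟩ := (hπ.eq_iff _ _).1 hte
    obtain ⟨e, he⟩ := h.exists_mapsEdge σ q.out
    refine ⟨e, ?_, by rw [← orbitOf_eq_of_mapsEdge he, orbitOf_out]⟩
    rw [← he.smul_edge, ← hσ]
    exact smul_mem_smul_set ⟨t, ht, rfl⟩
  · rintro ⟨e, he, rfl⟩
    obtain ⟨σ, hσ⟩ := h.exists_mapsEdge_out e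
    have : σ • x ∈ M.edge (orbitOf K M e).out := hσ.smul_edge ▸ smul_mem_smul_set he
    obtain ⟨t, ht, hte⟩ := this
    exact ⟨t, ht, by rw [← hπ.smul_eq σ x, ← hte]; rfl⟩

/-- The orbit map is a finite morphism, and has degree one on every edge. -/
def quotientMorphism (h : ActsWithoutInversion K M A) (hπ : IsOrbitMap K π) :
    FiniteMorphism M (h.quotientModel hπ) π where
  edgeMap := orbitOf K M
  deg _ := 1
  deg_pos _ := one_pos
  continuous := hπ.continuous
  map_vertex x hx := by
    classical
    simp only [quotientModel, Finset.mem_image]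
    exact ⟨x, hx, rfl⟩
  preimage_interior q := by
    ext x
    simp only [mem_preimage, mem_iUnion, exists_prop]
    constructor
    · rintro ⟨t, ht, hte⟩
      obtain ⟨σ, hσ⟩ := (hπ.eq_iff _ _).1 hte
      obtain ⟨e, he⟩ := h.exists_mapsEdge σ q.out
      refine ⟨e, ?_, ?_⟩
      · exact (orbitOf_eq_of_mapsEdge he).symm.trans (orbitOf_out q)
      · rw [← hσ]
        exact he.smul_mem_openEdge ⟨t, ht, rfl⟩
    · rintro ⟨e, rfl, hx⟩
      obtain ⟨σ, hσ⟩ := h.exists_mapsEdge_out e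
      obtain ⟨t, ht, hte⟩ := hσ.smul_mem_openEdge hx
      exact ⟨t, ht, by rw [← hπ.smul_eq σ x, ← hte]; rfl⟩
  len_edgeMap e := by
    obtain ⟨σ, hσ⟩ := h.exists_mapsEdge_out e
    rw [Nat.cast_one, one_mul]
    exact hσ.1.symm
  dilation e := by
    obtain ⟨σ, hl, hσ⟩ := h.exists_mapsEdge_out e
    simp only [Nat.cast_one, one_mul]
    refine hσ.imp (fun h1 t ht => ?_) fun h1 => ⟨h1.1, fun t ht => ?_⟩
    · rw [← hπ.smul_eq σ, h1 t ht]
      rfl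
    · rw [← hπ.smul_eq σ, h1.2 t ht, hl]
      rfl

end Quotient

end ActsWithoutInversion

end Action

end GraphModel

namespace GraphModel.ActsWithoutInversion

variable {X : Type*} [TopologicalSpace X] {M : GraphModel X} {K : Type*} [Group K] [MulAction K X]
  {A : Set X} {Z : Type*} [TopologicalSpace Z] {π : X → Z}

/-! ### The Galois property of quotient maps -/

lemma card_stabilizer_smul {α : Type*} [MulAction K α] (σ : K) (x : α) :
    Nat.card (MulAction.stabilizer K (σ • x)) = Nat.card (MulAction.stabilizer K x) :=
  (Nat.card_congr (MulAction.stabilizerEquivStabilizer (rfl : σ • x = σ • x)).toEquiv).symm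

open Classical in
/-- The stabilizer of a point acts transitively on the edges of a given orbit which contain it. -/
lemma card_stabilizer_eq [Finite K] (h : ActsWithoutInversion K M A) {x : X} {e₀ : M.E}
    (hx : x ∈ M.edge e₀) : Nat.card (MulAction.stabilizer K x) =
      (Finset.univ.filter fun e => x ∈ M.edge e ∧ orbitOf K M e = orbitOf K M e₀).card *
        Nat.card (MulAction.stabilizer K (M.edge e₀)) := by
  cases nonempty_fintype K
  choose act hact using h.exists_mapsEdge
  have hact' : ∀ σ e, act σ e₀ = e ↔ σ • M.edge e₀ = M.edge e := fun σ e =>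
    ⟨fun he => he ▸ (hact σ e₀).smul_edge,
      fun he => M.edge_injective ((hact σ e₀).smul_edge.symm.trans he)⟩
  have hstab_card : Nat.card (MulAction.stabilizer K (M.edge e₀)) =
      (Finset.univ.filter fun σ : K => σ • M.edge e₀ = M.edge e₀).card := by
    rw [Nat.card_eq_fintype_card, ← Fintype.card_subtype]
    rfl
  rw [Nat.card_eq_fintype_card (α := MulAction.stabilizer K x)]
  have hx_card : Fintype.card (MulAction.stabilizer K x) =
      (Finset.univ.filter fun σ : K => σ • x = x).card := by
    rw [← Fintype.card_subtype]
    exact Fintype.card_congr (Equiv.refl _)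
  -- The stabilizer of `x` is sorted by the image of `e₀`. Each fibre is a coset of the stabilizer
  -- of `e₀`, which fixes `x` since edges are not inverted.
  rw [hx_card, Finset.card_eq_sum_card_fiberwise (f := fun σ => act σ e₀)
    (t := Finset.univ.filter fun e => x ∈ M.edge e ∧ orbitOf K M e = orbitOf K M e₀),
    Finset.sum_const_nat]
  · intro e he
    obtain ⟨hxe, hq⟩ := (Finset.mem_filter.1 he).2
    obtain ⟨τ, hτ⟩ := orbitOf_eq_iff.1 hq.symm
    rw [hstab_card]
    refine Finset.card_nbij' (τ⁻¹ * ·) (τ * ·) ?_ ?_ ?_ ?_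
    · intro σ hσ
      simp only [Finset.coe_filter, Finset.mem_filter, Finset.mem_univ, true_and,
        mem_ofPred_eq] at hσ ⊢
      rw [mul_smul, (hact' _ _).1 hσ.2, ← hτ, inv_smul_smul]
    · intro σ hσ
      simp only [Finset.coe_filter, Finset.mem_filter, Finset.mem_univ, true_and,
        mem_ofPred_eq] at hσ ⊢
      have h1 : (τ * σ) • M.edge e₀ = M.edge e := by rw [mul_smul, hσ, hτ]
      refine ⟨?_, (hact' _ _).2 h1⟩
      have hxm : x ∈ (τ * σ) • M.edge e₀ := h1 ▸ hxe
      obtain ⟨y, hy, hyx⟩ := hxm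
      have hyx' : (τ * σ) • y = x := hyx
      have := h.eq_of_smul_eq hy hx hyx'
      rwa [this] at hyx'
    · intro σ _
      simp
    · intro σ _
      simp
  · intro σ hσ
    simp only [Finset.coe_filter, Finset.mem_univ, true_and, mem_ofPred_eq] at hσ ⊢
    refine ⟨?_, (orbitOf_eq_of_mapsEdge (hact σ e₀)).symm⟩
    have h1 := smul_mem_smul_set (a := σ) hx
    rwa [(hact σ e₀).smul_edge, hσ] at h1

/-- The multiplicity of an edge of the quotient: the order of the stabilizer of an edge above. -/
def quotientMult [Finite K] (q : EdgeOrbits K M) : ℕ+ :=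
  ⟨Nat.card (MulAction.stabilizer K (M.edge q.out)), Nat.card_pos⟩

lemma quotientMult_orbitOf [Finite K] (e : M.E) :
    (quotientMult (orbitOf K M e) : ℕ) = Nat.card (MulAction.stabilizer K (M.edge e)) := by
  obtain ⟨σ, hσ⟩ := orbitOf_eq_iff.1 (orbitOf_out (orbitOf K M e)).symm
  rw [← card_stabilizer_smul σ (M.edge e), hσ]
  rfl

/-- Each edge at `x` in the orbit `q` contributes the order of its stabilizer, and
`card_stabilizer_eq` adds these up. The result does not involve `q`, which is harmonicity. -/
lemma degAt_quotientMorphism [Finite K] (h : ActsWithoutInversion K M A) (hπ : IsOrbitMap K π)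
    {x : X} {q : EdgeOrbits K M} (hx : π x ∈ (h.quotientModel hπ).edge q) :
    (h.quotientMorphism hπ).degAt (fun _ => 1) (quotientMult (K := K)) x q =
      Nat.card (MulAction.stabilizer K x) := by
  classical
  obtain ⟨e₀, he₀, rfl⟩ := (h.mem_edge_quotientModel_iff hπ).1 hx
  rw [h.card_stabilizer_eq he₀, ← quotientMult_orbitOf]
  unfold FiniteMorphism.degAt
  refine (Finset.sum_const_nat (m := (quotientMult (orbitOf K M e₀) : ℕ)) fun e _ => ?_).trans ?_
  · simp [quotientMorphism]
  · congr 2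
    ext e
    simp only [Finset.mem_filter]
    exact Iff.rfl

/-- A fibre is an orbit, with `|K| / |K_x|` points each of local degree `|K_x|`. -/
theorem isGalois_quotientMorphism [Finite K] (h : ActsWithoutInversion K M A)
    (hπ : IsOrbitMap K π) :
    (h.quotientMorphism hπ).IsGalois K (fun _ => 1) (quotientMult (K := K)) where
  harmonic x := ⟨fun e _ => by simp, fun e₁ e₂ h₁ h₂ => by
    rw [h.degAt_quotientMorphism hπ h₁, h.degAt_quotientMorphism hπ h₂]⟩
  degree z q hz := by
    obtain ⟨x, rfl⟩ := hπ.surjective z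
    have hfib : π ⁻¹' {π x} = MulAction.orbit K x := by
      ext y
      rw [mem_preimage, mem_singleton_iff, eq_comm, hπ.eq_iff]
      rfl
    have hval : ∀ y ∈ MulAction.orbit K x,
        (h.quotientMorphism hπ).degAt (fun _ => 1) (quotientMult (K := K)) y q =
          Nat.card (MulAction.stabilizer K x) := by
      rintro _ ⟨σ, rfl⟩
      have h1 : π (σ • x) ∈ (h.quotientModel hπ).edge q := by rwa [hπ.smul_eq]
      exact (h.degAt_quotientMorphism hπ h1).trans (card_stabilizer_smul σ x)
    have hfin : (MulAction.orbit K x).Finite := Set.finite_range _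
    rw [hfib, finsum_mem_congr rfl hval, finsum_mem_eq_finite_toFinset_sum _ hfin,
      Finset.sum_const, smul_eq_mul, ← Set.ncard_eq_toFinset_card _ hfin,
      ← MulAction.index_stabilizer, mul_comm, Subgroup.card_mul_index]
  invariant σ x := hπ.smul_eq σ x
  transitive x y hxy := (hπ.eq_iff x y).1 hxy
  keeps σ e := by
    obtain ⟨e', he'⟩ := h.exists_mapsEdge σ e
    exact ⟨e', he'.smul_edge, he'.1.symm, rfl⟩

lemma loopless (h : ActsWithoutInversion K M A) : M.Loopless := fun e he =>
  h.not_iff e (by rw [he])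

/-- The invariant set `A` separates the two ends of an edge, so they are in different orbits. -/
lemma loopless_quotientModel (h : ActsWithoutInversion K M A) (hπ : IsOrbitMap K π) :
    (h.quotientModel hπ).Loopless := by
  intro q hq
  obtain ⟨σ, hσ⟩ := (hπ.eq_iff _ _).1 hq
  have h1 := h.mem_iff σ (M.param q.out 0)
  rw [hσ] at h1
  exact h.not_iff _ h1.symm

end GraphModel.ActsWithoutInversion

/-! ### The main results -/

section Main

variable {Γ : Type*} [TopologicalSpace Γ] [MetricGraph Γ] {K : Type*} [Group K] [Finite K]
  [MulAction K Γ] [ContinuousConstSMul K Γ] {D : Γ →₀ ℤ} {n : ℕ} {F : Fin (n + 1) → Γ → EReal}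

theorem KInjective.isLocalIsometry
    (hK : ∀ (σ : K) (x y : Γ), MetricGraph.d (σ • x) (σ • y) = MetricGraph.d x y)
    (hD : 0 ≤ D) (hF : Generates K D F) (hinj : KInjective K (rationalMap F)) :
    IsLocalIsometry (rationalMap F) := by
  obtain ⟨M, a, m, h⟩ := exists_isAdapted hF
  exact ⟨M, h.isModel, fun e s hs t ht => h.latticeDist_eq hF hD hK hinj e hs ht⟩

/-- The model used is the barycentric subdivision `B` of an adapted model `M`, with the vertices of
`M` as the set `A`. Lattice lengths pass to `B` because its edges are segments of edges of `M`. -/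
theorem KInjective.inducesGaloisCovering
    (hK : ∀ (σ : K) (x y : Γ), MetricGraph.d (σ • x) (σ • y) = MetricGraph.d x y)
    (hD : 0 ≤ D) (hF : Generates K D F) (hinj : KInjective K (rationalMap F)) :
    InducesGaloisCovering K (rationalMap F) := by
  classical
  have := MetricGraph.t2 (Γ := Γ)
  obtain ⟨M, a, m, h⟩ := exists_isAdapted hF
  obtain ⟨B, hB, ⟨r⟩⟩ := M.exists_refinement (Finset.univ.image M.midPoint)
  have hBm : IsModel B := r.dist_eq.trans h.isModel
  have hBV : ∀ (σ : K), ∀ x ∈ B.V, σ • x ∈ B.V := by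
    intro σ x hx
    rw [hB] at hx ⊢
    rcases Finset.mem_union.1 hx with hx | hx
    · exact Finset.mem_union_left _ (h.smul_mem σ x hx)
    · obtain ⟨e, -, rfl⟩ := Finset.mem_image.1 hx
      obtain ⟨e', he'⟩ := h.exists_mapsEdge hK σ e
      exact Finset.mem_union_right _
        (Finset.mem_image.2 ⟨e', Finset.mem_univ _, he'.smul_midPoint.symm⟩)
  have hact : GraphModel.ActsWithoutInversion K B (M.V : Set Γ) :=
    { smul_mem_V := hBV
      exists_mapsEdge := B.exists_mapsEdge
        (fun σ x y => by rw [show B.dist = MetricGraph.d from hBm, hK]) hBV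
      smul_mem := h.smul_mem
      not_iff := r.not_mem_iff_mem hB }
  have hπ : GraphModel.ActsWithoutInversion.IsOrbitMap K (rangeFactorization (rationalMap F)) :=
    { continuous := (h.exists_rationalMap_eq hF hD).1.subtype_mk _
      surjective := rangeFactorization_surjective
      eq_iff := fun x y => by
        rw [Subtype.ext_iff]
        refine ⟨fun hxy => hinj.exists_smul_eq hxy, ?_⟩
        rintro ⟨σ, rfl⟩
        exact (h.rationalMap_smul hF hD σ x).symm }
  refine ⟨B, hact.quotientModel hπ, hBm, hact.loopless, fun q s hs t ht => ?_,
    hact.loopless_quotientModel hπ, _, hact.quotientMorphism hπ,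
    hact.isGalois_quotientMorphism hπ, fun e =>
      GraphModel.ActsWithoutInversion.quotientMult_orbitOf e⟩
  have hle : ∀ t ≤ B.len q.out, r.off q.out + t ≤ M.len (r.under q.out) := fun t ht =>
    (add_le_add_right ht _).trans (r.off_add_le _)
  have := h.latticeDist_eq hF hD hK hinj (r.under q.out) (hle s hs) (hle t ht)
  rw [segLen_add_left (r.off_ne_top _), ← r.param_eq _ s hs, ← r.param_eq _ t ht] at this
  exact this

end Main

end TropicalGraph

end

theorem mainTheorem2 {Γ : Type*} [TopologicalSpace Γ] [TropicalGraph.MetricGraph Γ]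
    {K : Type*} [Group K] [Finite K] [MulAction K Γ] [ContinuousConstSMul K Γ]
    (hK : ∀ (σ : K) (x y : Γ),
      TropicalGraph.MetricGraph.d (σ • x) (σ • y) = TropicalGraph.MetricGraph.d x y)
    (D : Γ →₀ ℤ) (hD : 0 ≤ D) (hDK : ∀ (σ : K) (x : Γ), D (σ • x) = D x)
    (n : ℕ) (F : Fin (n + 1) → Γ → EReal) (hF : TropicalGraph.Generates K D F) :
    (TropicalGraph.KInjective K (TropicalGraph.rationalMap F) →
      TropicalGraph.IsLocalIsometry (TropicalGraph.rationalMap F)) ∧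
    (TropicalGraph.InducesGaloisCovering K (TropicalGraph.rationalMap F) ↔
      TropicalGraph.KInjective K (TropicalGraph.rationalMap F)) := by
  refine ⟨fun h => h.isLocalIsometry hK hD hF, ?_, fun h => h.inducesGaloisCovering hK hD hF⟩
  -- Only transitivity on the fibres is needed here.
  rintro ⟨M, M', -, -, -, -, m', ψ, hψ, -⟩ x y hxy h
  obtain ⟨σ, rfl⟩ := hψ.transitive x y (Subtype.ext h)
  exact hxy (MulAction.orbit_smul σ x).symm
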